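/- Let $\mathbb R^2_+=\{x\in\mathbb R^2: x_2>0\}$ and, for $\gamma\in(0,\infty)$, let $\mathscr D_0$ be the operator in $L^2(\mathbb R^2_+,\mathbb C^2)$ acting as $-i(\sigma_1\partial_1+\sigma_2\partial_2)$, where $\sigma_1=\begin{pmatrix}0&1\\1&0\end{pmatrix}$ and $\sigma_2=\begin{pmatrix}0&-i\\i&0\end{pmatrix}$, with domain $\{\psi\in H^1(\mathbb R^2_+,\mathbb C^2):\ \psi_2=\gamma\psi_1 \text{ on } x_2=0\}$ (in the sense of traces). For a $2\times2$ matrix $A$ put $|A|=\max_{j,k}|A_{jk}|$, and let $|x-x'|$ be the Euclidean distance. For every $\gamma\in(0,\infty)$ and $\lambda\in\mathbb R\setminus\{0\}$, the resolvent $(\mathscr D_0-i\lambda)^{-1}$ exists as a bounded operator and has an integral kernel $(\mathscr D_0-i\lambda)^{-1}(x,x')$ that is continuous on $\{(x,x')\in\mathbb R^2_+\times\mathbb R^2_+: x\neq x'\}$. Explicitly, with $\langle\xi\rangle=\sqrt{1+\xi^2}$, $$K^{\mathbb R}_{0,\xi}(z)=\frac{e^{-\langle\xi\rangle|z|}}{2\langle\xi\rangle}\begin{pmatrix}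 i&\xi+\langle\xi\rangle\,\mathrm{sign}(z)\\ \xi-\langle\xi\rangle\,\mathrm{sign}(z)&i\end{pmatrix},\qquad \alpha(\xi)=\frac{\gamma+i(\langle\xi\rangle+\xi)}{1+i\gamma(\langle\xi\rangle+\xi)},$$ $$K_0(x,x')=\frac1{2\pi}\int_{\mathbb R}e^{i\xi(x_1-x_1')}\Big(K^{\mathbb R}_{0,\xi}(x_2-x_2')+\alpha(\xi)K^{\mathbb R}_{0,\xi}(x_2+x_2')\sigma_1\Big)\,\mathrm d\xi\qquad(x_2\ne x_2'),$$ one has $(\mathscr D_0-i\lambda)^{-1}(x,x')=\lambda K_0(\lambda x,\lambda x')$ for $\lambda>0$ and $x_2\neq x_2'$, and $(\mathscr D_0-i\lambda)^{-1}(x,x')$ is the conjugate transpose of $(\mathscr D_0+i\lambda)^{-1}(x',x)$ for $\lambda<0$ and $x\ne x'$. For all $c\in(0,1)$ and $\gamma\in(0,\infty)$ there is a constant $C(\gamma,c)$ such that for all $\lambda\in\mathbb R\setminus\{0\}$ and all $x,x'\in\mathbb R^2_+$ with $x\neq x'$, $$\big|(\mathscr D_0-i\lambda)^{-1}(x,x')\big|\le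 C(\gamma,c)\,\frac{e^{-c|\lambda||x-x'|}}{|x-x'|}.$$ Moreover, any constants $C(\gamma,c)$ with this property satisfy $C(\gamma,c)\to\infty$ as $\gamma\to0^+$ and as $\gamma\to\infty$, for each fixed $c\in(0,1)$, and as $c\to1^-$, for each fixed $\gamma\in(0,\infty)$. -/

import Mathlib

open MeasureTheory Filter Topology Set
open scoped ContDiff Matrix

noncomputable section

namespace HalfPlaneDirac

/-! ### The half-plane and its spinors -/

/-- The open half-plane `x₂ > 0`. -/
def halfPlane : Set (ℝ × ℝ) := {x | 0 < x.2}

/-- The Euclidean distance of two points of the plane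
(the metric that `ℝ × ℝ` carries by default is the sup metric). -/
def euclDist (x x' : ℝ × ℝ) : ℝ := Real.sqrt ((x.1 - x'.1) ^ 2 + (x.2 - x'.2) ^ 2)

/-- `ℂ²` with its Hilbert space structure. -/
abbrev Spinor : Type := EuclideanSpace ℂ (Fin 2)

/-- The Hilbert space `L²(ℝ²₊, ℂ²)`. -/
abbrev L2Spinor : Type := Lp Spinor 2 ((volume : Measure (ℝ × ℝ)).restrict halfPlane)

/-- The matrix `A` applied to the spinor `v`. -/
def act (A : Matrix (Fin 2) (Fin 2) ℂ) (v : Spinor) : Spinor :=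
  WithLp.toLp 2 (A *ᵥ v.ofLp)

/-- The largest modulus of an entry. -/
def matSup (A : Matrix (Fin 2) (Fin 2) ℂ) : ℝ := ⨆ p : Fin 2 × Fin 2, ‖A p.1 p.2‖

/-- The first Pauli matrix. -/
def σ₁ : Matrix (Fin 2) (Fin 2) ℂ := !![0, 1; 1, 0]

/-- The second Pauli matrix. -/
def σ₂ : Matrix (Fin 2) (Fin 2) ℂ := !![0, -Complex.I; Complex.I, 0]

/-! ### The Dirac operator with boundary condition `ψ₂ = γ ψ₁` -/

/-- `d ∈ L²` is the weak derivative of `u ∈ L²` on the half-plane in the direction `v`: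
`∫ (∂ᵥ φ) u = - ∫ φ d` for all test functions `φ` supported in the open half-plane. -/
def IsWeakDeriv (v : ℝ × ℝ) (u d : L2Spinor) : Prop :=
  ∀ φ : ℝ × ℝ → ℝ, ContDiff ℝ ∞ φ → HasCompactSupport φ → tsupport φ ⊆ halfPlane →
    ∫ x in halfPlane, (fderiv ℝ φ x v) • u x = - ∫ x in halfPlane, φ x • d x

/-- `τ ∈ L²(ℝ, ℂ²)` is the trace on the line `x₂ = 0` of a function `u` whose weak derivative
`∂₂ u` is `d₂`: Green's formula
`∫ (∂₂ φ) u + ∫ φ ∂₂ u = - ∫ φ(s, 0) τ(s) ds` holds for all test functions `φ` of the whole plane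
(which need not vanish at the boundary). -/
def IsTrace (u d₂ : L2Spinor) (τ : Lp Spinor 2 (volume : Measure ℝ)) : Prop :=
  ∀ φ : ℝ × ℝ → ℝ, ContDiff ℝ ∞ φ → HasCompactSupport φ →
    (∫ x in halfPlane, (fderiv ℝ φ x (0, 1)) • u x) + (∫ x in halfPlane, φ x • d₂ x)
      = - ∫ s : ℝ, φ (s, 0) • τ s

/-- The graph of the Dirac operator `𝒟₀ = σ · (-i∇)` (no magnetic field, no potential) with
boundary parameter `γ`: `u` lies in `H¹(ℝ²₊, ℂ²)`, its trace satisfies `τ₂ = γ τ₁`, and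
`f = -i (σ₁ ∂₁ u + σ₂ ∂₂ u)`. -/
def DiracGraph (γ : ℝ) (u f : L2Spinor) : Prop :=
  ∃ (d₁ d₂ : L2Spinor) (τ : Lp Spinor 2 (volume : Measure ℝ)),
    IsWeakDeriv (1, 0) u d₁ ∧ IsWeakDeriv (0, 1) u d₂ ∧ IsTrace u d₂ τ ∧
    (∀ᵐ s : ℝ, τ s 1 = (γ : ℂ) * τ s 0) ∧
    ∀ᵐ x ∂((volume : Measure (ℝ × ℝ)).restrict halfPlane),
      f x = (-Complex.I) • (act σ₁ (d₁ x) + act σ₂ (d₂ x))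

/-- The bounded operator `R` is `(𝒟₀ - z)⁻¹`: for all `u, f ∈ L²`, the function `u` lies in the
domain of `𝒟₀` and `𝒟₀ u - z u = f` if and only if `u = R f`. -/
def IsResolvent (γ : ℝ) (z : ℂ) (R : L2Spinor →L[ℂ] L2Spinor) : Prop :=
  ∀ u f : L2Spinor, DiracGraph γ u (f + z • u) ↔ u = R f

/-- `K` is an integral kernel of `R`. -/
def IsIntegralKernel (R : L2Spinor →L[ℂ] L2Spinor)
    (K : ℝ × ℝ → ℝ × ℝ → Matrix (Fin 2) (Fin 2) ℂ) : Prop :=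
  ∀ f : L2Spinor, ∀ᵐ x ∂((volume : Measure (ℝ × ℝ)).restrict halfPlane),
    IntegrableOn (fun x' => act (K x x') (f x')) halfPlane ∧
    R f x = ∫ x' in halfPlane, act (K x x') (f x')

/-- `K` is the kernel of `(𝒟₀ - z)⁻¹`: the resolvent exists as a bounded operator, `K` is an
integral kernel of it, and `K` is continuous away from the diagonal. The continuity fixes the
value of `K` at every pair of distinct points of the half-plane. -/
def IsResolventKernel (γ : ℝ) (z : ℂ) (K : ℝ × ℝ → ℝ × ℝ → Matrix (Fin 2) (Fin 2) ℂ) : Prop :=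
  (∃ R : L2Spinor →L[ℂ] L2Spinor, IsResolvent γ z R ∧ IsIntegralKernel R K) ∧
  ContinuousOn (fun p : (ℝ × ℝ) × (ℝ × ℝ) => K p.1 p.2)
    {p | p.1 ∈ halfPlane ∧ p.2 ∈ halfPlane ∧ p.1 ≠ p.2}

/-! ### The explicit kernel for `λ = 1` -/

/-- `⟨ξ⟩ = (1 + ξ²)^{1/2}`. -/
def bracket (ξ : ℝ) : ℝ := Real.sqrt (1 + ξ ^ 2)

/-- The kernel on the whole line of the fibre resolvent:
`K^ℝ_ξ(z) = e^{-⟨ξ⟩|z|} / (2⟨ξ⟩) * (i, ξ + ⟨ξ⟩ sign z; ξ - ⟨ξ⟩ sign z, i)`. -/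
def lineKernel (ξ z : ℝ) : Matrix (Fin 2) (Fin 2) ℂ :=
  ((Real.exp (-(bracket ξ * |z|)) / (2 * bracket ξ) : ℝ) : ℂ) •
    !![Complex.I, ((ξ + bracket ξ * Real.sign z : ℝ) : ℂ);
       ((ξ - bracket ξ * Real.sign z : ℝ) : ℂ), Complex.I]

/-- The boundary coefficient `α(ξ) = (γ + i(⟨ξ⟩ + ξ)) / (1 + iγ(⟨ξ⟩ + ξ))`. -/
def boundaryCoeff (γ ξ : ℝ) : ℂ :=
  ((γ : ℂ) + Complex.I * ((bracket ξ + ξ : ℝ) : ℂ)) /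
    (1 + Complex.I * (γ : ℂ) * ((bracket ξ + ξ : ℝ) : ℂ))

/-- The fibre kernel on the half-line, `K_ξ(t,t') = K^ℝ_ξ(t - t') + α(ξ) K^ℝ_ξ(t + t') σ₁`. -/
def fiberKernel (γ ξ t t' : ℝ) : Matrix (Fin 2) (Fin 2) ℂ :=
  lineKernel ξ (t - t') + boundaryCoeff γ ξ • (lineKernel ξ (t + t') * σ₁)

/-- The inverse partial Fourier transform of the fibre kernels, entry by entry:
`K₀(x,x') = (2π)⁻¹ ∫ e^{iξ(x₁ - x₁')} K_ξ(x₂,x₂') dξ`.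
For `x, x'` in the half-plane the integral is absolutely convergent when `x₂ ≠ x₂'`. -/
def freeKernel (γ : ℝ) (x x' : ℝ × ℝ) : Matrix (Fin 2) (Fin 2) ℂ :=
  fun j k => (1 / (2 * (Real.pi : ℂ))) *
    ∫ ξ : ℝ, Complex.exp (Complex.I * ((ξ * (x.1 - x'.1) : ℝ) : ℂ)) *
      fiberKernel γ ξ x.2 x'.2 j k

/-! ### The estimate -/

/-- The family `K γ λ` of kernels satisfies
`|K γ λ (x,x')| ≤ C(γ,c) e^{-c|λ||x-x'|} / |x-x'|` for all `γ > 0`, `c ∈ (0,1)`, `λ ≠ 0` and all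
distinct points `x, x'` of the half-plane. -/
def KernelBound (K : ℝ → ℝ → ℝ × ℝ → ℝ × ℝ → Matrix (Fin 2) (Fin 2) ℂ) (C : ℝ → ℝ → ℝ) : Prop :=
  ∀ γ : ℝ, 0 < γ → ∀ c ∈ Ioo (0 : ℝ) 1, ∀ lam : ℝ, lam ≠ 0 →
    ∀ x ∈ halfPlane, ∀ x' ∈ halfPlane, x ≠ x' →
      matSup (K γ lam x x') ≤ C γ c * (Real.exp (-(c * |lam| * euclDist x x')) / euclDist x x')

end HalfPlaneDirac

end

open HalfPlaneDirac

noncomputable section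

namespace HalfPlaneDirac

/-! ### Exponential integrals -/

/-! The substitution ξ = sinh s uniformises the explicit formula: ⟨ξ⟩ = cosh s, ⟨ξ⟩ + ξ = e^s and
dξ/⟨ξ⟩ = ds. At λ = 1 the entries of the kernel become, up to factors ±1 and i, sums of integrals
(4π)⁻¹ ∫ exp(i y₁ sinh s - y₂ cosh s) b(s) ds with b(s) = α e^{νs} and ν ∈ {-1, 0, 1}. The free part
has y = (x₁ - x₁', |x₂ - x₂'|) and α = 1, which is the case γ = 1; the boundary part has y = (x₁ -
x₁', x₂ + x₂').

Upper bound. With y₂ + i y₁ = r e^{iθ}, |θ| < π/2, the oscillating factor is exp(-r cosh(s - iθ)).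
Moving the line of integration to height θ would give the decay e^{-r cosh s}, but α has a pole on
Im z = π/2. Stopping at a fixed fraction of θ keeps the line away from the pole and still leaves
cos(angle) ≥ c' for any prescribed c' < 1 (`exists_norm_stripKernel_symb_le`). For γ = 1 there is no
pole, the full shift is allowed, and the free kernel is an explicit combination of Bessel functions,
continuous off the origin (`stripKernel_symb_one`). The mirror point is farther away than the point
itself, so the boundary part obeys the bound in |x - x'|.

The kernel inverts the operator. Under the partial Fourier transform -i∂₁ ∓ ∂₂ becomes
multiplication by ±e^{±s}, so it shifts ν by ±1, up to a jump term at y₂ = 0. The jumps of ν = 1 and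
ν = -1 add up to 2 cosh s, which Fourier inversion turns into the source; the boundary condition is
the defining equation of α. This solves the problem classically for test data. Scaling and the
antilinear symmetry u ↦ conj u(-x₁, x₂) give all λ ≠ 0. The Schur test makes the integral operator
bounded. An energy identity in which the boundary terms cancel (`BoundaryPair.energy_identity`)
controls the H¹ norm by the graph norm, so the range of the operator lies in the domain by density
(`diracGraph_resolvent`). Uniqueness is duality: testing a solution at iλ against classical
solutions at -iλ determines it (`ClassicalSol.inner_eq`).

Lower bounds. On the normal axis the free diagonal entries are purely imaginary, so the real part
isolates the boundary term. At distance γ from both the boundary and each other, the range γ e^s ∈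
[1, 2] contributes at least a multiple of γ⁻², against the permitted C/γ; hence C is at least a
multiple of 1/γ. The symmetry γ ↔ 1/γ, s ↔ -s handles γ → ∞. For c → 1 both points are moved away
from the boundary until only the Bessel function of order 1 remains; it is at least a multiple of
e^{-r}/√r, and r = 1/(1 - c) forces C to be at least a multiple of (1 - c)^{-1/2}. -/

theorem exp_abs_le_two_mul_cosh (s : ℝ) : Real.exp |s| ≤ 2 * Real.cosh s := by
  rw [← Real.cosh_abs, Real.cosh_eq]
  linarith [Real.exp_pos (-|s|)]

theorem hasDerivAt_neg_exp_neg_mul_exp_div {ρ : ℝ} (hρ : 0 < ρ) (s : ℝ) :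
    HasDerivAt (fun s => -(Real.exp (-(ρ * Real.exp s)) / ρ))
      (Real.exp s * Real.exp (-(ρ * Real.exp s))) s := by
  have h : HasDerivAt (fun s => -(Real.exp (-(ρ * Real.exp s)) / ρ))
      (-(Real.exp (-(ρ * Real.exp s)) * -(ρ * Real.exp s) / ρ)) s :=
    ((((Real.hasDerivAt_exp s).const_mul ρ).neg.exp).div_const ρ).neg
  convert h using 1
  have := hρ.ne'
  field_simp

theorem tendsto_neg_exp_neg_mul_exp_div {ρ : ℝ} (hρ : 0 < ρ) :
    Tendsto (fun s => -(Real.exp (-(ρ * Real.exp s)) / ρ)) atTop (𝓝 0) := by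
  have h : Tendsto (fun s => Real.exp (-(ρ * Real.exp s))) atTop (𝓝 0) :=
    Real.tendsto_exp_neg_atTop_nhds_zero.comp (Real.tendsto_exp_atTop.const_mul_atTop hρ)
  simpa using (h.div_const ρ).neg

theorem integral_exp_abs_mul_exp_neg_mul_exp_abs {ρ : ℝ} (hρ : 0 < ρ) :
    ∫ s : ℝ, Real.exp |s| * Real.exp (-(ρ * Real.exp |s|)) = 2 * (Real.exp (-ρ) / ρ) := by
  rw [integral_comp_abs (f := fun s => Real.exp s * Real.exp (-(ρ * Real.exp s))),
    integral_Ioi_of_hasDerivAt_of_nonneg'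
      (fun s _ => hasDerivAt_neg_exp_neg_mul_exp_div hρ s) (fun s _ => by positivity)
      (tendsto_neg_exp_neg_mul_exp_div hρ)]
  simp

/-- A non-integrable function has Bochner integral 0, while the formula above gives a positive
value. -/
theorem integrable_exp_abs_mul_exp_neg_mul_exp_abs {ρ : ℝ} (hρ : 0 < ρ) :
    Integrable fun s : ℝ => Real.exp |s| * Real.exp (-(ρ * Real.exp |s|)) := by
  by_contra h
  have h1 := integral_undef h
  rw [integral_exp_abs_mul_exp_neg_mul_exp_abs hρ] at h1
  have : 0 < 2 * (Real.exp (-ρ) / ρ) := by positivity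
  linarith

theorem exp_abs_mul_exp_neg_cosh_le {ρ : ℝ} (hρ : 0 < ρ) (s : ℝ) :
    Real.exp |s| * Real.exp (-(ρ * Real.cosh s)) ≤
      Real.exp |s| * Real.exp (-(ρ / 2 * Real.exp |s|)) := by
  refine mul_le_mul_of_nonneg_left (Real.exp_le_exp.2 ?_) (Real.exp_pos _).le
  nlinarith [exp_abs_le_two_mul_cosh s]

theorem integrable_exp_abs_mul_exp_neg_cosh {ρ : ℝ} (hρ : 0 < ρ) :
    Integrable fun s : ℝ => Real.exp |s| * Real.exp (-(ρ * Real.cosh s)) := by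
  refine (integrable_exp_abs_mul_exp_neg_mul_exp_abs (half_pos hρ)).mono'
    (by fun_prop) (Eventually.of_forall fun s => ?_)
  rw [Real.norm_of_nonneg (by positivity)]
  exact exp_abs_mul_exp_neg_cosh_le hρ s

/-- The rate is split as c' = c + (c' - c). The first part yields e^{-cr} because cosh ≥ 1; the
second absorbs the growth e^{|s|} and, after integration, costs a factor of order 1/((c' - c) r). -/
theorem integral_exp_abs_mul_exp_neg_cosh_le {c c' r : ℝ} (hr : 0 < r) (hc : 0 < c) (hcc : c < c') :
    ∫ s : ℝ, Real.exp |s| * Real.exp (-(r * c' * Real.cosh s)) ≤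
      4 / (c' - c) * (Real.exp (-(c * r)) / r) := by
  have hd : 0 < r * (c' - c) := mul_pos hr (sub_pos.2 hcc)
  calc ∫ s : ℝ, Real.exp |s| * Real.exp (-(r * c' * Real.cosh s))
      ≤ ∫ s : ℝ, Real.exp (-(c * r)) *
          (Real.exp |s| * Real.exp (-(r * (c' - c) / 2 * Real.exp |s|))) := by
        refine integral_mono
          (integrable_exp_abs_mul_exp_neg_cosh (mul_pos hr (hc.trans hcc)))
          ((integrable_exp_abs_mul_exp_neg_mul_exp_abs (half_pos hd)).const_mul _) fun s => ?_
        have h1 := exp_abs_mul_exp_neg_cosh_le hd s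
        calc Real.exp |s| * Real.exp (-(r * c' * Real.cosh s))
            = Real.exp (-(c * r * Real.cosh s)) *
                (Real.exp |s| * Real.exp (-(r * (c' - c) * Real.cosh s))) := by
              rw [mul_left_comm]
              congr 1
              rw [← Real.exp_add]
              ring_nf
          _ ≤ Real.exp (-(c * r)) *
                (Real.exp |s| * Real.exp (-(r * (c' - c) / 2 * Real.exp |s|))) := by
              refine mul_le_mul ?_ h1 (by positivity) (by positivity)
              refine Real.exp_le_exp.2 (neg_le_neg ?_)
              exact le_mul_of_one_le_right (by positivity) (Real.one_le_cosh s)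
    _ = Real.exp (-(c * r)) * (2 * (Real.exp (-(r * (c' - c) / 2)) / (r * (c' - c) / 2))) := by
        rw [integral_const_mul, integral_exp_abs_mul_exp_neg_mul_exp_abs (half_pos hd)]
    _ ≤ Real.exp (-(c * r)) * (2 * (1 / (r * (c' - c) / 2))) := by
        gcongr
        rw [Real.exp_le_one_iff]; linarith
    _ = 4 / (c' - c) * (Real.exp (-(c * r)) / r) := by
        have := sub_pos.2 hcc
        field_simp
        norm_num

/-! ### Shifting a line of integration -/

/-- Cauchy's theorem on the rectangle with base [-T, T] and height φ, of either sign. One majorant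
`h`, uniform in the height, serves twice: it is integrable along the horizontal sides and tends to 0
on the vertical ones. -/
theorem integral_eq_integral_add_mul_I {F : ℂ → ℂ} {h : ℝ → ℝ} (φ : ℝ)
    (hF : ∀ z : ℂ, z.im ∈ uIcc 0 φ → DifferentiableAt ℂ F z)
    (hh : Integrable h) (htop : Tendsto h atTop (𝓝 0)) (hbot : Tendsto h atBot (𝓝 0))
    (hb : ∀ s : ℝ, ∀ t ∈ uIcc 0 φ, ‖F (s + t * Complex.I)‖ ≤ h s) :
    ∫ s : ℝ, F s = ∫ s : ℝ, F (s + φ * Complex.I) := by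
  have hint : ∀ t ∈ uIcc 0 φ, Integrable fun s : ℝ => F (s + t * Complex.I) := fun t ht => by
    refine hh.mono' (Continuous.aestronglyMeasurable ?_) (Eventually.of_forall fun s => hb s t ht)
    refine continuous_iff_continuousAt.2 fun s => ?_
    refine ContinuousAt.comp (f := fun s : ℝ => (s : ℂ) + t * Complex.I)
      (hF _ (by simpa using ht)).continuousAt ?_
    fun_prop
  have h0 : Integrable fun s : ℝ => F s := by simpa using hint 0 left_mem_uIcc
  have h1 := intervalIntegral_tendsto_integral h0 tendsto_neg_atTop_atBot tendsto_id
  have h2 := intervalIntegral_tendsto_integral (hint φ right_mem_uIcc)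
    tendsto_neg_atTop_atBot tendsto_id
  have key : ∀ T : ℝ, ‖(∫ s in (-T)..T, F s) - ∫ s in (-T)..T, F (s + φ * Complex.I)‖ ≤
      h T * |φ| + h (-T) * |φ| := fun T => by
    have hrect := Complex.integral_boundary_rect_eq_zero_of_differentiableOn F
      (-T : ℂ) (T + φ * Complex.I) (fun z hz => by
        have := hz.2
        refine (hF z ?_).differentiableWithinAt
        simpa using this)
    simp only [Complex.neg_re, Complex.ofReal_re, Complex.add_re, Complex.mul_re, Complex.I_re,
      mul_zero, Complex.ofReal_im, Complex.I_im, mul_one, sub_self, add_zero, Complex.neg_im,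
      neg_zero, Complex.add_im, Complex.mul_im, zero_add, Complex.ofReal_zero, zero_mul,
      smul_eq_mul] at hrect
    have hv : ∀ x : ℝ, ‖∫ t in (0 : ℝ)..φ, F (x + t * Complex.I)‖ ≤ h x * |φ| := fun x => by
      have := intervalIntegral.norm_integral_le_of_norm_le_const
        (a := 0) (b := φ) (f := fun t : ℝ => F (x + t * Complex.I)) (C := h x)
        (fun t ht => hb x t (uIoc_subset_uIcc ht))
      simpa using this
    have e : (∫ s in (-T)..T, F s) - ∫ s in (-T)..T, F (s + φ * Complex.I) =
        Complex.I * (∫ t in (0 : ℝ)..φ, F (((-T : ℝ) : ℂ) + t * Complex.I)) -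
          Complex.I * ∫ t in (0 : ℝ)..φ, F (T + t * Complex.I) := by
      linear_combination hrect
    rw [e]
    refine (norm_sub_le _ _).trans ?_
    rw [norm_mul, norm_mul, Complex.norm_I, one_mul, one_mul, add_comm]
    exact add_le_add (hv T) (hv (-T))
  have h3 : Tendsto (fun T : ℝ => h T * |φ| + h (-T) * |φ|) atTop (𝓝 0) := by
    simpa using (htop.mul_const |φ|).add ((hbot.comp tendsto_neg_atTop_atBot).mul_const |φ|)
  have h4 := squeeze_zero_norm key h3
  exact sub_eq_zero.1 (tendsto_nhds_unique (h1.sub h2) h4)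

/-! ### Half-plane kernels with a symbol -/

/-- The Euclidean norm of a point of the plane. -/
def euclNorm (y : ℝ × ℝ) : ℝ := Real.sqrt (y.1 ^ 2 + y.2 ^ 2)

/-- The normal coordinate is taken as the real part, so that the argument is the angle to the normal
axis and is smaller than π/2 in modulus on the open half-plane. -/
theorem euclNorm_eq_norm (y : ℝ × ℝ) : euclNorm y = ‖(y.2 + y.1 * Complex.I : ℂ)‖ := by
  rw [Complex.norm_add_mul_I, euclNorm, add_comm]

theorem euclNorm_nonneg (y : ℝ × ℝ) : 0 ≤ euclNorm y := Real.sqrt_nonneg _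

theorem euclNorm_pos {y : ℝ × ℝ} (hy : y ≠ 0) : 0 < euclNorm y := by
  refine Real.sqrt_pos.2 ?_
  by_contra h
  refine hy (Prod.ext ?_ ?_) <;> simp only [Prod.fst_zero, Prod.snd_zero] <;>
    nlinarith [sq_nonneg y.1, sq_nonneg y.2]

theorem continuous_euclNorm : Continuous euclNorm := by
  unfold euclNorm
  fun_prop

/-- The oscillating exponential `exp(i y₁ sinh s - y₂ cosh s)`. -/
def phase (y : ℝ × ℝ) (s : ℝ) : ℂ :=
  Complex.exp (Complex.I * ((y.1 * Real.sinh s : ℝ) : ℂ) - ((y.2 * Real.cosh s : ℝ) : ℂ))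

theorem norm_phase (y : ℝ × ℝ) (s : ℝ) : ‖phase y s‖ = Real.exp (-(y.2 * Real.cosh s)) := by
  rw [phase, Complex.norm_exp]
  congr 1
  rw [Complex.sub_re, Complex.ofReal_re, Complex.I_mul_re, Complex.ofReal_im]
  ring

theorem continuous_phase : Continuous fun p : (ℝ × ℝ) × ℝ => phase p.1 p.2 := by
  unfold phase
  fun_prop

/-- Continuous functions on the line that grow at most like `e^{|s|}`. -/
def IsSymbol (b : ℝ → ℂ) : Prop := Continuous b ∧ ∃ A, ∀ s, ‖b s‖ ≤ A * Real.exp |s|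

/-- The kernel `(4π)⁻¹ ∫ exp(i y₁ sinh s - y₂ cosh s) b(s) ds`. -/
def stripKernel (b : ℝ → ℂ) (y : ℝ × ℝ) : ℂ := 1 / (4 * Real.pi) * ∫ s : ℝ, phase y s * b s

theorem IsSymbol.norm_phase_mul_le {b : ℝ → ℂ} {A : ℝ} (hA : ∀ s, ‖b s‖ ≤ A * Real.exp |s|)
    {ε : ℝ} {y : ℝ × ℝ} (hy : ε ≤ y.2) (s : ℝ) :
    ‖phase y s * b s‖ ≤ A * (Real.exp |s| * Real.exp (-(ε * Real.cosh s))) := by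
  rw [norm_mul, norm_phase]
  calc _ ≤ Real.exp (-(ε * Real.cosh s)) * (A * Real.exp |s|) := by
        refine mul_le_mul (Real.exp_le_exp.2 (neg_le_neg ?_)) (hA s) (norm_nonneg _)
          (Real.exp_pos _).le
        exact mul_le_mul_of_nonneg_right hy (Real.cosh_pos s).le
    _ = _ := by ring

theorem IsSymbol.integrable_phase_mul {b : ℝ → ℂ} (hb : IsSymbol b) {y : ℝ × ℝ} (hy : 0 < y.2) :
    Integrable fun s => phase y s * b s := by
  obtain ⟨hc, A, hA⟩ := hb
  refine ((integrable_exp_abs_mul_exp_neg_cosh hy).const_mul A).mono'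
    (Continuous.aestronglyMeasurable ?_)
    (Eventually.of_forall fun s => IsSymbol.norm_phase_mul_le hA le_rfl s)
  exact (continuous_phase.comp (by fun_prop : Continuous fun s : ℝ => (y, s))).mul hc

theorem IsSymbol.continuousOn_stripKernel {b : ℝ → ℂ} (hb : IsSymbol b) :
    ContinuousOn (stripKernel b) halfPlane := by
  obtain ⟨hc, A, hA⟩ := hb
  refine continuousOn_const.mul fun y hy => ContinuousAt.continuousWithinAt ?_
  have hy : 0 < y.2 := hy
  refine continuousAt_of_dominated (bound := fun s => A * (Real.exp |s| *
    Real.exp (-(y.2 / 2 * Real.cosh s)))) ?_ ?_ ?_ ?_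
  · exact Eventually.of_forall fun y => Continuous.aestronglyMeasurable
      ((continuous_phase.comp (by fun_prop : Continuous fun s : ℝ => (y, s))).mul hc)
  · filter_upwards [(continuous_snd.tendsto y).eventually (lt_mem_nhds (half_lt_self hy))] with y' h
    exact Eventually.of_forall fun s => IsSymbol.norm_phase_mul_le hA h.le s
  · exact (integrable_exp_abs_mul_exp_neg_cosh (half_pos hy)).const_mul A
  · exact Eventually.of_forall fun s => Continuous.continuousAt
      ((continuous_phase.comp (by fun_prop : Continuous fun y : ℝ × ℝ => (y, s))).mul
        continuous_const)

theorem IsSymbol.const_mul {b : ℝ → ℂ} (hb : IsSymbol b) (k : ℂ) :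
    IsSymbol fun s => k * b s := by
  obtain ⟨hc, A, hA⟩ := hb
  refine ⟨by fun_prop, ‖k‖ * A, fun s => ?_⟩
  rw [norm_mul, mul_assoc]
  exact mul_le_mul_of_nonneg_left (hA s) (norm_nonneg _)

theorem stripKernel_const_mul (b : ℝ → ℂ) (k : ℂ) (y : ℝ × ℝ) :
    stripKernel (fun s => k * b s) y = k * stripKernel b y := by
  rw [stripKernel, stripKernel, mul_left_comm, ← integral_const_mul k]
  congr 2
  funext s
  ring

/-- The boundary coefficient in the variable `z` with `ξ = sinh z`. -/
def refl (γ : ℝ) (z : ℂ) : ℂ :=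
  (γ + Complex.I * Complex.exp z) / (1 + Complex.I * γ * Complex.exp z)

/-- The symbol `α(sinh s) e^{νs}`. -/
def symb (γ ν s : ℝ) : ℂ := refl γ s * Complex.exp (ν * s)

/-! ### The boundary coefficient on the strip |Im z| < π/2. -/

theorem normSq_one_add_I_mul (γ s t : ℝ) :
    ‖1 + Complex.I * γ * Complex.exp (s + t * Complex.I)‖ ^ 2 =
      1 - 2 * (γ * Real.exp s) * Real.sin t + (γ * Real.exp s) ^ 2 := by
  rw [Complex.exp_add, Complex.exp_mul_I, ← Complex.ofReal_exp, ← Complex.ofReal_cos,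
    ← Complex.ofReal_sin, ← Complex.normSq_eq_norm_sq, Complex.normSq_apply]
  simp only [Complex.add_re, Complex.add_im, Complex.mul_re, Complex.mul_im, Complex.I_re,
    Complex.I_im, Complex.ofReal_re, Complex.ofReal_im, Complex.one_re, Complex.one_im]
  linear_combination (γ * Real.exp s) ^ 2 * Real.sin_sq_add_cos_sq t

/-- With x = γ e^s, completing the square in the squared modulus gives (x - sin t)² + cos² t, and
cos t > 0 in the open strip. For γ > 0 there is a zero on the edge, at z = -log γ + iπ/2. -/
theorem one_add_I_mul_exp_ne_zero {γ : ℝ} {z : ℂ} (hz : |z.im| < Real.pi / 2) :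
    1 + Complex.I * γ * Complex.exp z ≠ 0 := by
  intro h
  have h1 := normSq_one_add_I_mul γ z.re z.im
  rw [Complex.re_add_im, h, norm_zero] at h1
  have hc : 0 < Real.cos z.im := Real.cos_pos_of_mem_Ioo (abs_lt.1 hz)
  nlinarith [sq_nonneg (γ * Real.exp z.re - Real.sin z.im), Real.sin_sq_add_cos_sq z.im]

/-- The coefficient tends to γ as s → -∞ and to 1/γ as s → ∞, whence the sum γ + γ⁻¹; the factor
1/cos η measures the distance to the pole at height π/2. -/
theorem norm_refl_le {γ η : ℝ} (hγ : 0 < γ) (hη : η < Real.pi / 2) {s t : ℝ} (ht : |t| ≤ η) :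
    ‖refl γ (s + t * Complex.I)‖ ≤ 2 * (γ + γ⁻¹) / Real.cos η := by
  have hη0 : 0 ≤ η := (abs_nonneg t).trans ht
  have hμ : 0 < Real.cos η := Real.cos_pos_of_mem_Ioo ⟨by linarith, hη⟩
  have hμt : Real.cos η ≤ Real.cos t := by
    rw [← Real.cos_abs t]
    exact Real.cos_le_cos_of_nonneg_of_le_pi (abs_nonneg t) (by linarith) ht
  have hden : 1 + Complex.I * γ * Complex.exp (s + t * Complex.I) ≠ 0 :=
    one_add_I_mul_exp_ne_zero (by simpa using ht.trans_lt hη)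
  rw [refl, norm_div, div_le_div_iff₀ (norm_pos_iff.2 hden) hμ]
  have hN := normSq_one_add_I_mul γ s t
  set N := ‖1 + Complex.I * γ * Complex.exp (s + t * Complex.I)‖
  set E := Real.exp s with hE
  have hEp : 0 < E := Real.exp_pos s
  have hnum : ‖(γ : ℂ) + Complex.I * Complex.exp (s + t * Complex.I)‖ ≤ γ + E := by
    refine (norm_add_le _ _).trans_eq ?_
    rw [norm_mul, Complex.norm_I, Complex.norm_exp, Complex.norm_real,
      Real.norm_of_nonneg hγ.le]
    simp [hE]
  refine (mul_le_mul_of_nonneg_right hnum hμ.le).trans ?_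
  refine abs_le_of_sq_le_sq' ?_ (by positivity) |>.2
  -- With x = γE, N² equals both (x - sin t)² + cos² t and (1 - x sin t)² + x² cos² t; adding the
  -- two gives the claim.
  have h1 : Real.cos η ^ 2 * (1 + (γ * E) ^ 2) ≤ 2 * N ^ 2 := by
    have h2 : Real.cos η ^ 2 ≤ Real.cos t ^ 2 := pow_le_pow_left₀ hμ.le hμt 2
    have h3 := Real.sin_sq_add_cos_sq t
    calc _ ≤ Real.cos t ^ 2 * (1 + (γ * E) ^ 2) := by gcongr
      _ ≤ _ := by
        rw [hN]
        nlinarith [sq_nonneg (γ * E - Real.sin t), sq_nonneg (1 - γ * E * Real.sin t)]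
  have h4 : (γ + E) ^ 2 ≤ 2 * ((γ + γ⁻¹) ^ 2 * (1 + (γ * E) ^ 2)) := by
    have h5 : (γ + γ⁻¹) ^ 2 * (1 + (γ * E) ^ 2) =
        γ ^ 2 + 2 + γ⁻¹ ^ 2 + (γ ^ 2 + 2) * (γ * E) ^ 2 + E ^ 2 := by
      field_simp
      ring
    rw [h5]
    nlinarith [sq_nonneg (γ - E), sq_nonneg γ⁻¹, mul_nonneg (sq_nonneg γ) (sq_nonneg (γ * E)),
      sq_nonneg (γ * E)]
  calc ((γ + E) * Real.cos η) ^ 2 = (γ + E) ^ 2 * Real.cos η ^ 2 := by ring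
    _ ≤ 2 * ((γ + γ⁻¹) ^ 2 * (1 + (γ * E) ^ 2)) * Real.cos η ^ 2 := by gcongr
    _ = 2 * (γ + γ⁻¹) ^ 2 * (Real.cos η ^ 2 * (1 + (γ * E) ^ 2)) := by ring
    _ ≤ 2 * (γ + γ⁻¹) ^ 2 * (2 * N ^ 2) := by gcongr
    _ = (2 * (γ + γ⁻¹) * N) ^ 2 := by ring

theorem differentiableAt_refl {γ : ℝ} {z : ℂ} (hz : |z.im| < Real.pi / 2) :
    DifferentiableAt ℂ (refl γ) z := by
  unfold refl
  exact DifferentiableAt.div (by fun_prop) (by fun_prop) (one_add_I_mul_exp_ne_zero hz)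

theorem exp_mul_le_exp_abs {ν : ℝ} (hν : |ν| ≤ 1) (s : ℝ) : Real.exp (ν * s) ≤ Real.exp |s| := by
  refine Real.exp_le_exp.2 ((le_abs_self _).trans ?_)
  rw [abs_mul]
  exact mul_le_of_le_one_left (abs_nonneg s) hν

theorem isSymbol_symb {γ : ℝ} (hγ : 0 < γ) {ν : ℝ} (hν : |ν| ≤ 1) : IsSymbol (symb γ ν) := by
  refine ⟨continuous_iff_continuousAt.2 fun s => ?_, 2 * (γ + γ⁻¹) / Real.cos 0, fun s => ?_⟩
  · refine ContinuousAt.mul (f := fun s : ℝ => refl γ s) ?_ (by fun_prop)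
    exact ContinuousAt.comp (g := refl γ) (f := fun s : ℝ => (s : ℂ))
      (differentiableAt_refl (by simpa using Real.pi_pos)).continuousAt
      Complex.continuous_ofReal.continuousAt
  · rw [symb, norm_mul]
    have h1 := norm_refl_le (s := s) (t := 0) hγ (by positivity : (0 : ℝ) < Real.pi / 2) (by simp)
    rw [Complex.ofReal_zero, zero_mul, add_zero] at h1
    refine mul_le_mul h1 ?_ (norm_nonneg _) ((norm_nonneg _).trans h1)
    rw [Complex.norm_exp]
    simpa using exp_mul_le_exp_abs hν s

/-- This makes the kernel of the whole plane a special case: its symbols are `symb 1 ν`, so all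
results on `symb γ ν` apply to it. -/
theorem refl_one (s : ℝ) : refl 1 s = 1 := by
  have h := one_add_I_mul_exp_ne_zero (γ := 1) (z := s) (by simpa using Real.pi_pos)
  rw [refl, div_eq_one_iff_eq h]
  simp

theorem symb_one (ν s : ℝ) : symb 1 ν s = Complex.exp (ν * s) := by
  rw [symb, refl_one, one_mul]

/-! ### Contour shifts in the phase integrals. -/

theorem tendsto_exp_abs_mul_exp_neg_cosh {ρ : ℝ} (hρ : 0 < ρ) {l : Filter ℝ}
    (hl : Tendsto (fun s : ℝ => |s|) l atTop) :
    Tendsto (fun s : ℝ => Real.exp |s| * Real.exp (-(ρ * Real.cosh s))) l (𝓝 0) := by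
  have h1 : Tendsto (fun s : ℝ => Real.exp |s| * Real.exp (-(ρ / 2 * Real.exp |s|))) l (𝓝 0) := by
    have := (tendsto_rpow_mul_exp_neg_mul_atTop_nhds_zero 1 (ρ / 2) (half_pos hρ)).comp
      (Real.tendsto_exp_atTop.comp hl)
    simpa [Function.comp_def, neg_mul] using this
  exact squeeze_zero (fun s => by positivity) (exp_abs_mul_exp_neg_cosh_le hρ) h1

/-- In polar coordinates y₂ + i y₁ = r e^{iθ}, the addition theorem gives y₂ cosh s - i y₁ sinh s =
r cosh(s - iθ). The angle thus enters only as an imaginary translation of s. -/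
theorem phase_eq_exp_cosh (y : ℝ × ℝ) (s : ℝ) :
    phase y s = Complex.exp (-(euclNorm y *
      Complex.cosh (s - (y.2 + y.1 * Complex.I : ℂ).arg * Complex.I))) := by
  set Z : ℂ := y.2 + y.1 * Complex.I
  have h1 : euclNorm y * Real.cos Z.arg = y.2 := by
    rw [euclNorm_eq_norm, Complex.norm_mul_cos_arg]; simp
  have h2 : euclNorm y * Real.sin Z.arg = y.1 := by
    rw [euclNorm_eq_norm, Complex.norm_mul_sin_arg]; simp
  rw [phase, Complex.cosh_sub, Complex.cosh_mul_I, Complex.sinh_mul_I]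
  congr 1
  nth_rewrite 1 [← h1]
  nth_rewrite 1 [← h2]
  push_cast
  ring

theorem norm_exp_neg_cosh (r s t : ℝ) :
    ‖Complex.exp (-(r * Complex.cosh (s + t * Complex.I)))‖ =
      Real.exp (-(r * Real.cos t * Real.cosh s)) := by
  rw [Complex.norm_exp, Complex.cosh_add, Complex.cosh_mul_I, Complex.sinh_mul_I,
    ← Complex.ofReal_cosh, ← Complex.ofReal_cos, ← Complex.ofReal_sinh, ← Complex.ofReal_sin]
  congr 1
  simp
  rw [← Complex.ofReal_cos, Complex.ofReal_re]
  ring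

theorem abs_arg_lt {y : ℝ × ℝ} (hy : 0 < y.2) :
    |(y.2 + y.1 * Complex.I : ℂ).arg| < Real.pi / 2 :=
  Complex.abs_arg_lt_pi_div_two_iff.2 (Or.inl (by simpa using hy))

/-- The line of integration may be shifted as long as it stays on the same side of the critical
line as the argument of the point. -/
theorem integral_phase_mul_eq {B : ℂ → ℂ} (hB : ∀ z : ℂ, |z.im| < Real.pi / 2 →
      DifferentiableAt ℂ B z) {y : ℝ × ℝ} (hy : 0 < y.2) {M φ : ℝ}
    (hφ : φ ∈ uIcc 0 (y.2 + y.1 * Complex.I : ℂ).arg)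
    (hM : ∀ s t : ℝ, |t| ≤ |φ| → ‖B (s + t * Complex.I)‖ ≤ M * Real.exp |s|) :
    ∫ s : ℝ, phase y s * B s = ∫ s : ℝ, Complex.exp (-(euclNorm y *
      Complex.cosh (s + ((φ - (y.2 + y.1 * Complex.I : ℂ).arg : ℝ) : ℂ) * Complex.I))) *
        B (s + φ * Complex.I) := by
  set θ := (y.2 + y.1 * Complex.I : ℂ).arg with hθ
  have hθ' : |θ| < Real.pi / 2 := abs_arg_lt hy
  have hr : 0 < euclNorm y := euclNorm_pos fun h => by rw [h] at hy; exact lt_irrefl _ hy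
  have hcos : 0 < Real.cos θ := Real.cos_pos_of_mem_Ioo (abs_lt.1 hθ')
  have hρ : 0 < euclNorm y * Real.cos θ := mul_pos hr hcos
  -- Every intermediate height lies between 0 and θ, so the decay rate r cos(t - θ) is never worse
  -- than the rate r cos θ on the real line. A single majorant with that rate therefore works for
  -- the whole shift.
  have hsub : ∀ t ∈ uIcc 0 φ, |t| ≤ |φ| ∧ |t - θ| ≤ |θ| := fun t ht => by
    have ht' := uIcc_subset_uIcc_left hφ ht
    refine ⟨by simpa using abs_sub_left_of_mem_uIcc ht, ?_⟩
    have h2 := abs_sub_right_of_mem_uIcc ht'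
    rw [abs_sub_comm]
    simpa using h2
  have hφθ : |φ| ≤ |θ| := by simpa using abs_sub_left_of_mem_uIcc hφ
  have hM0 : 0 ≤ M := by
    have := (norm_nonneg _).trans (hM 0 0 (by simp))
    simpa using this
  have h := integral_eq_integral_add_mul_I (F := fun z => Complex.exp (-(euclNorm y *
      Complex.cosh (z - θ * Complex.I))) * B z)
    (h := fun s => M * (Real.exp |s| * Real.exp (-(euclNorm y * Real.cos θ * Real.cosh s)))) φ
    (fun z hz => ?_) ((integrable_exp_abs_mul_exp_neg_cosh hρ).const_mul M) ?_ ?_ ?_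
  · simp only [phase_eq_exp_cosh]
    rw [h]
    congr 1
    funext s
    congr 5
    push_cast
    ring
  · refine DifferentiableAt.mul (by fun_prop) (hB z ?_)
    exact ((hsub _ hz).1.trans hφθ).trans_lt hθ'
  · simpa using (tendsto_exp_abs_mul_exp_neg_cosh hρ tendsto_abs_atTop_atTop).const_mul M
  · simpa using (tendsto_exp_abs_mul_exp_neg_cosh hρ tendsto_abs_atBot_atTop).const_mul M
  · intro s t ht
    obtain ⟨ht1, ht2⟩ := hsub t ht
    have e : (s + t * Complex.I - θ * Complex.I : ℂ) = s + ((t - θ : ℝ) : ℂ) * Complex.I := by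
      push_cast; ring
    rw [norm_mul, e, norm_exp_neg_cosh, mul_left_comm, mul_comm]
    rw [mul_left_comm]
    have hc : Real.cos θ ≤ Real.cos (t - θ) := by
      rw [← Real.cos_abs θ, ← Real.cos_abs (t - θ)]
      exact Real.cos_le_cos_of_nonneg_of_le_pi (abs_nonneg _) (by linarith [Real.pi_pos]) ht2
    calc _ ≤ M * Real.exp |s| * Real.exp (-(euclNorm y * Real.cos θ * Real.cosh s)) := by
          refine mul_le_mul (hM s t ht1) (Real.exp_le_exp.2 (neg_le_neg ?_)) (Real.exp_pos _).le
            (by positivity)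
          exact mul_le_mul_of_nonneg_right (mul_le_mul_of_nonneg_left hc hr.le)
            (Real.cosh_pos s).le
      _ = _ := by ring

theorem norm_exp_mul_le {ν : ℝ} (hν : |ν| ≤ 1) (s t : ℝ) :
    ‖Complex.exp (ν * (s + t * Complex.I))‖ ≤ Real.exp |s| := by
  rw [Complex.norm_exp]
  simpa using exp_mul_le_exp_abs hν s

/-- The core of the upper bound. The shift to height θ would be optimal for the decay but approaches
the pole of the coefficient as |θ| → π/2. Shifting to κθ instead, with κ < 1 independent of y,
leaves a distance η to the pole and an angle of at most η in the exponent. -/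
theorem exists_norm_stripKernel_symb_le {γ c : ℝ} (hγ : 0 < γ) (hc : 0 < c) (hc1 : c < 1) :
    ∃ C : ℝ, 0 < C ∧ ∀ ν : ℝ, |ν| ≤ 1 → ∀ y : ℝ × ℝ, 0 < y.2 →
      ‖stripKernel (symb γ ν) y‖ ≤ C * (Real.exp (-(c * euclNorm y)) / euclNorm y) := by
  -- The shifted integrand decays like exp(-c' r cosh s) with c' = cos η; the gap c' - c pays for
  -- the growth e^{|s|} of the symbol.
  obtain ⟨c', hcc', hc'1⟩ := exists_between hc1
  have hη0 : 0 < Real.arccos c' := Real.arccos_pos.2 hc'1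
  have hη1 : Real.arccos c' < Real.pi / 2 := Real.arccos_lt_pi_div_two.2 (hc.trans hcc')
  set η := Real.arccos c' with hη
  have hcosη : Real.cos η = c' := Real.cos_arccos (by linarith) hc'1.le
  have hη2 : Real.pi / 2 - η < Real.pi / 2 := by linarith
  set M := 2 * (γ + γ⁻¹) / Real.cos (Real.pi / 2 - η) with hMdef
  have hM0 : 0 < M := by
    have : 0 < Real.cos (Real.pi / 2 - η) :=
      Real.cos_pos_of_mem_Ioo ⟨by linarith, hη2⟩
    positivity
  refine ⟨M * (4 / (c' - c)), mul_pos hM0 (div_pos (by norm_num) (sub_pos.2 hcc')),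
    fun ν hν y hy => ?_⟩
  have hr : 0 < euclNorm y := euclNorm_pos fun h => by rw [h] at hy; exact lt_irrefl _ hy
  have hθ' := abs_arg_lt hy
  set θ := (y.2 + y.1 * Complex.I : ℂ).arg with hθ
  -- Chosen so that κ π/2 = π/2 - η and (1 - κ) π/2 = η.
  set κ := 1 - η / (Real.pi / 2) with hκ
  have hπ := Real.pi_pos
  have hκ0 : 0 ≤ κ := by
    rw [hκ, sub_nonneg, div_le_one (by positivity)]; exact hη1.le
  have hκ1 : κ ≤ 1 := by rw [hκ]; linarith [div_pos hη0 (by positivity : 0 < Real.pi / 2)]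
  have hκe : κ * (Real.pi / 2) = Real.pi / 2 - η := by rw [hκ]; field_simp
  have hφ : κ * θ ∈ uIcc 0 θ := by
    rcases le_total 0 θ with h | h
    · rw [uIcc_of_le h]; exact ⟨by positivity, by nlinarith⟩
    · rw [uIcc_of_ge h]; exact ⟨by nlinarith, by nlinarith⟩
  have hφ2 : |κ * θ| ≤ Real.pi / 2 - η := by
    rw [abs_mul, abs_of_nonneg hκ0, ← hκe]
    exact mul_le_mul_of_nonneg_left hθ'.le hκ0
  have hφ3 : |κ * θ - θ| ≤ η := by
    have : κ * θ - θ = -((1 - κ) * θ) := by ring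
    rw [this, abs_neg, abs_mul, abs_of_nonneg (sub_nonneg.2 hκ1)]
    nlinarith [abs_nonneg θ]
  have hbound : ∀ s t : ℝ, |t| ≤ |κ * θ| →
      ‖refl γ (s + t * Complex.I) * Complex.exp (ν * (s + t * Complex.I))‖ ≤
        M * Real.exp |s| := fun s t ht => by
    rw [norm_mul]
    exact mul_le_mul (norm_refl_le hγ hη2 (ht.trans hφ2)) (norm_exp_mul_le hν s t)
      (norm_nonneg _) hM0.le
  have hshift := integral_phase_mul_eq (B := fun z => refl γ z * Complex.exp (ν * z))
    (fun z hz => (differentiableAt_refl hz).mul (by fun_prop)) hy hφ hbound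
  rw [stripKernel]
  simp only [symb]
  rw [hshift, norm_mul]
  have h4 : ‖(1 / (4 * Real.pi) : ℂ)‖ ≤ 1 := by
    rw [norm_div, norm_mul, Complex.norm_real, Real.norm_of_nonneg hπ.le]
    simp only [norm_one, Complex.norm_ofNat]
    rw [div_le_one (by positivity)]
    linarith [Real.pi_gt_three]
  refine (mul_le_of_le_one_left (norm_nonneg _) h4).trans ?_
  have hc'0 : 0 < c' := hc.trans hcc'
  calc _ ≤ ∫ s : ℝ, M * (Real.exp |s| * Real.exp (-(euclNorm y * c' * Real.cosh s))) := by
        refine norm_integral_le_of_norm_le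
          ((integrable_exp_abs_mul_exp_neg_cosh (mul_pos hr hc'0)).const_mul M)
          (Eventually.of_forall fun s => ?_)
        rw [norm_mul, norm_exp_neg_cosh, mul_comm]
        have hcos : c' ≤ Real.cos (κ * θ - θ) := by
          rw [← hcosη, ← Real.cos_abs (κ * θ - θ)]
          exact Real.cos_le_cos_of_nonneg_of_le_pi (abs_nonneg _) (by linarith) hφ3
        calc _ ≤ M * Real.exp |s| * Real.exp (-(euclNorm y * c' * Real.cosh s)) := by
              refine mul_le_mul (hbound s _ le_rfl) (Real.exp_le_exp.2 (neg_le_neg ?_))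
                (Real.exp_pos _).le (by positivity)
              exact mul_le_mul_of_nonneg_right (mul_le_mul_of_nonneg_left hcos hr.le)
                (Real.cosh_pos s).le
          _ = _ := by ring
    _ ≤ _ := by
        rw [integral_const_mul, mul_assoc]
        exact mul_le_mul_of_nonneg_left (integral_exp_abs_mul_exp_neg_cosh_le hr hc hcc') hM0.le

/-! ### The free kernel -/

/-- The integral `∫ exp(-r cosh s + ν s) ds`, twice the modified Bessel function `K_ν(r)`. -/
def besselInt (ν r : ℝ) : ℝ := ∫ s : ℝ, Real.exp (-(r * Real.cosh s)) * Real.exp (ν * s)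

/-- The symbol e^{νz} is entire, so the line may be shifted all the way to height θ. The exponent
becomes real and the angle survives only in the factor e^{iνθ}. -/
theorem stripKernel_symb_one {ν : ℝ} (hν : |ν| ≤ 1) {y : ℝ × ℝ} (hy : 0 < y.2) :
    stripKernel (symb 1 ν) y = 1 / (4 * Real.pi) *
      (Complex.exp (ν * ((y.2 + y.1 * Complex.I : ℂ).arg * Complex.I)) *
        besselInt ν (euclNorm y)) := by
  have h := integral_phase_mul_eq (B := fun z => Complex.exp (ν * z)) (M := 1)
    (fun z _ => by fun_prop) hy right_mem_uIcc
    (fun s t _ => by rw [one_mul]; exact norm_exp_mul_le hν s t)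
  simp only [stripKernel, symb_one]
  rw [h, besselInt, ← integral_complex_ofReal,
    ← integral_const_mul (Complex.exp (ν * ((y.2 + y.1 * Complex.I : ℂ).arg * Complex.I)))]
  congr 2
  funext s
  rw [sub_self, mul_add, Complex.exp_add]
  push_cast
  simp only [zero_mul, add_zero]
  ring

/-! ### Integrable weights -/

/-- By evenness the integral is twice a Gamma integral, and a positive value excludes
non-integrability. -/
theorem integrable_rpow_abs_mul_exp_neg_abs {p a : ℝ} (hp : 0 < p) (ha : 0 < a) :
    Integrable fun t : ℝ => |t| ^ (p - 1) * Real.exp (-(a * |t|)) := by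
  by_contra h
  have h1 := integral_undef h
  rw [integral_comp_abs (f := fun t => t ^ (p - 1) * Real.exp (-(a * t))),
    Real.integral_rpow_mul_exp_neg_mul_Ioi hp ha] at h1
  have : 0 < 2 * ((1 / a) ^ p * Real.Gamma p) := by
    have := Real.Gamma_pos_of_pos hp
    positivity
  linarith

theorem integrable_exp_neg_mul_abs {a : ℝ} (ha : 0 < a) :
    Integrable fun t : ℝ => Real.exp (-(a * |t|)) := by
  simpa using integrable_rpow_abs_mul_exp_neg_abs one_pos ha

theorem integrable_exp_neg_mul_abs_add_abs {a : ℝ} (ha : 0 < a) :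
    Integrable fun y : ℝ × ℝ => Real.exp (-(a * (|y.1| + |y.2|))) := by
  have := (integrable_exp_neg_mul_abs ha).mul_prod (integrable_exp_neg_mul_abs ha)
  refine this.congr (Eventually.of_forall fun y => ?_)
  simp only
  rw [← Real.exp_add]
  ring_nf

theorem abs_add_abs_le_two_mul_euclNorm (y : ℝ × ℝ) : |y.1| + |y.2| ≤ 2 * euclNorm y := by
  have h1 : |y.1| ≤ euclNorm y := Real.abs_le_sqrt (by nlinarith [sq_nonneg y.2])
  have h2 : |y.2| ≤ euclNorm y := Real.abs_le_sqrt (by nlinarith [sq_nonneg y.1])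
  linarith

/-- Since |y₁||y₂| ≤ r², the singularity 1/r is dominated by a product of two integrable
one-dimensional singularities. This reduces the integrability of e^{-ar}/r to Fubini, without polar
coordinates. -/
theorem rpow_abs_mul_rpow_abs_ge {y : ℝ × ℝ} (h1 : y.1 ≠ 0) (h2 : y.2 ≠ 0) :
    1 / euclNorm y ≤ |y.1| ^ ((1 / 2 : ℝ) - 1) * |y.2| ^ ((1 / 2 : ℝ) - 1) := by
  have h1' := abs_pos.2 h1
  have h2' := abs_pos.2 h2
  have e : |y.1| ^ ((1 / 2 : ℝ) - 1) * |y.2| ^ ((1 / 2 : ℝ) - 1) = 1 / Real.sqrt (|y.1| * |y.2|) := by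
    rw [← Real.mul_rpow h1'.le h2'.le, Real.sqrt_eq_rpow,
      one_div ((|y.1| * |y.2|) ^ (1 / 2 : ℝ)), ← Real.rpow_neg (mul_pos h1' h2').le]
    norm_num
  rw [e]
  refine one_div_le_one_div_of_le (by positivity) (Real.sqrt_le_sqrt ?_)
  nlinarith [sq_nonneg (|y.1| - |y.2|), sq_abs y.1, sq_abs y.2]

theorem ae_fst_ne_zero_and_snd_ne_zero : ∀ᵐ y : ℝ × ℝ, y.1 ≠ 0 ∧ y.2 ≠ 0 := by
  have h : ∀ᵐ t : ℝ, t ≠ 0 := Measure.ae_ne volume 0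
  filter_upwards [Measure.quasiMeasurePreserving_fst.ae h,
    Measure.quasiMeasurePreserving_snd.ae h] with y h1 h2 using ⟨h1, h2⟩

/-- The radial weight `e^{-ar}/r`. -/
def yukawa (a : ℝ) (y : ℝ × ℝ) : ℝ := Real.exp (-(a * euclNorm y)) / euclNorm y

theorem yukawa_nonneg (a : ℝ) (y : ℝ × ℝ) : 0 ≤ yukawa a y :=
  div_nonneg (Real.exp_pos _).le (euclNorm_nonneg y)

theorem measurable_yukawa (a : ℝ) : Measurable (yukawa a) := by
  have := continuous_euclNorm.measurable
  unfold yukawa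
  fun_prop

theorem integrable_yukawa {a : ℝ} (ha : 0 < a) : Integrable (yukawa a) := by
  have h1 := integrable_rpow_abs_mul_exp_neg_abs (p := 1 / 2) (by norm_num) (half_pos ha)
  refine (h1.mul_prod h1).mono' (measurable_yukawa a).aestronglyMeasurable ?_
  filter_upwards [ae_fst_ne_zero_and_snd_ne_zero] with y hy
  rw [Real.norm_of_nonneg (yukawa_nonneg a y), yukawa, div_eq_mul_one_div]
  calc Real.exp (-(a * euclNorm y)) * (1 / euclNorm y)
      ≤ Real.exp (-(a / 2 * |y.1|) + -(a / 2 * |y.2|)) *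
        (|y.1| ^ ((1 / 2 : ℝ) - 1) * |y.2| ^ ((1 / 2 : ℝ) - 1)) := by
        refine mul_le_mul (Real.exp_le_exp.2 ?_) (rpow_abs_mul_rpow_abs_ge hy.1 hy.2)
          (one_div_nonneg.2 (euclNorm_nonneg y)) (Real.exp_pos _).le
        nlinarith [abs_add_abs_le_two_mul_euclNorm y]
    _ = _ := by rw [Real.exp_add]; ring

/-! ### Smooth functions with exponential decay -/

/-- Exponential decay at infinity. -/
def ExpDecay (u : ℝ × ℝ → ℂ) : Prop :=
  ∃ ε > 0, ∃ C, ∀ x, ‖u x‖ ≤ C * Real.exp (-(ε * (|x.1| + |x.2|)))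

/-- Smooth functions all of whose iterated derivatives decay exponentially. -/
def Nice (u : ℝ × ℝ → ℂ) : Prop :=
  ∃ S : Set (ℝ × ℝ → ℂ), u ∈ S ∧
    ∀ w ∈ S, ContDiff ℝ ∞ w ∧ ExpDecay w ∧ ∀ v, (fun x => fderiv ℝ w x v) ∈ S

theorem ExpDecay.add {u w : ℝ × ℝ → ℂ} (hu : ExpDecay u) (hw : ExpDecay w) :
    ExpDecay fun x => u x + w x := by
  obtain ⟨ε, hε, C, hC⟩ := hu
  obtain ⟨δ, hδ, D, hD⟩ := hw
  refine ⟨min ε δ, lt_min hε hδ, |C| + |D|, fun x => (norm_add_le _ _).trans ?_⟩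
  have hn : 0 ≤ |x.1| + |x.2| := by positivity
  have h1 : Real.exp (-(ε * (|x.1| + |x.2|))) ≤ Real.exp (-(min ε δ * (|x.1| + |x.2|))) :=
    Real.exp_le_exp.2 (neg_le_neg (mul_le_mul_of_nonneg_right (min_le_left _ _) hn))
  have h2 : Real.exp (-(δ * (|x.1| + |x.2|))) ≤ Real.exp (-(min ε δ * (|x.1| + |x.2|))) :=
    Real.exp_le_exp.2 (neg_le_neg (mul_le_mul_of_nonneg_right (min_le_right _ _) hn))
  rw [add_mul]
  exact add_le_add
    ((hC x).trans (mul_le_mul (le_abs_self C) h1 (Real.exp_pos _).le (abs_nonneg C)))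
    ((hD x).trans (mul_le_mul (le_abs_self D) h2 (Real.exp_pos _).le (abs_nonneg D)))

theorem ExpDecay.exists_norm_le {u : ℝ × ℝ → ℂ} (hu : ExpDecay u) : ∃ C, ∀ x, ‖u x‖ ≤ C := by
  obtain ⟨ε, hε, C, hC⟩ := hu
  refine ⟨|C|, fun x => (hC x).trans ?_⟩
  calc C * Real.exp (-(ε * (|x.1| + |x.2|))) ≤ |C| * 1 := by
        refine mul_le_mul (le_abs_self C) (Real.exp_le_one_iff.2 ?_) (Real.exp_pos _).le
          (abs_nonneg C)
        have : 0 ≤ ε * (|x.1| + |x.2|) := by positivity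
        linarith
    _ = |C| := mul_one _

theorem ExpDecay.integrable {u : ℝ × ℝ → ℂ} (hu : ExpDecay u)
    (hm : AEStronglyMeasurable u volume) : Integrable u := by
  obtain ⟨ε, hε, C, hC⟩ := hu
  exact ((integrable_exp_neg_mul_abs_add_abs hε).const_mul C).mono' hm (Eventually.of_forall hC)

theorem ExpDecay.of_norm_le {u w : ℝ × ℝ → ℂ} (hu : ExpDecay u) {K : ℝ}
    (h : ∀ x, ‖w x‖ ≤ K * ‖u x‖) : ExpDecay w := by
  obtain ⟨ε, hε, C, hC⟩ := hu
  refine ⟨ε, hε, |K| * C, fun x => (h x).trans ?_⟩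
  calc K * ‖u x‖ ≤ |K| * (C * Real.exp (-(ε * (|x.1| + |x.2|)))) :=
        mul_le_mul (le_abs_self K) (hC x) (norm_nonneg _) (abs_nonneg K)
    _ = _ := by ring

theorem ExpDecay.mul_bounded {u w : ℝ × ℝ → ℂ} (hu : ExpDecay u) {K : ℝ} (hw : ∀ x, ‖w x‖ ≤ K) :
    ExpDecay fun x => u x * w x :=
  hu.of_norm_le (K := K) fun x => by
    rw [norm_mul, mul_comm]
    exact mul_le_mul_of_nonneg_right (hw x) (norm_nonneg _)

theorem ExpDecay.mul {u w : ℝ × ℝ → ℂ} (hu : ExpDecay u) (hw : ExpDecay w) :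
    ExpDecay fun x => u x * w x := by
  obtain ⟨K, hK⟩ := hw.exists_norm_le
  exact hu.mul_bounded hK

theorem ExpDecay.integrable_slice {u : ℝ × ℝ → ℂ} (hu : ExpDecay u) (hc : Continuous u) (t : ℝ) :
    Integrable fun s : ℝ => u (s, t) := by
  obtain ⟨ε, hε, C, hC⟩ := hu
  refine ((integrable_exp_neg_mul_abs hε).const_mul |C|).mono'
    (Continuous.aestronglyMeasurable (by fun_prop)) (Eventually.of_forall fun s => ?_)
  refine (hC (s, t)).trans (mul_le_mul (le_abs_self C) (Real.exp_le_exp.2 ?_)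
    (Real.exp_pos _).le (abs_nonneg C))
  have : 0 ≤ ε * |t| := by positivity
  simp only
  linarith

theorem ExpDecay.comp_linear {u : ℝ × ℝ → ℂ} (hu : ExpDecay u) (T : ℝ × ℝ → ℝ × ℝ) {δ : ℝ}
    (hδ : 0 < δ) (hT : ∀ x, δ * (|x.1| + |x.2|) ≤ |(T x).1| + |(T x).2|) :
    ExpDecay fun x => u (T x) := by
  obtain ⟨ε, hε, C, hC⟩ := hu
  refine ⟨ε * δ, mul_pos hε hδ, |C|, fun x => (hC (T x)).trans ?_⟩
  refine mul_le_mul (le_abs_self C) (Real.exp_le_exp.2 ?_) (Real.exp_pos _).le (abs_nonneg C)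
  have := mul_le_mul_of_nonneg_left (hT x) hε.le
  linarith

theorem Nice.contDiff {u : ℝ × ℝ → ℂ} (hu : Nice u) : ContDiff ℝ ∞ u := by
  obtain ⟨S, huS, hS⟩ := hu
  exact (hS u huS).1

theorem Nice.expDecay {u : ℝ × ℝ → ℂ} (hu : Nice u) : ExpDecay u := by
  obtain ⟨S, huS, hS⟩ := hu
  exact (hS u huS).2.1

theorem Nice.fderiv {u : ℝ × ℝ → ℂ} (hu : Nice u) (v : ℝ × ℝ) :
    Nice fun x => fderiv ℝ u x v := by
  obtain ⟨S, huS, hS⟩ := hu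
  exact ⟨S, (hS u huS).2.2 v, hS⟩

theorem Nice.differentiable {u : ℝ × ℝ → ℂ} (hu : Nice u) : Differentiable ℝ u :=
  hu.contDiff.differentiable (by simp)

theorem Nice.continuous {u : ℝ × ℝ → ℂ} (hu : Nice u) : Continuous u := hu.contDiff.continuous

theorem Nice.integrable {u : ℝ × ℝ → ℂ} (hu : Nice u) : Integrable u :=
  hu.expDecay.integrable hu.continuous.aestronglyMeasurable

theorem Nice.add {u w : ℝ × ℝ → ℂ} (hu : Nice u) (hw : Nice w) : Nice fun x => u x + w x := by
  -- `Nice` asks for a class of smooth decaying functions stable under directional derivatives. The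
  -- class of all sums of two such functions is one; the closure properties below use the same
  -- device.
  refine ⟨{f | ∃ u w, Nice u ∧ Nice w ∧ f = fun x => u x + w x}, ⟨u, w, hu, hw, rfl⟩, ?_⟩
  rintro _ ⟨u, w, hu, hw, rfl⟩
  refine ⟨hu.contDiff.add hw.contDiff, hu.expDecay.add hw.expDecay, fun v =>
    ⟨_, _, hu.fderiv v, hw.fderiv v, funext fun x => ?_⟩⟩
  rw [fderiv_fun_add hu.differentiable.differentiableAt hw.differentiable.differentiableAt]
  rfl

theorem Nice.clm_comp {u : ℝ × ℝ → ℂ} (hu : Nice u) (L : ℂ →L[ℝ] ℂ) : Nice fun x => L (u x) := by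
  refine ⟨{f | ∃ u, Nice u ∧ f = fun x => L (u x)}, ⟨u, hu, rfl⟩, ?_⟩
  rintro _ ⟨u, hu, rfl⟩
  refine ⟨L.contDiff.comp hu.contDiff, hu.expDecay.of_norm_le (fun x => L.le_opNorm (u x)),
    fun v => ⟨_, hu.fderiv v, funext fun x => ?_⟩⟩
  have := (L.hasFDerivAt.comp x hu.differentiable.differentiableAt.hasFDerivAt).fderiv
  rw [Function.comp_def] at this
  rw [this]
  rfl

theorem Nice.const_mul {u : ℝ × ℝ → ℂ} (hu : Nice u) (k : ℂ) : Nice fun x => k * u x :=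
  hu.clm_comp ((ContinuousLinearMap.mul ℝ ℂ) k)

theorem Nice.conj {u : ℝ × ℝ → ℂ} (hu : Nice u) : Nice fun x => (starRingEnd ℂ) (u x) :=
  hu.clm_comp Complex.conjCLE.toContinuousLinearMap

theorem Nice.comp_linear {u : ℝ × ℝ → ℂ} (hu : Nice u) (T : ℝ × ℝ →L[ℝ] ℝ × ℝ) {δ : ℝ}
    (hδ : 0 < δ) (hT : ∀ x, δ * (|x.1| + |x.2|) ≤ |(T x).1| + |(T x).2|) :
    Nice fun x => u (T x) := by
  refine ⟨{f | ∃ u, Nice u ∧ f = fun x => u (T x)}, ⟨u, hu, rfl⟩, ?_⟩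
  rintro _ ⟨u, hu, rfl⟩
  refine ⟨hu.contDiff.comp T.contDiff, hu.expDecay.comp_linear T hδ hT,
    fun v => ⟨_, hu.fderiv (T v), funext fun x => ?_⟩⟩
  have := (hu.differentiable.differentiableAt.hasFDerivAt.comp x T.hasFDerivAt).fderiv
  rw [Function.comp_def] at this
  rw [this]
  rfl

/-- The product with the inverse weight is continuous with compact support, hence bounded. The rate
is left free because the convolution estimate needs a small one. -/
theorem expDecay_of_hasCompactSupport {φ : ℝ × ℝ → ℂ} (hc : Continuous φ)
    (hs : HasCompactSupport φ) (ε : ℝ) :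
    ∃ C, ∀ x, ‖φ x‖ ≤ C * Real.exp (-(ε * (|x.1| + |x.2|))) := by
  obtain ⟨C, hC⟩ := HasCompactSupport.exists_bound_of_continuous
    (f := fun x => φ x * (Real.exp (ε * (|x.1| + |x.2|)) : ℂ)) hs.mul_right (by fun_prop)
  refine ⟨C, fun x => ?_⟩
  rw [Real.exp_neg, ← div_eq_mul_inv, le_div_iff₀ (Real.exp_pos _)]
  have := hC x
  rwa [norm_mul, Complex.norm_real,
    Real.norm_of_nonneg (Real.exp_pos _).le] at this

theorem nice_of_hasCompactSupport {φ : ℝ × ℝ → ℂ} (hc : ContDiff ℝ ∞ φ)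
    (hs : HasCompactSupport φ) : Nice φ := by
  refine ⟨{φ | ContDiff ℝ ∞ φ ∧ HasCompactSupport φ}, ⟨hc, hs⟩, ?_⟩
  rintro φ ⟨hc, hs⟩
  exact ⟨hc, ⟨1, one_pos, expDecay_of_hasCompactSupport hc.continuous hs 1⟩,
    fun v => ⟨(hc.fderiv_right (m := ∞) (by simp)).clm_apply contDiff_const,
      hs.fderiv_apply ℝ v⟩⟩

/-! ### Integration by parts on the half-plane -/

theorem halfPlane_eq_prod : halfPlane = univ ×ˢ Ioi (0 : ℝ) := by
  ext x; simp [halfPlane]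

theorem measurableSet_halfPlane : MeasurableSet halfPlane := by
  rw [halfPlane_eq_prod]
  exact MeasurableSet.univ.prod measurableSet_Ioi

theorem isOpen_halfPlane : IsOpen halfPlane := isOpen_lt continuous_const continuous_snd

theorem volume_restrict_halfPlane :
    (volume : Measure (ℝ × ℝ)).restrict halfPlane =
      (volume : Measure ℝ).prod (volume.restrict (Ioi (0 : ℝ))) := by
  rw [halfPlane_eq_prod, Measure.volume_eq_prod, ← Measure.prod_restrict, Measure.restrict_univ]

section Divergence

variable {E : Type*} [NormedAddCommGroup E] [NormedSpace ℝ E]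

theorem hasDerivAt_slice_fst {F : ℝ × ℝ → E} (hF : Differentiable ℝ F) (s t : ℝ) :
    HasDerivAt (fun s => F (s, t)) (fderiv ℝ F (s, t) (1, 0)) s :=
  (hF (s, t)).hasFDerivAt.comp_hasDerivAt s ((hasDerivAt_id s).prodMk (hasDerivAt_const s t))

theorem hasDerivAt_slice_snd {F : ℝ × ℝ → E} (hF : Differentiable ℝ F) (s t : ℝ) :
    HasDerivAt (fun t => F (s, t)) (fderiv ℝ F (s, t) (0, 1)) t :=
  (hF (s, t)).hasFDerivAt.comp_hasDerivAt t ((hasDerivAt_const t s).prodMk (hasDerivAt_id t))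

theorem setIntegral_halfPlane_fderiv_fst {F : ℝ × ℝ → E} (hF : Differentiable ℝ F)
    (hi : IntegrableOn F halfPlane) (hd : IntegrableOn (fun x => fderiv ℝ F x (1, 0)) halfPlane) :
    ∫ x in halfPlane, fderiv ℝ F x (1, 0) = 0 := by
  rw [IntegrableOn, volume_restrict_halfPlane] at hi hd
  rw [volume_restrict_halfPlane, integral_prod_symm _ hd]
  refine integral_eq_zero_of_ae ?_
  filter_upwards [hi.prod_left_ae, hd.prod_left_ae] with t h1 h2
  exact integral_eq_zero_of_hasDerivAt_of_integrable (fun s => hasDerivAt_slice_fst hF s t) h2 h1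

/-- No decay is assumed: on almost every normal line both the function and its derivative are
integrable, which forces the limit 0 at infinity. -/
theorem setIntegral_halfPlane_fderiv_snd [CompleteSpace E] {F : ℝ × ℝ → E} (hF : Differentiable ℝ F)
    (hi : IntegrableOn F halfPlane) (hd : IntegrableOn (fun x => fderiv ℝ F x (0, 1)) halfPlane) :
    ∫ x in halfPlane, fderiv ℝ F x (0, 1) = - ∫ s : ℝ, F (s, 0) := by
  rw [IntegrableOn, volume_restrict_halfPlane] at hi hd
  rw [volume_restrict_halfPlane, integral_prod _ hd, ← integral_neg]
  refine integral_congr_ae ?_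
  filter_upwards [hi.prod_right_ae, hd.prod_right_ae] with s h1 h2
  rw [integral_Ioi_of_hasDerivAt_of_tendsto' (fun t _ => hasDerivAt_slice_snd hF s t) h2
    (tendsto_zero_of_hasDerivAt_of_integrableOn_Ioi
      (fun t _ => hasDerivAt_slice_snd hF s t) h2 h1), zero_sub]

end Divergence

/-! ### Convolution with a half-plane kernel -/

/-- Symbols whose half-plane kernel is dominated by an integrable radial weight. -/
structure GoodSymbol (b : ℝ → ℂ) : Prop where
  isSymbol : IsSymbol b
  bound : ∃ C, ∀ y : ℝ × ℝ, 0 < y.2 → ‖stripKernel b y‖ ≤ C * yukawa (1 / 2) y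

theorem goodSymbol_symb {γ : ℝ} (hγ : 0 < γ) {ν : ℝ} (hν : |ν| ≤ 1) : GoodSymbol (symb γ ν) := by
  obtain ⟨C, _, hC⟩ := exists_norm_stripKernel_symb_le hγ (c := 1 / 2) (by norm_num) (by norm_num)
  exact ⟨isSymbol_symb hγ hν, C, hC ν hν⟩

/-- Smooth functions of compact support. -/
def IsTest (φ : ℝ × ℝ → ℂ) : Prop := ContDiff ℝ ∞ φ ∧ HasCompactSupport φ

theorem IsTest.nice {φ : ℝ × ℝ → ℂ} (hφ : IsTest φ) : Nice φ :=
  nice_of_hasCompactSupport hφ.1 hφ.2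

theorem IsTest.fderiv {φ : ℝ × ℝ → ℂ} (hφ : IsTest φ) (v : ℝ × ℝ) :
    IsTest fun x => fderiv ℝ φ x v :=
  ⟨(hφ.1.fderiv_right (m := ∞) (by simp)).clm_apply contDiff_const, hφ.2.fderiv_apply ℝ v⟩

/-- The convolution of `φ` with the kernel of symbol `b`, restricted to the half-plane. -/
def stripConv (b : ℝ → ℂ) (φ : ℝ × ℝ → ℂ) (x : ℝ × ℝ) : ℂ :=
  ∫ y in halfPlane, stripKernel b y * φ (x - y)

theorem GoodSymbol.integrableOn {b : ℝ → ℂ} (hb : GoodSymbol b) :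
    IntegrableOn (stripKernel b) halfPlane := by
  obtain ⟨C, hC⟩ := hb.bound
  refine (((integrable_yukawa one_half_pos).const_mul C).integrableOn).mono'
    (hb.isSymbol.continuousOn_stripKernel.aestronglyMeasurable measurableSet_halfPlane) ?_
  filter_upwards [ae_restrict_mem measurableSet_halfPlane] with y hy using hC y hy

theorem stripConv_eq_convolution (b : ℝ → ℂ) (φ : ℝ × ℝ → ℂ) :
    stripConv b φ =
      convolution (halfPlane.indicator (stripKernel b)) φ (ContinuousLinearMap.mul ℝ ℂ) volume := by
  funext x
  rw [convolution_def, stripConv, ← integral_indicator measurableSet_halfPlane]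
  congr 1
  funext y
  by_cases hy : y ∈ halfPlane <;> simp [hy]

theorem GoodSymbol.contDiff_stripConv {b : ℝ → ℂ} (hb : GoodSymbol b) {φ : ℝ × ℝ → ℂ}
    (hφ : IsTest φ) : ContDiff ℝ ∞ (stripConv b φ) := by
  rw [stripConv_eq_convolution]
  exact hφ.2.contDiff_convolution_right _
    (hb.integrableOn.integrable_indicator measurableSet_halfPlane).locallyIntegrable hφ.1

theorem GoodSymbol.fderiv_stripConv {b : ℝ → ℂ} (hb : GoodSymbol b) {φ : ℝ × ℝ → ℂ}
    (hφ : IsTest φ) (v x : ℝ × ℝ) :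
    fderiv ℝ (stripConv b φ) x v = stripConv b (fun x => fderiv ℝ φ x v) x := by
  have hl := (hb.integrableOn.integrable_indicator measurableSet_halfPlane).locallyIntegrable
  rw [stripConv_eq_convolution, stripConv_eq_convolution,
    (hφ.2.hasFDerivAt_convolution_right (ContinuousLinearMap.mul ℝ ℂ) hl
      (hφ.1.of_le (by simp)) x).fderiv,
    convolution_precompR_apply _ hl (hφ.2.fderiv ℝ) (hφ.1.continuous_fderiv (by simp))]

theorem GoodSymbol.expDecay_stripConv {b : ℝ → ℂ} (hb : GoodSymbol b) {φ : ℝ × ℝ → ℂ}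
    (hφ : IsTest φ) : ExpDecay (stripConv b φ) := by
  obtain ⟨C, hC⟩ := hb.bound
  obtain ⟨D, hD⟩ := expDecay_of_hasCompactSupport hφ.1.continuous hφ.2 (1 / 8)
  -- Of the kernel's rate 1/2, one half stays with the kernel for integrability. The other satisfies
  -- r/4 ≥ (|y₁| + |y₂|)/8 and moves the weight from x - y to x by the triangle inequality.
  refine ⟨1 / 8, by norm_num, ∫ y in halfPlane, |C| * |D| * yukawa (1 / 4) y, fun x => ?_⟩
  rw [← integral_mul_const]
  refine norm_integral_le_of_norm_le ((((integrable_yukawa (by norm_num)).const_mul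
    (|C| * |D|)).mul_const _).integrableOn) ?_
  filter_upwards [ae_restrict_mem measurableSet_halfPlane] with y hy
  have h1 : ‖stripKernel b y‖ ≤ |C| * yukawa (1 / 2) y :=
    (hC y hy).trans (mul_le_mul_of_nonneg_right (le_abs_self C) (yukawa_nonneg _ _))
  have h2 : ‖φ (x - y)‖ ≤ |D| * Real.exp (-(1 / 8 * (|(x - y).1| + |(x - y).2|))) :=
    (hD _).trans (mul_le_mul_of_nonneg_right (le_abs_self D) (Real.exp_pos _).le)
  have h3 : yukawa (1 / 2) y * Real.exp (-(1 / 8 * (|(x - y).1| + |(x - y).2|))) ≤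
      yukawa (1 / 4) y * Real.exp (-(1 / 8 * (|x.1| + |x.2|))) := by
    rw [yukawa, yukawa, div_mul_eq_mul_div (Real.exp (-(1 / 2 * euclNorm y))),
      div_mul_eq_mul_div (Real.exp (-(1 / 4 * euclNorm y))), ← Real.exp_add, ← Real.exp_add]
    refine div_le_div_of_nonneg_right (Real.exp_le_exp.2 ?_) (euclNorm_nonneg y)
    have h4 := abs_add_abs_le_two_mul_euclNorm y
    have h5 : |x.1| ≤ |(x - y).1| + |y.1| := by simpa using abs_add_le (x.1 - y.1) y.1
    have h6 : |x.2| ≤ |(x - y).2| + |y.2| := by simpa using abs_add_le (x.2 - y.2) y.2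
    linarith
  rw [norm_mul]
  calc _ ≤ |C| * yukawa (1 / 2) y *
        (|D| * Real.exp (-(1 / 8 * (|(x - y).1| + |(x - y).2|)))) :=
        mul_le_mul h1 h2 (norm_nonneg _) (mul_nonneg (abs_nonneg C) (yukawa_nonneg _ _))
    _ = |C| * |D| * (yukawa (1 / 2) y * Real.exp (-(1 / 8 * (|(x - y).1| + |(x - y).2|)))) := by
        ring
    _ ≤ |C| * |D| * (yukawa (1 / 4) y * Real.exp (-(1 / 8 * (|x.1| + |x.2|)))) := by gcongr
    _ = _ := by ring

theorem GoodSymbol.nice_stripConv {b : ℝ → ℂ} (hb : GoodSymbol b) {φ : ℝ × ℝ → ℂ}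
    (hφ : IsTest φ) : Nice (stripConv b φ) := by
  refine ⟨{f | ∃ φ, IsTest φ ∧ f = stripConv b φ}, ⟨φ, hφ, rfl⟩, ?_⟩
  rintro _ ⟨φ, hφ, rfl⟩
  exact ⟨hb.contDiff_stripConv hφ, hb.expDecay_stripConv hφ,
    fun v => ⟨_, hφ.fderiv v, funext fun x => hb.fderiv_stripConv hφ v x⟩⟩

/-! ### The partial Fourier transform -/

/-- The partial Fourier transform of `y ↦ φ (x - y)` on the line `y₂ = t`, damped by
`e^{-t cosh s}`. -/
def slab (φ : ℝ × ℝ → ℂ) (x : ℝ × ℝ) (s t : ℝ) : ℂ :=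
  ∫ r : ℝ, phase (r, t) s * φ (x.1 - r, x.2 - t)

/-- The Fourier-Laplace transform of `y ↦ φ (x - y)` on the half-plane. -/
def laplace (φ : ℝ × ℝ → ℂ) (x : ℝ × ℝ) (s : ℝ) : ℂ := ∫ t in Ioi (0 : ℝ), slab φ x s t

theorem norm_phase_le_one {y : ℝ × ℝ} (hy : 0 ≤ y.2) (s : ℝ) : ‖phase y s‖ ≤ 1 := by
  rw [norm_phase, Real.exp_le_one_iff]
  have := mul_nonneg hy (Real.cosh_pos s).le
  linarith

theorem continuous_phase_left (s : ℝ) : Continuous fun y => phase y s :=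
  continuous_phase.comp (by fun_prop : Continuous fun y : ℝ × ℝ => (y, s))

theorem Nice.expDecay_phase_mul {φ : ℝ × ℝ → ℂ} (hφ : Nice φ) (x : ℝ × ℝ) {t : ℝ} (ht : 0 ≤ t)
    (s : ℝ) : Integrable fun r : ℝ => phase (r, t) s * φ (x.1 - r, x.2 - t) := by
  have h1 : Integrable fun r : ℝ => φ (x.1 - r, x.2 - t) :=
    (hφ.expDecay.integrable_slice hφ.continuous (x.2 - t)).comp_sub_left x.1
  refine h1.norm.mono' (Continuous.aestronglyMeasurable ?_) (Eventually.of_forall fun r => ?_)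
  · have := hφ.continuous
    exact ((continuous_phase_left s).comp (by fun_prop)).mul (by fun_prop)
  · rw [norm_mul]
    exact mul_le_of_le_one_left (norm_nonneg _) (norm_phase_le_one ht s)

theorem IsTest.exists_norm_slab_le {φ : ℝ × ℝ → ℂ} (hφ : IsTest φ) :
    ∃ C, 0 ≤ C ∧ ∀ x s t, 0 ≤ t → ‖slab φ x s t‖ ≤ C * Real.exp (-|x.2 - t|) := by
  obtain ⟨D, hD⟩ := expDecay_of_hasCompactSupport hφ.1.continuous hφ.2 1
  have hi : Integrable fun r : ℝ => Real.exp (-|r|) := by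
    simpa using integrable_exp_neg_mul_abs one_pos
  refine ⟨|D| * ∫ r : ℝ, Real.exp (-|r|),
    mul_nonneg (abs_nonneg D) (integral_nonneg fun r => (Real.exp_pos _).le), fun x s t ht => ?_⟩
  have e : ∫ r : ℝ, Real.exp (-|r|) = ∫ r : ℝ, Real.exp (-|x.1 - r|) :=
    (integral_sub_left_eq_self (fun r => Real.exp (-|r|)) volume x.1).symm
  rw [e, mul_assoc, ← integral_mul_const, ← integral_const_mul]
  refine norm_integral_le_of_norm_le (((hi.comp_sub_left x.1).mul_const _).const_mul _)
    (Eventually.of_forall fun r => ?_)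
  rw [norm_mul]
  calc _ ≤ 1 * (|D| * Real.exp (-(1 * (|x.1 - r| + |x.2 - t|)))) := by
        refine mul_le_mul (norm_phase_le_one ht s) ((hD _).trans ?_) (norm_nonneg _) zero_le_one
        exact mul_le_mul_of_nonneg_right (le_abs_self D) (Real.exp_pos _).le
    _ = _ := by rw [one_mul, one_mul, neg_add, Real.exp_add]

theorem hasDerivAt_phase_fst (s t r : ℝ) :
    HasDerivAt (fun r => phase (r, t) s) (Complex.I * Real.sinh s * phase (r, t) s) r := by
  have h : HasDerivAt (fun r : ℝ => Complex.I * ((r * Real.sinh s : ℝ) : ℂ) -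
      ((t * Real.cosh s : ℝ) : ℂ)) (Complex.I * ((1 * Real.sinh s : ℝ) : ℂ)) r :=
    ((((hasDerivAt_id r).mul_const (Real.sinh s)).ofReal_comp).const_mul Complex.I).sub_const _
  refine h.cexp.congr_deriv ?_
  change phase (r, t) s * _ = _
  push_cast
  ring

theorem hasDerivAt_phase_snd (s t r : ℝ) :
    HasDerivAt (fun t => phase (r, t) s) (-(Real.cosh s) * phase (r, t) s) t := by
  have h : HasDerivAt (fun t : ℝ => Complex.I * ((r * Real.sinh s : ℝ) : ℂ) -
      ((t * Real.cosh s : ℝ) : ℂ)) (-((1 * Real.cosh s : ℝ) : ℂ)) t :=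
    (((hasDerivAt_id t).mul_const (Real.cosh s)).ofReal_comp).const_sub _
  refine h.cexp.congr_deriv ?_
  change phase (r, t) s * _ = _
  push_cast
  ring

theorem Nice.slab_fderiv_fst {φ : ℝ × ℝ → ℂ} (hφ : Nice φ) (x : ℝ × ℝ) (s : ℝ) {t : ℝ}
    (ht : 0 ≤ t) :
    slab (fun x => _root_.fderiv ℝ φ x (1, 0)) x s t = Complex.I * Real.sinh s * slab φ x s t := by
  have hi := hφ.expDecay_phase_mul x ht s
  have hd := (hφ.fderiv (1, 0)).expDecay_phase_mul x ht s
  have hderiv : ∀ r : ℝ, HasDerivAt (fun r => phase (r, t) s * φ (x.1 - r, x.2 - t))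
      (Complex.I * Real.sinh s * (phase (r, t) s * φ (x.1 - r, x.2 - t)) -
        phase (r, t) s * _root_.fderiv ℝ φ (x.1 - r, x.2 - t) (1, 0)) r := fun r => by
    have h1 := (hasDerivAt_slice_fst hφ.differentiable (x.1 - r) (x.2 - t)).scomp r
      ((hasDerivAt_id r).const_sub x.1)
    refine ((hasDerivAt_phase_fst s t r).mul h1).congr_deriv ?_
    rw [Function.comp_apply, neg_smul, one_smul]
    ring
  have h0 := integral_eq_zero_of_hasDerivAt_of_integrable hderiv ((hi.const_mul _).sub hd) hi
  rw [integral_sub (hi.const_mul _) hd, integral_const_mul, sub_eq_zero] at h0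
  exact h0.symm

/-- The derivative ∂₁ corresponds to i sinh s, so 1 - ∂₁² corresponds to 1 + sinh² s = cosh² s.
Smoothness of φ along the boundary is thereby traded for decay in s. -/
theorem IsTest.cosh_sq_mul_slab {φ : ℝ × ℝ → ℂ} (hφ : IsTest φ) (x : ℝ × ℝ) (s : ℝ) {t : ℝ}
    (ht : 0 ≤ t) :
    (Real.cosh s : ℂ) ^ 2 * slab φ x s t = slab φ x s t -
      slab (fun x => _root_.fderiv ℝ (fun x => _root_.fderiv ℝ φ x (1, 0)) x (1, 0)) x s t := by
  rw [(hφ.nice.fderiv (1, 0)).slab_fderiv_fst x s ht, hφ.nice.slab_fderiv_fst x s ht]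
  have h : (Real.cosh s : ℂ) ^ 2 = 1 + (Real.sinh s : ℂ) ^ 2 := by
    rw [add_comm]
    exact_mod_cast Real.cosh_sq s
  rw [h]
  linear_combination ((Real.sinh s : ℂ) ^ 2 * slab φ x s t) * Complex.I_sq

/-- The damping e^{-t cosh s} is lost at t = 0; the factor e^{-2|s|}, uniform in t ≥ 0, replaces it
and beats the growth e^{|s|} of a symbol. -/
theorem IsTest.exists_norm_slab_le_div {φ : ℝ × ℝ → ℂ} (hφ : IsTest φ) :
    ∃ C, 0 ≤ C ∧ ∀ x s t, 0 ≤ t →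
      ‖slab φ x s t‖ ≤ C * Real.exp (-(2 * |s|)) * Real.exp (-|x.2 - t|) := by
  obtain ⟨C, hC0, hC⟩ := hφ.exists_norm_slab_le
  obtain ⟨D, hD0, hD⟩ := ((hφ.fderiv (1, 0)).fderiv (1, 0)).exists_norm_slab_le
  refine ⟨4 * (C + D), by positivity, fun x s t ht => ?_⟩
  have h1 : Real.cosh s ^ 2 * ‖slab φ x s t‖ ≤ (C + D) * Real.exp (-|x.2 - t|) := by
    have := congrArg norm (hφ.cosh_sq_mul_slab x s ht)
    rw [norm_mul, norm_pow, Complex.norm_real, Real.norm_of_nonneg (Real.cosh_pos s).le] at this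
    rw [this, add_mul]
    exact (norm_sub_le _ _).trans (add_le_add (hC x s t ht) (hD x s t ht))
  have h2 : Real.exp (2 * |s|) ≤ 4 * Real.cosh s ^ 2 := by
    have := pow_le_pow_left₀ (Real.exp_pos _).le (exp_abs_le_two_mul_cosh s) 2
    rw [← Real.exp_nat_mul] at this
    calc _ = Real.exp ((2 : ℕ) * |s|) := by norm_num
      _ ≤ _ := this
      _ = _ := by ring
  rw [Real.exp_neg, mul_right_comm, ← div_eq_mul_inv, le_div_iff₀ (Real.exp_pos _)]
  calc _ ≤ ‖slab φ x s t‖ * (4 * Real.cosh s ^ 2) := by gcongr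
    _ = 4 * (Real.cosh s ^ 2 * ‖slab φ x s t‖) := by ring
    _ ≤ 4 * ((C + D) * Real.exp (-|x.2 - t|)) := by gcongr
    _ = _ := by ring

theorem integrable_exp_neg_abs_sub (a : ℝ) : Integrable fun t : ℝ => Real.exp (-|a - t|) := by
  have hi : Integrable fun r : ℝ => Real.exp (-|r|) := by
    simpa using integrable_exp_neg_mul_abs one_pos
  exact hi.comp_sub_left a

theorem Nice.aestronglyMeasurable_slab {φ : ℝ × ℝ → ℂ} (hφ : Nice φ) (x : ℝ × ℝ) :
    StronglyMeasurable fun p : ℝ × ℝ => slab φ x p.1 p.2 := by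
  refine StronglyMeasurable.integral_prod_right
    (f := fun (p : ℝ × ℝ) (r : ℝ) => phase (r, p.2) p.1 * φ (x.1 - r, x.2 - p.2)) ?_
  refine Continuous.stronglyMeasurable ?_
  have := hφ.continuous
  exact (continuous_phase.comp
    (by fun_prop : Continuous fun q : (ℝ × ℝ) × ℝ => ((q.2, q.1.2), q.1.1))).mul (by fun_prop)

theorem Nice.integrableOn_phase_mul {φ : ℝ × ℝ → ℂ} (hφ : Nice φ) (x : ℝ × ℝ) (s : ℝ) :
    IntegrableOn (fun y => phase y s * φ (x - y)) halfPlane := by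
  have h1 : Integrable fun y : ℝ × ℝ => φ (x - y) := hφ.integrable.comp_sub_left x
  have := hφ.continuous
  refine h1.norm.integrableOn.mono' (Continuous.aestronglyMeasurable
    ((continuous_phase_left s).mul (by fun_prop))) ?_
  filter_upwards [ae_restrict_mem measurableSet_halfPlane] with y hy
  rw [norm_mul]
  exact mul_le_of_le_one_left (norm_nonneg _) (norm_phase_le_one (le_of_lt hy) s)

theorem Nice.laplace_eq {φ : ℝ × ℝ → ℂ} (hφ : Nice φ) (x : ℝ × ℝ) (s : ℝ) :
    laplace φ x s = ∫ y in halfPlane, phase y s * φ (x - y) := by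
  have h := hφ.integrableOn_phase_mul x s
  rw [IntegrableOn, volume_restrict_halfPlane] at h
  rw [volume_restrict_halfPlane, integral_prod_symm _ h]
  rfl

theorem IsTest.exists_norm_laplace_le {φ : ℝ × ℝ → ℂ} (hφ : IsTest φ) (x : ℝ × ℝ) :
    ∃ C, ∀ s, ‖laplace φ x s‖ ≤ C * Real.exp (-(2 * |s|)) := by
  obtain ⟨C, hC0, hC⟩ := hφ.exists_norm_slab_le_div
  refine ⟨C * ∫ t in Ioi (0 : ℝ), Real.exp (-|x.2 - t|), fun s => ?_⟩
  rw [mul_right_comm, ← integral_const_mul]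
  refine norm_integral_le_of_norm_le
    ((integrable_exp_neg_abs_sub x.2).const_mul _).integrableOn ?_
  filter_upwards [ae_restrict_mem measurableSet_Ioi] with t ht using hC x s t (le_of_lt ht)

theorem IsSymbol.integrable_mul {b g : ℝ → ℂ} (hb : IsSymbol b) (hg : AEStronglyMeasurable g volume)
    {C : ℝ} (hC : ∀ s, ‖g s‖ ≤ C * Real.exp (-(2 * |s|))) : Integrable fun s => b s * g s := by
  obtain ⟨hc, A, hA⟩ := hb
  refine ((integrable_exp_neg_mul_abs one_pos).const_mul (A * C)).mono'
    (hc.aestronglyMeasurable.mul hg) (Eventually.of_forall fun s => ?_)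
  rw [norm_mul]
  calc _ ≤ (A * Real.exp |s|) * (C * Real.exp (-(2 * |s|))) :=
        mul_le_mul (hA s) (hC s) (norm_nonneg _) ((norm_nonneg _).trans (hA s))
    _ = A * C * (Real.exp |s| * Real.exp (-(2 * |s|))) := by ring
    _ = _ := by rw [← Real.exp_add]; ring_nf

theorem IsTest.aestronglyMeasurable_laplace {φ : ℝ × ℝ → ℂ} (hφ : IsTest φ) (x : ℝ × ℝ) :
    AEStronglyMeasurable (laplace φ x) volume :=
  (StronglyMeasurable.integral_prod_right (ν := volume.restrict (Ioi (0 : ℝ)))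
    (f := fun s t => slab φ x s t) (hφ.nice.aestronglyMeasurable_slab x)).aestronglyMeasurable

theorem IsSymbol.integrable_mul_laplace {b : ℝ → ℂ} (hb : IsSymbol b) {φ : ℝ × ℝ → ℂ}
    (hφ : IsTest φ) (x : ℝ × ℝ) : Integrable fun s => b s * laplace φ x s := by
  obtain ⟨C, hC⟩ := hφ.exists_norm_laplace_le x
  exact hb.integrable_mul (hφ.aestronglyMeasurable_laplace x) hC

theorem IsSymbol.integrable_mul_slab {b : ℝ → ℂ} (hb : IsSymbol b) {φ : ℝ × ℝ → ℂ}
    (hφ : IsTest φ) (x : ℝ × ℝ) : Integrable fun s => b s * slab φ x s 0 := by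
  obtain ⟨C, hC0, hC⟩ := hφ.exists_norm_slab_le_div
  refine hb.integrable_mul (C := C * Real.exp (-|x.2 - 0|))
    ((hφ.nice.aestronglyMeasurable_slab x).comp_measurable
      (measurable_prodMk_right (y := (0 : ℝ)))).aestronglyMeasurable fun s => ?_
  rw [mul_right_comm]
  exact hC x s 0 le_rfl

theorem GoodSymbol.integrableOn_mul {b : ℝ → ℂ} (hb : GoodSymbol b) {φ : ℝ × ℝ → ℂ}
    (hφ : Nice φ) (x : ℝ × ℝ) :
    IntegrableOn (fun y => stripKernel b y * φ (x - y)) halfPlane := by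
  obtain ⟨K, hK⟩ := hφ.expDecay.exists_norm_le
  have := hφ.continuous
  exact hb.integrableOn.mul_bdd (c := K) (by fun_prop) (Eventually.of_forall fun y => hK _)

/-- The convolution is the inverse of the partial Fourier transform. -/
theorem GoodSymbol.stripConv_eq {b : ℝ → ℂ} (hb : GoodSymbol b) {φ : ℝ × ℝ → ℂ} (hφ : IsTest φ)
    (x : ℝ × ℝ) :
    stripConv b φ x = 1 / (4 * Real.pi) * ∫ s : ℝ, b s * laplace φ x s := by
  have h := hb.integrableOn_mul hφ.nice x
  rw [IntegrableOn, volume_restrict_halfPlane] at h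
  rw [stripConv, volume_restrict_halfPlane, integral_prod_symm _ h]
  have hbc := hb.isSymbol.1
  obtain ⟨A, hA⟩ := hb.isSymbol.2
  have hφc := hφ.1.continuous
  -- Fubini is applied twice. At fixed t > 0 the damping e^{-t cosh s} makes the integral in (r, s)
  -- absolutely convergent; the exchange of t and s in `hswap`, with t ranging down to 0, relies on
  -- the decay e^{-2|s|} of the slabs.
  have step : ∀ t ∈ Ioi (0 : ℝ), ∫ r : ℝ, stripKernel b (r, t) * φ (x - (r, t)) =
      1 / (4 * Real.pi) * ∫ s : ℝ, b s * slab φ x s t := fun t ht => by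
    have ht : 0 < t := ht
    have hprod : Integrable (Function.uncurry fun (r s : ℝ) =>
        phase (r, t) s * b s * φ (x - (r, t))) (volume.prod volume) := by
      have h1 : Integrable fun r : ℝ => φ (x.1 - r, x.2 - t) :=
        (hφ.nice.expDecay.integrable_slice hφc (x.2 - t)).comp_sub_left x.1
      have h2 := (integrable_exp_abs_mul_exp_neg_cosh ht).const_mul A
      refine (h1.norm.mul_prod h2).mono' (Continuous.aestronglyMeasurable ?_)
        (Eventually.of_forall fun p => ?_)
      · exact ((continuous_phase.comp (by fun_prop :
          Continuous fun q : ℝ × ℝ => ((q.1, t), q.2))).mul (by fun_prop)).mul (by fun_prop)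
      · simp only [Function.uncurry]
        rw [norm_mul, mul_comm]
        exact mul_le_mul_of_nonneg_left (IsSymbol.norm_phase_mul_le hA le_rfl p.2) (norm_nonneg _)
    calc _ = ∫ r : ℝ, ∫ s : ℝ, 1 / (4 * Real.pi) * (phase (r, t) s * b s * φ (x - (r, t))) := by
          congr 1
          funext r
          rw [stripKernel, integral_const_mul, integral_mul_const, mul_assoc]
      _ = 1 / (4 * Real.pi) * ∫ r : ℝ, ∫ s : ℝ, phase (r, t) s * b s * φ (x - (r, t)) := by
          simp_rw [integral_const_mul]
      _ = _ := by
          rw [integral_integral_swap hprod]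
          congr 2
          funext s
          rw [slab, ← integral_const_mul]
          congr 1
          funext r
          change _ = b s * (phase (r, t) s * φ (x - (r, t)))
          ring
  rw [setIntegral_congr_fun measurableSet_Ioi step, integral_const_mul]
  congr 1
  obtain ⟨C, hC0, hC⟩ := hφ.exists_norm_slab_le_div
  have hswap : Integrable (Function.uncurry fun (t s : ℝ) => b s * slab φ x s t)
      ((volume.restrict (Ioi 0)).prod volume) := by
    have h1 : Integrable (fun t : ℝ => Real.exp (-|x.2 - t|)) (volume.restrict (Ioi 0)) :=
      (integrable_exp_neg_abs_sub x.2).integrableOn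
    have h2 : Integrable fun s : ℝ => ‖b s * Real.exp (-(2 * |s|))‖ :=
      (hb.isSymbol.integrable_mul (g := fun s => (Real.exp (-(2 * |s|)) : ℂ)) (C := 1)
        (Continuous.aestronglyMeasurable (by fun_prop)) fun s => by
          rw [Complex.norm_real, Real.norm_of_nonneg (Real.exp_pos _).le, one_mul]).norm
    refine ((h1.const_mul C).mul_prod h2).mono' ?_ ?_
    · exact ((hbc.comp continuous_snd).aestronglyMeasurable).mul
        ((hφ.nice.aestronglyMeasurable_slab x).comp_measurable
          (measurable_swap (α := ℝ) (β := ℝ))).aestronglyMeasurable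
    · have : ∀ᵐ p : ℝ × ℝ ∂((volume.restrict (Ioi (0 : ℝ))).prod volume), p.1 ∈ Ioi (0 : ℝ) :=
        Measure.quasiMeasurePreserving_fst.ae (ae_restrict_mem measurableSet_Ioi)
      filter_upwards [this] with p hp
      simp only [Function.uncurry]
      rw [norm_mul, norm_mul, Complex.norm_real, Real.norm_of_nonneg (Real.exp_pos _).le]
      calc _ ≤ ‖b p.2‖ * (C * Real.exp (-(2 * |p.2|)) * Real.exp (-|x.2 - p.1|)) :=
            mul_le_mul_of_nonneg_left (hC x p.2 p.1 (le_of_lt hp)) (norm_nonneg _)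
        _ = _ := by ring
  rw [integral_integral_swap hswap]
  congr 1
  funext s
  rw [integral_const_mul, laplace]

theorem IsTest.laplace_fderiv_fst {φ : ℝ × ℝ → ℂ} (hφ : IsTest φ) (x : ℝ × ℝ) (s : ℝ) :
    laplace (fun x => _root_.fderiv ℝ φ x (1, 0)) x s =
      Complex.I * Real.sinh s * laplace φ x s := by
  rw [laplace, laplace, ← integral_const_mul]
  exact setIntegral_congr_fun measurableSet_Ioi
    fun t ht => hφ.nice.slab_fderiv_fst x s (le_of_lt ht)

/-- Integration by parts puts the normal derivative on e^{-t cosh s} and leaves the slice at t = 0.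
That slice is where the source term of the equation will come from. -/
theorem IsTest.laplace_fderiv_snd {φ : ℝ × ℝ → ℂ} (hφ : IsTest φ) (x : ℝ × ℝ) (s : ℝ) :
    laplace (fun x => _root_.fderiv ℝ φ x (0, 1)) x s =
      slab φ x s 0 - Real.cosh s * laplace φ x s := by
  have hn := hφ.nice
  have hi := hn.integrableOn_phase_mul x s
  have hd := (hn.fderiv (0, 1)).integrableOn_phase_mul x s
  have hdiff : Differentiable ℝ fun y : ℝ × ℝ => phase y s * φ (x - y) := by
    have h1 : Differentiable ℝ fun y : ℝ × ℝ => phase y s := by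
      unfold phase
      refine Differentiable.cexp ((Differentiable.const_mul ?_ _).sub ?_)
      · exact Complex.ofRealCLM.differentiable.comp (differentiable_fst.mul_const (Real.sinh s))
      · exact Complex.ofRealCLM.differentiable.comp (differentiable_snd.mul_const (Real.cosh s))
    exact h1.mul (hn.differentiable.comp (by fun_prop))
  have hderiv : ∀ y : ℝ × ℝ, _root_.fderiv ℝ (fun y => phase y s * φ (x - y)) y (0, 1) =
      -(Real.cosh s) * (phase y s * φ (x - y)) -
        phase y s * _root_.fderiv ℝ φ (x - y) (0, 1) := fun y => by
    have h1 := hasDerivAt_slice_snd hdiff y.1 y.2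
    have h2 := (hasDerivAt_slice_snd hn.differentiable (x.1 - y.1) (x.2 - y.2)).scomp y.2
      ((hasDerivAt_id y.2).const_sub x.2)
    rw [h1.unique ((hasDerivAt_phase_snd s y.2 y.1).mul h2), neg_smul, one_smul]
    change -(Real.cosh s : ℂ) * phase (y.1, y.2) s * φ (x.1 - y.1, x.2 - y.2) + _ =
      -(Real.cosh s) * (phase (y.1, y.2) s * φ (x.1 - y.1, x.2 - y.2)) -
        phase (y.1, y.2) s * _root_.fderiv ℝ φ (x.1 - y.1, x.2 - y.2) (0, 1)
    ring
  have hF := setIntegral_halfPlane_fderiv_snd hdiff hi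
    (((hi.const_mul _).sub hd).congr (Eventually.of_forall fun y => (hderiv y).symm))
  simp only [hderiv] at hF
  rw [integral_sub (hi.const_mul _) hd, integral_const_mul] at hF
  rw [hn.laplace_eq, (hn.fderiv (0, 1)).laplace_eq]
  change _ = -slab φ x s 0 at hF
  linear_combination -hF

/-- The boundary term that arises from the jump of a kernel across `y₂ = 0`. -/
def jumpTerm (b : ℝ → ℂ) (φ : ℝ × ℝ → ℂ) (x : ℝ × ℝ) : ℂ :=
  1 / (4 * Real.pi) * ∫ s : ℝ, b s * slab φ x s 0

/-- On the transform side -i∂₁ is sinh s and -∂₂ is cosh s minus the boundary slice, and sinh s +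
cosh s = e^s. With the opposite sign of ∂₂, as in the next lemma, the multiplier is sinh s - cosh s
= -e^{-s} and the slice changes sign. -/
theorem GoodSymbol.fderiv_fst_add_fderiv_snd_stripConv {b b' : ℝ → ℂ} (hb : GoodSymbol b)
    (hb' : GoodSymbol b') (h : ∀ s, b' s = Complex.exp s * b s) {φ : ℝ × ℝ → ℂ} (hφ : IsTest φ)
    (x : ℝ × ℝ) :
    -Complex.I * fderiv ℝ (stripConv b φ) x (1, 0) - fderiv ℝ (stripConv b φ) x (0, 1) =
      stripConv b' φ x - jumpTerm b φ x := by
  rw [hb.fderiv_stripConv hφ, hb.fderiv_stripConv hφ, hb.stripConv_eq (hφ.fderiv _),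
    hb.stripConv_eq (hφ.fderiv _), hb'.stripConv_eq hφ, jumpTerm]
  have i1 := (hb.isSymbol.integrable_mul_laplace (hφ.fderiv (1, 0)) x).const_mul (-Complex.I)
  have i2 := hb.isSymbol.integrable_mul_laplace (hφ.fderiv (0, 1)) x
  have i3 := hb'.isSymbol.integrable_mul_laplace hφ x
  have i4 := hb.isSymbol.integrable_mul_slab hφ x
  rw [mul_left_comm, ← mul_sub, ← mul_sub, ← integral_const_mul, ← integral_sub i1 i2,
    ← integral_sub i3 i4]
  congr 2
  funext s
  rw [hφ.laplace_fderiv_fst, hφ.laplace_fderiv_snd, h, Complex.ofReal_sinh, Complex.ofReal_cosh,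
    Complex.sinh, Complex.cosh]
  linear_combination (-((Complex.exp s - Complex.exp (-s)) / 2) * laplace φ x s * b s) *
    Complex.I_sq

theorem GoodSymbol.fderiv_fst_sub_fderiv_snd_stripConv {b b' : ℝ → ℂ} (hb : GoodSymbol b)
    (hb' : GoodSymbol b') (h : ∀ s, b' s = Complex.exp (-s) * b s) {φ : ℝ × ℝ → ℂ}
    (hφ : IsTest φ) (x : ℝ × ℝ) :
    -Complex.I * fderiv ℝ (stripConv b φ) x (1, 0) + fderiv ℝ (stripConv b φ) x (0, 1) =
      -stripConv b' φ x + jumpTerm b φ x := by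
  rw [hb.fderiv_stripConv hφ, hb.fderiv_stripConv hφ, hb.stripConv_eq (hφ.fderiv _),
    hb.stripConv_eq (hφ.fderiv _), hb'.stripConv_eq hφ, jumpTerm]
  have i1 := (hb.isSymbol.integrable_mul_laplace (hφ.fderiv (1, 0)) x).const_mul (-Complex.I)
  have i2 := hb.isSymbol.integrable_mul_laplace (hφ.fderiv (0, 1)) x
  have i3 := hb'.isSymbol.integrable_mul_laplace hφ x
  have i4 := hb.isSymbol.integrable_mul_slab hφ x
  rw [mul_left_comm, ← mul_add, neg_add_eq_sub, ← mul_sub, ← integral_const_mul,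
    ← integral_add i1 i2, ← integral_sub i4 i3]
  congr 2
  funext s
  rw [hφ.laplace_fderiv_fst, hφ.laplace_fderiv_snd, h, Complex.ofReal_sinh, Complex.ofReal_cosh,
    Complex.sinh, Complex.cosh]
  linear_combination (-((Complex.exp s - Complex.exp (-s)) / 2) * laplace φ x s * b s) *
    Complex.I_sq

/-- The change of variables ξ = sinh s, a bijection of the line; no integrability is needed. -/
theorem integral_cosh_mul_comp_sinh {E : Type*} [NormedAddCommGroup E] [NormedSpace ℝ E]
    (g : ℝ → E) : ∫ s : ℝ, Real.cosh s • g (Real.sinh s) = ∫ ξ : ℝ, g ξ := by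
  have h := integral_image_eq_integral_abs_deriv_smul (s := univ) MeasurableSet.univ
    (fun s _ => (Real.hasDerivAt_sinh s).hasDerivWithinAt) Real.sinh_injective.injOn g
  rw [image_univ, Real.sinh_surjective.range_eq] at h
  simp only [setIntegral_univ] at h
  rw [h]
  congr 1
  funext s
  rw [abs_of_pos (Real.cosh_pos s)]

/-- The Fourier inversion formula on the line `y₂ = x₂`. -/
theorem IsTest.jumpTerm_two_mul_cosh {φ : ℝ × ℝ → ℂ} (hφ : IsTest φ) (x : ℝ × ℝ) :
    jumpTerm (fun s => 2 * Real.cosh s) φ x = φ x := by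
  have hs : HasCompactSupport fun t : ℝ => φ (t, x.2) :=
    hφ.2.comp_isClosedEmbedding (Topology.IsClosedEmbedding.of_continuous_injective_isClosedMap
      (by fun_prop) (fun a b h => (Prod.mk.inj h).1) (isClosedMap_prodMk_right x.2))
  have hc : ContDiff ℝ ∞ fun t : ℝ => φ (t, x.2) := hφ.1.comp (by fun_prop)
  set G := hs.toSchwartzMap hc with hG
  have hGv : ∀ t, G t = φ (t, x.2) := fun t => rfl
  have hinv : FourierTransformInv.fourierInv (FourierTransform.fourier (G : ℝ → ℂ)) x.1 =
      φ x := by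
    have := G.continuous.fourierInv_fourier_eq G.integrable
      (by rw [← SchwartzMap.fourier_coe]; exact SchwartzMap.integrable _)
    rw [this, hGv]
  -- At t = 0 there is no damping, so after r ↦ x₁ - r the slab is a modulated Fourier transform at
  -- frequency sinh s/(2π). The weight 2 cosh s ds is 2 dξ, which completes the prefactor 1/(4π) to
  -- 1/(2π).
  have hslab : ∀ s, slab φ x s 0 = Complex.exp (Complex.I * ((x.1 * Real.sinh s : ℝ) : ℂ)) *
      FourierTransform.fourier (G : ℝ → ℂ) (Real.sinh s / (2 * Real.pi)) := fun s => by
    rw [slab, Real.fourier_eq', ← integral_const_mul,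
      ← integral_sub_left_eq_self (fun r => phase (r, 0) s * φ (x.1 - r, x.2 - 0)) volume x.1]
    congr 1
    funext r
    rw [hGv, smul_eq_mul, ← mul_assoc, ← Complex.exp_add, phase]
    have hπ : (Real.pi : ℂ) ≠ 0 := Complex.ofReal_ne_zero.2 Real.pi_ne_zero
    congr 2
    · simp
      field_simp
      ring
    · simp
  have hπ := Real.pi_pos
  rw [jumpTerm]
  calc _ = 1 / (4 * Real.pi) * ∫ s : ℝ, Real.cosh s • (2 *
        (Complex.exp (Complex.I * ((x.1 * Real.sinh s : ℝ) : ℂ)) *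
          FourierTransform.fourier (G : ℝ → ℂ) (Real.sinh s / (2 * Real.pi)))) := by
        congr 2
        funext s
        rw [hslab, Complex.real_smul]
        ring
    _ = 1 / (2 * Real.pi) * ∫ ξ : ℝ, Complex.exp (Complex.I * ((x.1 * ξ : ℝ) : ℂ)) *
          FourierTransform.fourier (G : ℝ → ℂ) (ξ / (2 * Real.pi)) := by
        rw [integral_cosh_mul_comp_sinh (fun ξ => 2 *
          (Complex.exp (Complex.I * ((x.1 * ξ : ℝ) : ℂ)) *
            FourierTransform.fourier (G : ℝ → ℂ) (ξ / (2 * Real.pi)))), integral_const_mul,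
          ← mul_assoc]
        congr 1
        have hπ : (Real.pi : ℂ) ≠ 0 := Complex.ofReal_ne_zero.2 Real.pi_ne_zero
        field_simp
        norm_num
    _ = ∫ w : ℝ, Complex.exp (Complex.I * ((x.1 * (w * (2 * Real.pi)) : ℝ) : ℂ)) *
          FourierTransform.fourier (G : ℝ → ℂ) w := by
        have := Measure.integral_comp_mul_right (fun ξ : ℝ =>
          Complex.exp (Complex.I * ((x.1 * ξ : ℝ) : ℂ)) *
            FourierTransform.fourier (G : ℝ → ℂ) (ξ / (2 * Real.pi))) (2 * Real.pi)
        rw [abs_of_pos (by positivity), Complex.real_smul] at this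
        push_cast at this ⊢
        rw [one_div, ← this]
        congr 1
        funext w
        rw [mul_div_assoc, div_self (by positivity), mul_one]
    _ = φ x := by
        rw [← hinv, Real.fourierInv_eq']
        congr 1
        funext w
        rw [smul_eq_mul]
        congr 2
        simp
        ring

/-! ### The resolvent kernel -/

/-- The reflection across the boundary line. -/
def flip (x : ℝ × ℝ) : ℝ × ℝ := (x.1, -x.2)

theorem measurePreserving_flip : MeasurePreserving flip :=
  (MeasurePreserving.id volume).prod (Measure.measurePreserving_neg volume)

/-- The reflection across the boundary line as a homeomorphism. -/
def flipHomeomorph : ℝ × ℝ ≃ₜ ℝ × ℝ := (Homeomorph.refl ℝ).prodCongr (Homeomorph.neg ℝ)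

theorem integral_comp_flip (g : ℝ × ℝ → ℂ) : ∫ x, g (flip x) = ∫ x, g x :=
  measurePreserving_flip.integral_comp flipHomeomorph.measurableEmbedding g

/-- The reflection across the boundary line as a continuous linear map. -/
def flipL : ℝ × ℝ →L[ℝ] ℝ × ℝ :=
  (ContinuousLinearMap.fst ℝ ℝ ℝ).prod (-(ContinuousLinearMap.snd ℝ ℝ ℝ))

theorem IsTest.comp_flip {φ : ℝ × ℝ → ℂ} (hφ : IsTest φ) : IsTest fun x => φ (flip x) :=
  ⟨hφ.1.comp flipL.contDiff, hφ.2.comp_homeomorph flipHomeomorph⟩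

theorem Nice.comp_flip {u : ℝ × ℝ → ℂ} (hu : Nice u) : Nice fun x => u (flip x) :=
  hu.comp_linear flipL one_pos fun x => by simp [flipL]

theorem fderiv_comp_flip {u : ℝ × ℝ → ℂ} (hu : Differentiable ℝ u) (x v : ℝ × ℝ) :
    fderiv ℝ (fun x => u (flip x)) x v = fderiv ℝ u (flip x) (flip v) := by
  have := ((hu (flip x)).hasFDerivAt.comp x flipL.hasFDerivAt).fderiv
  rw [Function.comp_def] at this
  rw [this]
  rfl

/-- The resolvent kernel of the whole plane. -/
def planeKernel (y : ℝ × ℝ) : Matrix (Fin 2) (Fin 2) ℂ :=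
  !![1 / (4 * Real.pi) * (Complex.I * besselInt 0 (euclNorm y)),
      1 / (4 * Real.pi) * ((y.2 + y.1 * Complex.I) / euclNorm y * besselInt 1 (euclNorm y));
    1 / (4 * Real.pi) * ((-y.2 + y.1 * Complex.I) / euclNorm y * besselInt 1 (euclNorm y)),
      1 / (4 * Real.pi) * (Complex.I * besselInt 0 (euclNorm y))]

/-- The contribution of the boundary to the resolvent kernel. -/
def mirrorKernel (γ : ℝ) (y : ℝ × ℝ) : Matrix (Fin 2) (Fin 2) ℂ :=
  !![stripKernel (symb γ 1) y, Complex.I * stripKernel (symb γ 0) y;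
    Complex.I * stripKernel (symb γ 0) y, -stripKernel (symb γ (-1)) y]

/-- The resolvent kernel at `i`. -/
def unitKernel (γ : ℝ) (x x' : ℝ × ℝ) : Matrix (Fin 2) (Fin 2) ℂ :=
  planeKernel (x - x') + mirrorKernel γ (x.1 - x'.1, x.2 + x'.2)

/-- The resolvent kernel at `iλ`. -/
def diracKernel (γ lam : ℝ) (x x' : ℝ × ℝ) : Matrix (Fin 2) (Fin 2) ℂ :=
  if 0 < lam then (lam : ℂ) • unitKernel γ (lam • x) (lam • x')
  else (((-lam : ℝ) : ℂ) • unitKernel γ ((-lam) • x') ((-lam) • x))ᴴ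

/-! ### The two representations of the kernel of the whole plane. -/

theorem besselInt_neg (ν r : ℝ) : besselInt (-ν) r = besselInt ν r := by
  rw [besselInt, besselInt, ← integral_neg_eq_self]
  congr 1
  funext s
  rw [Real.cosh_neg, neg_mul_neg]

theorem euclNorm_flip (y : ℝ × ℝ) : euclNorm (flip y) = euclNorm y := by
  simp [euclNorm, flip]

theorem exp_arg_mul_I {y : ℝ × ℝ} (hy : 0 < y.2) :
    Complex.exp ((y.2 + y.1 * Complex.I : ℂ).arg * Complex.I) =
      (y.2 + y.1 * Complex.I) / euclNorm y := by
  have hr : 0 < euclNorm y := euclNorm_pos fun h => by rw [h] at hy; exact lt_irrefl _ hy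
  rw [eq_div_iff (Complex.ofReal_ne_zero.2 hr.ne'), euclNorm_eq_norm, mul_comm]
  exact Complex.norm_mul_exp_arg_mul_I _

theorem exp_neg_arg_mul_I {y : ℝ × ℝ} (hy : 0 < y.2) :
    Complex.exp (-((y.2 + y.1 * Complex.I : ℂ).arg * Complex.I)) =
      (y.2 - y.1 * Complex.I) / euclNorm y := by
  have hr : 0 < euclNorm y := euclNorm_pos fun h => by rw [h] at hy; exact lt_irrefl _ hy
  have hr' : (euclNorm y : ℂ) ≠ 0 := Complex.ofReal_ne_zero.2 hr.ne'
  have h1 : (y.2 + y.1 * Complex.I : ℂ) * (y.2 - y.1 * Complex.I) = (euclNorm y : ℂ) ^ 2 := by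
    have : euclNorm y ^ 2 = y.1 ^ 2 + y.2 ^ 2 := Real.sq_sqrt (by positivity)
    rw [← Complex.ofReal_pow, this]
    push_cast
    linear_combination (-(y.1 : ℂ) ^ 2) * Complex.I_sq
  rw [Complex.exp_neg, exp_arg_mul_I hy]
  refine inv_eq_of_mul_eq_one_right ?_
  rw [div_mul_div_comm, h1, sq, div_self (mul_ne_zero hr' hr')]

/-- For ν = 0, 1, -1 the factor e^{iνθ} is 1 and (y₂ ± i y₁)/r. The strip integrals are suited to
the equation but only live off the line y₂ = 0; the Bessel form extends continuously across that
line away from the origin. -/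
theorem planeKernel_of_pos {y : ℝ × ℝ} (hy : 0 < y.2) :
    planeKernel y = !![Complex.I * stripKernel (symb 1 0) y, stripKernel (symb 1 1) y;
      -stripKernel (symb 1 (-1)) y, Complex.I * stripKernel (symb 1 0) y] := by
  rw [stripKernel_symb_one (by simp) hy, stripKernel_symb_one (by simp) hy,
    stripKernel_symb_one (by simp) hy, besselInt_neg]
  push_cast
  rw [zero_mul, Complex.exp_zero, one_mul, one_mul, neg_mul, one_mul, exp_arg_mul_I hy,
    exp_neg_arg_mul_I hy, planeKernel]
  ext j k
  fin_cases j <;> fin_cases k <;> simp <;> ring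

theorem planeKernel_of_neg {y : ℝ × ℝ} (hy : y.2 < 0) :
    planeKernel y = !![Complex.I * stripKernel (symb 1 0) (flip y),
        -stripKernel (symb 1 (-1)) (flip y);
      stripKernel (symb 1 1) (flip y), Complex.I * stripKernel (symb 1 0) (flip y)] := by
  have hy' : 0 < (flip y).2 := neg_pos.2 hy
  rw [stripKernel_symb_one (by simp) hy', stripKernel_symb_one (by simp) hy',
    stripKernel_symb_one (by simp) hy', besselInt_neg]
  push_cast
  rw [zero_mul, Complex.exp_zero, one_mul, one_mul, neg_mul, one_mul, exp_arg_mul_I hy',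
    exp_neg_arg_mul_I hy', planeKernel, euclNorm_flip]
  ext j k
  fin_cases j <;> fin_cases k <;> simp [flip] <;> ring

/-! ### Classical solutions for test functions at `λ = 1` -/

/-- A rapidly decaying classical solution of `(𝒟₀ - iλ) u = f`. -/
structure ClassicalSol (γ lam : ℝ) (f₁ f₂ u₁ u₂ : ℝ × ℝ → ℂ) : Prop where
  nice₁ : Nice u₁
  nice₂ : Nice u₂
  eq₁ : ∀ x ∈ halfPlane, -Complex.I * fderiv ℝ u₂ x (1, 0) - fderiv ℝ u₂ x (0, 1) -
    Complex.I * lam * u₁ x = f₁ x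
  eq₂ : ∀ x ∈ halfPlane, -Complex.I * fderiv ℝ u₁ x (1, 0) + fderiv ℝ u₁ x (0, 1) -
    Complex.I * lam * u₂ x = f₂ x
  boundary : ∀ s : ℝ, u₂ (s, 0) = γ * u₁ (s, 0)

/-- The pair `u` is given by integration of `f` against the kernel `K`. -/
def IsKernelIntegral (K : ℝ × ℝ → ℝ × ℝ → Matrix (Fin 2) (Fin 2) ℂ)
    (f₁ f₂ u₁ u₂ : ℝ × ℝ → ℂ) : Prop :=
  ∀ x ∈ halfPlane,
    u₁ x = ∫ x' in halfPlane, (K x x' 0 0 * f₁ x' + K x x' 0 1 * f₂ x') ∧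
    u₂ x = ∫ x' in halfPlane, (K x x' 1 0 * f₁ x' + K x x' 1 1 * f₂ x')

/-- The upper component of the solution with datum `f`. -/
def solFst (γ : ℝ) (f₁ f₂ : ℝ × ℝ → ℂ) (x : ℝ × ℝ) : ℂ :=
  Complex.I * stripConv (symb 1 0) f₁ x +
    Complex.I * stripConv (symb 1 0) (fun x => f₁ (flip x)) (flip x) +
    stripConv (symb 1 1) f₂ x +
    (-1) * stripConv (symb 1 (-1)) (fun x => f₂ (flip x)) (flip x) +
    stripConv (symb γ 1) (fun x => f₁ (flip x)) x +
    Complex.I * stripConv (symb γ 0) (fun x => f₂ (flip x)) x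

/-- The lower component of the solution with datum `f`. -/
def solSnd (γ : ℝ) (f₁ f₂ : ℝ × ℝ → ℂ) (x : ℝ × ℝ) : ℂ :=
  (-1) * stripConv (symb 1 (-1)) f₁ x +
    stripConv (symb 1 1) (fun x => f₁ (flip x)) (flip x) +
    Complex.I * stripConv (symb 1 0) f₂ x +
    Complex.I * stripConv (symb 1 0) (fun x => f₂ (flip x)) (flip x) +
    Complex.I * stripConv (symb γ 0) (fun x => f₁ (flip x)) x +
    (-1) * stripConv (symb γ (-1)) (fun x => f₂ (flip x)) x

theorem abs_neg_one_le_one : |(-1 : ℝ)| ≤ 1 := by simp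
theorem abs_zero_le_one : |(0 : ℝ)| ≤ 1 := by simp
theorem abs_one_le_one : |(1 : ℝ)| ≤ 1 := by simp

theorem jumpTerm_comp_flip (b : ℝ → ℂ) (φ : ℝ × ℝ → ℂ) (x : ℝ × ℝ) :
    jumpTerm b (fun x => φ (flip x)) (flip x) = jumpTerm b φ x := by
  simp [jumpTerm, slab, flip]

/-- The reflected source lies below the boundary, so the mirror terms create no source in the
half-plane. -/
theorem jumpTerm_comp_flip_eq_zero (b : ℝ → ℂ) {φ : ℝ × ℝ → ℂ} (hs : ∀ x : ℝ × ℝ, x.2 ≤ 0 → φ x = 0)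
    {x : ℝ × ℝ} (hx : 0 ≤ x.2) : jumpTerm b (fun x => φ (flip x)) x = 0 := by
  have : ∀ r : ℝ, φ (flip (x.1 - r, x.2 - 0)) = 0 := fun r =>
    hs _ (by simpa [flip] using hx)
  simp only [jumpTerm, slab, this]
  simp

theorem nice_solFst {γ : ℝ} (hγ : 0 < γ) {f₁ f₂ : ℝ × ℝ → ℂ} (h₁ : IsTest f₁) (h₂ : IsTest f₂) :
    Nice (solFst γ f₁ f₂) := by
  have g : ∀ {γ ν : ℝ}, 0 < γ → |ν| ≤ 1 → ∀ {φ}, IsTest φ → Nice (stripConv (symb γ ν) φ) :=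
    fun hγ hν _ hφ => (goodSymbol_symb hγ hν).nice_stripConv hφ
  exact ((((((g one_pos abs_zero_le_one h₁).const_mul _).add
    ((g one_pos abs_zero_le_one h₁.comp_flip).comp_flip.const_mul _)).add
    (g one_pos abs_one_le_one h₂)).add
    ((g one_pos abs_neg_one_le_one h₂.comp_flip).comp_flip.const_mul _)).add
    (g hγ abs_one_le_one h₁.comp_flip)).add ((g hγ abs_zero_le_one h₂.comp_flip).const_mul _)

theorem nice_solSnd {γ : ℝ} (hγ : 0 < γ) {f₁ f₂ : ℝ × ℝ → ℂ} (h₁ : IsTest f₁) (h₂ : IsTest f₂) :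
    Nice (solSnd γ f₁ f₂) := by
  have g : ∀ {γ ν : ℝ}, 0 < γ → |ν| ≤ 1 → ∀ {φ}, IsTest φ → Nice (stripConv (symb γ ν) φ) :=
    fun hγ hν _ hφ => (goodSymbol_symb hγ hν).nice_stripConv hφ
  exact ((((((g one_pos abs_neg_one_le_one h₁).const_mul _).add
    (g one_pos abs_one_le_one h₁.comp_flip).comp_flip).add
    ((g one_pos abs_zero_le_one h₂).const_mul _)).add
    ((g one_pos abs_zero_le_one h₂.comp_flip).comp_flip.const_mul _)).add
    ((g hγ abs_zero_le_one h₁.comp_flip).const_mul _)).add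
    ((g hγ abs_neg_one_le_one h₂.comp_flip).const_mul _)

/-- The two first order operators `-i∂₁ ∓ ∂₂` as one directional derivative. -/
def dirac (ε : ℂ) (u : ℝ × ℝ → ℂ) (x : ℝ × ℝ) : ℂ :=
  -Complex.I * fderiv ℝ u x (1, 0) + ε * fderiv ℝ u x (0, 1)

theorem dirac_add (ε : ℂ) {u w : ℝ × ℝ → ℂ} (hu : Nice u) (hw : Nice w) (x : ℝ × ℝ) :
    dirac ε (fun x => u x + w x) x = dirac ε u x + dirac ε w x := by
  simp only [dirac, fderiv_fun_add hu.differentiable.differentiableAt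
    hw.differentiable.differentiableAt, add_apply]
  ring

theorem dirac_const_mul (ε k : ℂ) {u : ℝ × ℝ → ℂ} (hu : Nice u) (x : ℝ × ℝ) :
    dirac ε (fun x => k * u x) x = k * dirac ε u x := by
  simp only [dirac, fderiv_const_mul hu.differentiable.differentiableAt,
    smul_apply, smul_eq_mul]
  ring

theorem dirac_comp_flip (ε : ℂ) {u : ℝ × ℝ → ℂ} (hu : Nice u) (x : ℝ × ℝ) :
    dirac ε (fun x => u (flip x)) x = dirac (-ε) u (flip x) := by
  have e1 : flip (1, 0) = (1, 0) := by simp [flip]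
  have e2 : flip (0, 1) = -(0, 1) := by simp [flip]
  simp only [dirac, fderiv_comp_flip hu.differentiable, e1, e2, map_neg]
  ring

theorem dirac_neg_stripConv {γ ν : ℝ} (hγ : 0 < γ) (hν : |ν| ≤ 1) (hν' : |ν + 1| ≤ 1)
    {φ : ℝ × ℝ → ℂ} (hφ : IsTest φ) (x : ℝ × ℝ) :
    dirac (-1) (stripConv (symb γ ν) φ) x =
      stripConv (symb γ (ν + 1)) φ x - jumpTerm (symb γ ν) φ x := by
  rw [← (goodSymbol_symb hγ hν).fderiv_fst_add_fderiv_snd_stripConv (goodSymbol_symb hγ hν')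
    (fun s => ?_) hφ x, dirac]
  · ring
  · rw [symb, symb, mul_left_comm, ← Complex.exp_add]
    congr 2
    push_cast
    ring

theorem dirac_pos_stripConv {γ ν : ℝ} (hγ : 0 < γ) (hν : |ν| ≤ 1) (hν' : |ν - 1| ≤ 1)
    {φ : ℝ × ℝ → ℂ} (hφ : IsTest φ) (x : ℝ × ℝ) :
    dirac 1 (stripConv (symb γ ν) φ) x =
      -stripConv (symb γ (ν - 1)) φ x + jumpTerm (symb γ ν) φ x := by
  rw [← (goodSymbol_symb hγ hν).fderiv_fst_sub_fderiv_snd_stripConv (goodSymbol_symb hγ hν')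
    (fun s => ?_) hφ x, dirac]
  · ring
  · rw [symb, symb, mul_left_comm, ← Complex.exp_add]
    congr 2
    push_cast
    ring

/-- Since e^s + e^{-s} = 2 cosh s, this is Fourier inversion; it is the delta function of the
fundamental solution. -/
theorem jumpTerm_symb_one_add {φ : ℝ × ℝ → ℂ} (hφ : IsTest φ) (x : ℝ × ℝ) :
    jumpTerm (symb 1 1) φ x + jumpTerm (symb 1 (-1)) φ x = φ x := by
  rw [← hφ.jumpTerm_two_mul_cosh x, jumpTerm, jumpTerm, jumpTerm, ← mul_add, ← integral_add
    ((isSymbol_symb one_pos abs_one_le_one).integrable_mul_slab hφ x)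
    ((isSymbol_symb one_pos abs_neg_one_le_one).integrable_mul_slab hφ x)]
  congr 2
  funext s
  rw [symb_one, symb_one, ← add_mul, Complex.ofReal_cosh, Complex.cosh]
  push_cast
  rw [one_mul, neg_mul, one_mul]
  ring

/-- Term by term the operator turns the six summands of `solSnd` into i times those of `solFst`.
Among the jumps, those of `f₁` with ν = ±1 add up to `f₁`, those of `f₂` with ν = 0 cancel between
the direct and the reflected term, and those of the mirror terms vanish. -/
theorem dirac_solSnd {γ : ℝ} (hγ : 0 < γ) {f₁ f₂ : ℝ × ℝ → ℂ} (h₁ : IsTest f₁) (h₂ : IsTest f₂)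
    (s₁ : ∀ x : ℝ × ℝ, x.2 ≤ 0 → f₁ x = 0) (s₂ : ∀ x : ℝ × ℝ, x.2 ≤ 0 → f₂ x = 0) {x : ℝ × ℝ} (hx : 0 ≤ x.2) :
    dirac (-1) (solSnd γ f₁ f₂) x = Complex.I * solFst γ f₁ f₂ x + f₁ x := by
  have g : ∀ {γ ν : ℝ}, 0 < γ → |ν| ≤ 1 → ∀ {φ}, IsTest φ → Nice (stripConv (symb γ ν) φ) :=
    fun hγ hν _ hφ => (goodSymbol_symb hγ hν).nice_stripConv hφ
  have n1 := (g one_pos abs_neg_one_le_one h₁).const_mul (-1)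
  have n2 := (g one_pos abs_one_le_one h₁.comp_flip).comp_flip
  have n3 := (g one_pos abs_zero_le_one h₂).const_mul Complex.I
  have n4 := (g one_pos abs_zero_le_one h₂.comp_flip).comp_flip.const_mul Complex.I
  have n5 := (g hγ abs_zero_le_one h₁.comp_flip).const_mul Complex.I
  have n6 := (g hγ abs_neg_one_le_one h₂.comp_flip).const_mul (-1)
  have e : dirac (-1) (solSnd γ f₁ f₂) x = _ :=
    ((dirac_add _ ((((n1.add n2).add n3).add n4).add n5) n6 x).trans
      (congrArg (· + _) ((dirac_add _ (((n1.add n2).add n3).add n4) n5 x).trans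
        (congrArg (· + _) ((dirac_add _ ((n1.add n2).add n3) n4 x).trans
          (congrArg (· + _) ((dirac_add _ (n1.add n2) n3 x).trans
            (congrArg (· + _) (dirac_add _ n1 n2 x)))))))))
  have a1 := dirac_neg_stripConv (γ := 1) (ν := -1) one_pos (by simp) (by simp) h₁ x
  have a2 := dirac_pos_stripConv (γ := 1) (ν := 1) one_pos (by simp) (by simp) h₁.comp_flip (flip x)
  have a3 := dirac_neg_stripConv (γ := 1) (ν := 0) one_pos (by simp) (by simp) h₂ x
  have a4 := dirac_pos_stripConv (γ := 1) (ν := 0) one_pos (by simp) (by simp) h₂.comp_flip (flip x)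
  have a5 := dirac_neg_stripConv (ν := 0) hγ (by simp) (by simp) h₁.comp_flip x
  have a6 := dirac_neg_stripConv (ν := -1) hγ (by simp) (by simp) h₂.comp_flip x
  rw [neg_add_cancel] at a1 a6
  rw [sub_self, jumpTerm_comp_flip] at a2
  rw [zero_add] at a3 a5
  rw [zero_sub, jumpTerm_comp_flip] at a4
  rw [jumpTerm_comp_flip_eq_zero _ s₁ hx] at a5
  rw [jumpTerm_comp_flip_eq_zero _ s₂ hx] at a6
  rw [e, dirac_const_mul _ _ (g one_pos abs_neg_one_le_one h₁),
    dirac_comp_flip _ (g one_pos abs_one_le_one h₁.comp_flip),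
    dirac_const_mul _ _ (g one_pos abs_zero_le_one h₂),
    dirac_const_mul _ _ (g one_pos abs_zero_le_one h₂.comp_flip).comp_flip,
    dirac_comp_flip _ (g one_pos abs_zero_le_one h₂.comp_flip),
    dirac_const_mul _ _ (g hγ abs_zero_le_one h₁.comp_flip),
    dirac_const_mul _ _ (g hγ abs_neg_one_le_one h₂.comp_flip), neg_neg, a1, a2, a3, a4, a5, a6,
    solFst]
  linear_combination jumpTerm_symb_one_add h₁ x -
    (stripConv (symb 1 0) f₁ x + stripConv (symb 1 0) (fun x => f₁ (flip x)) (flip x) +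
      stripConv (symb γ 0) (fun x => f₂ (flip x)) x) * Complex.I_sq

theorem dirac_solFst {γ : ℝ} (hγ : 0 < γ) {f₁ f₂ : ℝ × ℝ → ℂ} (h₁ : IsTest f₁) (h₂ : IsTest f₂)
    (s₁ : ∀ x : ℝ × ℝ, x.2 ≤ 0 → f₁ x = 0) (s₂ : ∀ x : ℝ × ℝ, x.2 ≤ 0 → f₂ x = 0) {x : ℝ × ℝ} (hx : 0 ≤ x.2) :
    dirac 1 (solFst γ f₁ f₂) x = Complex.I * solSnd γ f₁ f₂ x + f₂ x := by
  have g : ∀ {γ ν : ℝ}, 0 < γ → |ν| ≤ 1 → ∀ {φ}, IsTest φ → Nice (stripConv (symb γ ν) φ) :=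
    fun hγ hν _ hφ => (goodSymbol_symb hγ hν).nice_stripConv hφ
  have n1 := (g one_pos abs_zero_le_one h₁).const_mul Complex.I
  have n2 := (g one_pos abs_zero_le_one h₁.comp_flip).comp_flip.const_mul Complex.I
  have n3 := g one_pos abs_one_le_one h₂
  have n4 := (g one_pos abs_neg_one_le_one h₂.comp_flip).comp_flip.const_mul (-1)
  have n5 := g hγ abs_one_le_one h₁.comp_flip
  have n6 := (g hγ abs_zero_le_one h₂.comp_flip).const_mul Complex.I
  have e : dirac 1 (solFst γ f₁ f₂) x = _ :=
    ((dirac_add _ ((((n1.add n2).add n3).add n4).add n5) n6 x).trans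
      (congrArg (· + _) ((dirac_add _ (((n1.add n2).add n3).add n4) n5 x).trans
        (congrArg (· + _) ((dirac_add _ ((n1.add n2).add n3) n4 x).trans
          (congrArg (· + _) ((dirac_add _ (n1.add n2) n3 x).trans
            (congrArg (· + _) (dirac_add _ n1 n2 x)))))))))
  have a1 := dirac_pos_stripConv (γ := 1) (ν := 0) one_pos (by simp) (by simp) h₁ x
  have a2 := dirac_neg_stripConv (γ := 1) (ν := 0) one_pos (by simp) (by simp) h₁.comp_flip (flip x)
  have a3 := dirac_pos_stripConv (γ := 1) (ν := 1) one_pos (by simp) (by simp) h₂ x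
  have a4 := dirac_neg_stripConv (γ := 1) (ν := -1) one_pos (by simp) (by simp) h₂.comp_flip
    (flip x)
  have a5 := dirac_pos_stripConv (ν := 1) hγ (by simp) (by simp) h₁.comp_flip x
  have a6 := dirac_pos_stripConv (ν := 0) hγ (by simp) (by simp) h₂.comp_flip x
  rw [neg_add_cancel, jumpTerm_comp_flip] at a4
  rw [zero_add, jumpTerm_comp_flip] at a2
  rw [sub_self] at a3 a5
  rw [zero_sub] at a1 a6
  rw [jumpTerm_comp_flip_eq_zero _ s₁ hx] at a5
  rw [jumpTerm_comp_flip_eq_zero _ s₂ hx] at a6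
  rw [e, dirac_const_mul _ _ (g one_pos abs_zero_le_one h₁),
    dirac_const_mul _ _ (g one_pos abs_zero_le_one h₁.comp_flip).comp_flip,
    dirac_comp_flip _ (g one_pos abs_zero_le_one h₁.comp_flip),
    dirac_const_mul _ _ (g one_pos abs_neg_one_le_one h₂.comp_flip).comp_flip,
    dirac_comp_flip _ (g one_pos abs_neg_one_le_one h₂.comp_flip),
    dirac_const_mul _ _ (g hγ abs_zero_le_one h₂.comp_flip), a1, a2, a3, a4, a5, a6, solSnd]
  linear_combination jumpTerm_symb_one_add h₂ x -
    (stripConv (symb 1 0) f₂ x + stripConv (symb 1 0) (fun x => f₂ (flip x)) (flip x) +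
      stripConv (symb γ 0) (fun x => f₁ (flip x)) x) * Complex.I_sq

/-! ### The boundary condition -/

theorem refl_mul (γ s : ℝ) :
    refl γ s * (1 + Complex.I * γ * Complex.exp s) = γ + Complex.I * Complex.exp s :=
  div_mul_cancel₀ _ (one_add_I_mul_exp_ne_zero (by simpa using Real.pi_pos))

/-- The defining relation α(1 + iγe^s) = γ + ie^s multiplied by i; multiplied by -e^{-s} it is
`symb_boundary_two`. The two identities encode the boundary condition for sources in the first and
in the second component. -/
theorem symb_boundary_one (γ s : ℝ) :
    symb 1 1 s + Complex.I * symb γ 0 s = γ * (Complex.I * symb 1 0 s + symb γ 1 s) := by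
  rw [symb_one, symb_one, symb, symb]
  push_cast
  rw [one_mul, zero_mul, Complex.exp_zero]
  have h := refl_mul γ s
  linear_combination Complex.I * h - (refl γ s * γ * Complex.exp s - Complex.exp s) * Complex.I_sq

theorem symb_boundary_two (γ s : ℝ) :
    Complex.I * symb 1 0 s + (-1) * symb γ (-1) s =
      γ * ((-1) * symb 1 (-1) s + Complex.I * symb γ 0 s) := by
  rw [symb_one, symb_one, symb, symb]
  push_cast
  simp only [neg_mul, one_mul, zero_mul, Complex.exp_zero]
  have h := refl_mul γ s
  have h2 : Complex.exp s * Complex.exp (-s) = 1 := by rw [← Complex.exp_add]; simp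
  linear_combination (-Complex.exp (-s)) * h +
    (refl γ s * Complex.I * γ - Complex.I) * h2

theorem stripConv_eq_zero (b : ℝ → ℂ) {φ : ℝ × ℝ → ℂ} (hs : ∀ x : ℝ × ℝ, x.2 ≤ 0 → φ x = 0) {x : ℝ × ℝ}
    (hx : x.2 ≤ 0) : stripConv b φ x = 0 := by
  rw [stripConv]
  refine setIntegral_eq_zero_of_forall_eq_zero fun y hy => ?_
  have hy : 0 < y.2 := hy
  rw [hs _ (by simpa using by linarith), mul_zero]

theorem stripConv_add_const_mul {b b' : ℝ → ℂ} (hb : GoodSymbol b) (hb' : GoodSymbol b') (k k' : ℂ)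
    {φ : ℝ × ℝ → ℂ} (hφ : IsTest φ) (x : ℝ × ℝ) :
    k * stripConv b φ x + k' * stripConv b' φ x =
      1 / (4 * Real.pi) * ∫ s, (k * b s + k' * b' s) * laplace φ x s := by
  rw [hb.stripConv_eq hφ, hb'.stripConv_eq hφ, mul_left_comm, mul_left_comm k', ← mul_add,
    ← integral_const_mul, ← integral_const_mul, ← integral_add
    ((hb.isSymbol.integrable_mul_laplace hφ x).const_mul k)
    ((hb'.isSymbol.integrable_mul_laplace hφ x).const_mul k')]
  congr 2
  funext s
  ring

/-- On the boundary the convolutions with the unreflected sources vanish, because those sources lie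
above and the kernels only see points below. The remaining terms are convolutions of the reflected
sources at the same point, so the condition can be checked on the symbols. -/
theorem solSnd_boundary {γ : ℝ} (hγ : 0 < γ) {f₁ f₂ : ℝ × ℝ → ℂ} (h₁ : IsTest f₁) (h₂ : IsTest f₂)
    (s₁ : ∀ x : ℝ × ℝ, x.2 ≤ 0 → f₁ x = 0) (s₂ : ∀ x : ℝ × ℝ, x.2 ≤ 0 → f₂ x = 0) (s : ℝ) :
    solSnd γ f₁ f₂ (s, 0) = γ * solFst γ f₁ f₂ (s, 0) := by
  have g : ∀ {γ ν : ℝ}, 0 < γ → |ν| ≤ 1 → GoodSymbol (symb γ ν) := fun hγ hν => goodSymbol_symb hγ hν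
  have e : flip (s, 0) = (s, 0) := by simp [flip]
  have a1 := stripConv_add_const_mul (g one_pos abs_one_le_one) (g hγ abs_zero_le_one) 1 Complex.I
    h₁.comp_flip (s, 0)
  have b1 := stripConv_add_const_mul (g one_pos abs_zero_le_one) (g hγ abs_one_le_one) Complex.I 1
    h₁.comp_flip (s, 0)
  have a2 := stripConv_add_const_mul (g one_pos abs_zero_le_one) (g hγ abs_neg_one_le_one)
    Complex.I (-1) h₂.comp_flip (s, 0)
  have b2 := stripConv_add_const_mul (g one_pos abs_neg_one_le_one) (g hγ abs_zero_le_one) (-1)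
    Complex.I h₂.comp_flip (s, 0)
  simp only [one_mul] at a1 b1
  simp only [symb_boundary_one, mul_assoc, integral_const_mul] at a1
  simp only [symb_boundary_two, mul_assoc, integral_const_mul] at a2
  rw [solFst, solSnd, e, stripConv_eq_zero _ s₁ le_rfl, stripConv_eq_zero _ s₂ le_rfl,
    stripConv_eq_zero _ s₁ le_rfl, stripConv_eq_zero _ s₂ le_rfl]
  linear_combination a1 + a2 - γ * b1 - γ * b2

theorem classicalSol_one {γ : ℝ} (hγ : 0 < γ) {f₁ f₂ : ℝ × ℝ → ℂ} (h₁ : IsTest f₁) (h₂ : IsTest f₂)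
    (s₁ : ∀ x : ℝ × ℝ, x.2 ≤ 0 → f₁ x = 0) (s₂ : ∀ x : ℝ × ℝ, x.2 ≤ 0 → f₂ x = 0) :
    ClassicalSol γ 1 f₁ f₂ (solFst γ f₁ f₂) (solSnd γ f₁ f₂) where
  nice₁ := nice_solFst hγ h₁ h₂
  nice₂ := nice_solSnd hγ h₁ h₂
  eq₁ x hx := by
    have := dirac_solSnd hγ h₁ h₂ s₁ s₂ (le_of_lt hx)
    rw [dirac] at this
    push_cast
    linear_combination this
  eq₂ x hx := by
    have := dirac_solFst hγ h₁ h₂ s₁ s₂ (le_of_lt hx)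
    rw [dirac] at this
    push_cast
    linear_combination this
  boundary := solSnd_boundary hγ h₁ h₂ s₁ s₂

/-! ### The kernel representation -/

/-- The half-plane kernel extended by zero. -/
def zeroExt (b : ℝ → ℂ) : ℝ × ℝ → ℂ := halfPlane.indicator (stripKernel b)

theorem stripConv_eq_integral (b : ℝ → ℂ) (φ : ℝ × ℝ → ℂ) (x : ℝ × ℝ) :
    stripConv b φ x = ∫ x', zeroExt b (x - x') * φ x' := by
  rw [stripConv, ← integral_indicator measurableSet_halfPlane,
    ← integral_sub_left_eq_self _ volume x]
  congr 1
  funext y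
  by_cases hy : x - y ∈ halfPlane <;> simp [hy, zeroExt]

theorem stripConv_comp_flip_eq_integral (b : ℝ → ℂ) (φ : ℝ × ℝ → ℂ) (x : ℝ × ℝ) :
    stripConv b (fun x => φ (flip x)) x = ∫ x', zeroExt b (x - flip x') * φ x' := by
  rw [stripConv_eq_integral, ← integral_comp_flip]
  simp [flip]

theorem GoodSymbol.integrable_zeroExt {b : ℝ → ℂ} (hb : GoodSymbol b) :
    Integrable (zeroExt b) := hb.integrableOn.integrable_indicator measurableSet_halfPlane

theorem GoodSymbol.integrable_zeroExt_mul {b : ℝ → ℂ} (hb : GoodSymbol b) {φ : ℝ × ℝ → ℂ}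
    (hφ : Nice φ) (x : ℝ × ℝ) : Integrable fun x' => zeroExt b (x - x') * φ x' := by
  obtain ⟨K, hK⟩ := hφ.expDecay.exists_norm_le
  have := hφ.continuous
  exact (hb.integrable_zeroExt.comp_sub_left x).mul_bdd (c := K) (by fun_prop)
    (Eventually.of_forall fun y => hK _)

theorem GoodSymbol.integrable_zeroExt_flip_mul {b : ℝ → ℂ} (hb : GoodSymbol b) {φ : ℝ × ℝ → ℂ}
    (hφ : Nice φ) (x : ℝ × ℝ) : Integrable fun x' => zeroExt b (x - flip x') * φ x' := by
  have h := (measurePreserving_flip.integrable_comp_emb flipHomeomorph.measurableEmbedding).2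
    (hb.integrable_zeroExt_mul hφ.comp_flip x)
  refine h.congr (Eventually.of_forall fun y => ?_)
  simp [flip]

theorem ae_snd_ne (t : ℝ) : ∀ᵐ x : ℝ × ℝ, x.2 ≠ t :=
  Measure.quasiMeasurePreserving_snd.ae (Measure.ae_ne volume t)

theorem zeroExt_of_pos (b : ℝ → ℂ) {y : ℝ × ℝ} (hy : 0 < y.2) : zeroExt b y = stripKernel b y :=
  indicator_of_mem (show y ∈ halfPlane from hy) _

theorem zeroExt_of_nonpos (b : ℝ → ℂ) {y : ℝ × ℝ} (hy : y.2 ≤ 0) : zeroExt b y = 0 :=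
  indicator_of_notMem (show y ∉ halfPlane from not_lt.2 hy) _

theorem flip_sub (x y : ℝ × ℝ) : flip x - flip y = flip (x - y) := by
  simp only [flip]
  ext <;> simp
  ring

/-- The kernel at `i` in terms of the half-plane kernels. -/
theorem unitKernel_eq {γ : ℝ} {x x' : ℝ × ℝ} (hx : x ∈ halfPlane) (hx' : x' ∈ halfPlane)
    (hne : x'.2 ≠ x.2) :
    unitKernel γ x x' =
      !![Complex.I * zeroExt (symb 1 0) (x - x') + Complex.I * zeroExt (symb 1 0) (flip x - flip x')
          + zeroExt (symb γ 1) (x - flip x'),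
        zeroExt (symb 1 1) (x - x') + (-1) * zeroExt (symb 1 (-1)) (flip x - flip x')
          + Complex.I * zeroExt (symb γ 0) (x - flip x');
        (-1) * zeroExt (symb 1 (-1)) (x - x') + zeroExt (symb 1 1) (flip x - flip x')
          + Complex.I * zeroExt (symb γ 0) (x - flip x'),
        Complex.I * zeroExt (symb 1 0) (x - x') + Complex.I * zeroExt (symb 1 0) (flip x - flip x')
          + (-1) * zeroExt (symb γ (-1)) (x - flip x')] := by
  have hx : 0 < x.2 := hx
  have hx' : 0 < x'.2 := hx'
  have hm : x - flip x' = (x.1 - x'.1, x.2 + x'.2) := by ext <;> simp [flip]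
  have hmp : 0 < (x.1 - x'.1, x.2 + x'.2).2 := add_pos hx hx'
  simp only [flip_sub, hm, zeroExt_of_pos _ hmp]
  -- Exactly one of x - x' and its reflection lies in the half-plane, so one of the two free terms
  -- is zero.
  rcases lt_or_gt_of_ne hne with h | h
  · have h1 : 0 < (x - x').2 := sub_pos.2 h
    have h2 : (flip (x - x')).2 ≤ 0 := by simp only [flip]; linarith
    rw [unitKernel, planeKernel_of_pos h1, mirrorKernel]
    simp only [zeroExt_of_pos _ h1, zeroExt_of_nonpos _ h2]
    ext j k
    fin_cases j <;> fin_cases k <;> simp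
  · have h1 : (x - x').2 < 0 := sub_neg.2 h
    have h2 : 0 < (flip (x - x')).2 := by simp only [flip]; linarith
    rw [unitKernel, planeKernel_of_neg h1, mirrorKernel]
    simp only [zeroExt_of_pos _ h2, zeroExt_of_nonpos _ h1.le]
    ext j k
    fin_cases j <;> fin_cases k <;> simp

theorem setIntegral_halfPlane_unitKernel {γ : ℝ} {f₁ f₂ : ℝ × ℝ → ℂ}
    (s₁ : ∀ x : ℝ × ℝ, x.2 ≤ 0 → f₁ x = 0) (s₂ : ∀ x : ℝ × ℝ, x.2 ≤ 0 → f₂ x = 0) {x : ℝ × ℝ}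
    (j : Fin 2) (P Q : ℝ × ℝ → ℂ)
    (h : ∀ x' ∈ halfPlane, x'.2 ≠ x.2 → unitKernel γ x x' j 0 = P x' ∧
      unitKernel γ x x' j 1 = Q x') :
    ∫ x' in halfPlane, (unitKernel γ x x' j 0 * f₁ x' + unitKernel γ x x' j 1 * f₂ x') =
      ∫ x', (P x' * f₁ x' + Q x' * f₂ x') := by
  rw [← integral_indicator measurableSet_halfPlane]
  refine integral_congr_ae ?_
  filter_upwards [ae_snd_ne x.2] with x' hne
  by_cases hx' : x' ∈ halfPlane
  · rw [indicator_of_mem hx', (h x' hx' hne).1, (h x' hx' hne).2]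
  · rw [indicator_of_notMem hx', s₁ _ (not_lt.1 hx'),
      s₂ _ (not_lt.1 hx')]
    simp

theorem integral_add_six {f₁ f₂ f₃ f₄ f₅ f₆ : ℝ × ℝ → ℂ} (h₁ : Integrable f₁)
    (h₂ : Integrable f₂) (h₃ : Integrable f₃) (h₄ : Integrable f₄) (h₅ : Integrable f₅)
    (h₆ : Integrable f₆) :
    ∫ x, f₁ x + f₂ x + f₃ x + f₄ x + f₅ x + f₆ x =
      (∫ x, f₁ x) + (∫ x, f₂ x) + (∫ x, f₃ x) + (∫ x, f₄ x) + (∫ x, f₅ x) + ∫ x, f₆ x := by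
  have h₁₂ : Integrable fun x => f₁ x + f₂ x := h₁.add h₂
  have h₁₃ : Integrable fun x => f₁ x + f₂ x + f₃ x := h₁₂.add h₃
  have h₁₄ : Integrable fun x => f₁ x + f₂ x + f₃ x + f₄ x := h₁₃.add h₄
  have h₁₅ : Integrable fun x => f₁ x + f₂ x + f₃ x + f₄ x + f₅ x := h₁₄.add h₅
  rw [integral_add h₁₅ h₆, integral_add h₁₄ h₅, integral_add h₁₃ h₄, integral_add h₁₂ h₃,
    integral_add h₁ h₂]

theorem isKernelIntegral_one {γ : ℝ} (hγ : 0 < γ) {f₁ f₂ : ℝ × ℝ → ℂ} (h₁ : IsTest f₁)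
    (h₂ : IsTest f₂) (s₁ : ∀ x : ℝ × ℝ, x.2 ≤ 0 → f₁ x = 0) (s₂ : ∀ x : ℝ × ℝ, x.2 ≤ 0 → f₂ x = 0) :
    IsKernelIntegral (unitKernel γ) f₁ f₂ (solFst γ f₁ f₂) (solSnd γ f₁ f₂) := by
  have g : ∀ {γ ν : ℝ}, 0 < γ → |ν| ≤ 1 → GoodSymbol (symb γ ν) := fun hγ hν => goodSymbol_symb hγ hν
  intro x hx
  have i : ∀ {γ ν : ℝ}, 0 < γ → |ν| ≤ 1 → ∀ {φ}, IsTest φ →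
      Integrable fun x' => zeroExt (symb γ ν) (x - x') * φ x' :=
    fun hγ hν _ hφ => (g hγ hν).integrable_zeroExt_mul hφ.nice x
  have i' : ∀ {γ ν : ℝ}, 0 < γ → |ν| ≤ 1 → ∀ {φ}, IsTest φ → ∀ z,
      Integrable fun x' => zeroExt (symb γ ν) (z - flip x') * φ x' :=
    fun hγ hν _ hφ z => (g hγ hν).integrable_zeroExt_flip_mul hφ.nice z
  constructor
  · rw [setIntegral_halfPlane_unitKernel s₁ s₂ 0
      (fun x' => Complex.I * zeroExt (symb 1 0) (x - x') +
        Complex.I * zeroExt (symb 1 0) (flip x - flip x') + zeroExt (symb γ 1) (x - flip x'))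
      (fun x' => zeroExt (symb 1 1) (x - x') + (-1) * zeroExt (symb 1 (-1)) (flip x - flip x')
          + Complex.I * zeroExt (symb γ 0) (x - flip x'))
      fun x' hx' hne => by rw [unitKernel_eq hx hx' hne]; exact ⟨rfl, rfl⟩]
    have j1 := (i one_pos abs_zero_le_one h₁).const_mul Complex.I
    have j2 := (i' one_pos abs_zero_le_one h₁ (flip x)).const_mul Complex.I
    have j3 := i one_pos abs_one_le_one h₂
    have j4 := (i' one_pos abs_neg_one_le_one h₂ (flip x)).const_mul (-1)
    have j5 := i' hγ abs_one_le_one h₁ x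
    have j6 := (i' hγ abs_zero_le_one h₂ x).const_mul Complex.I
    simp only [solFst, stripConv_comp_flip_eq_integral, stripConv_eq_integral _ f₁,
      stripConv_eq_integral _ f₂]
    rw [← integral_const_mul, ← integral_const_mul, ← integral_const_mul, ← integral_const_mul,
      ← integral_add_six j1 j2 j3 j4 j5 j6]
    congr 1
    funext x'
    ring
  · rw [setIntegral_halfPlane_unitKernel s₁ s₂ 1
      (fun x' => (-1) * zeroExt (symb 1 (-1)) (x - x') + zeroExt (symb 1 1) (flip x - flip x')
          + Complex.I * zeroExt (symb γ 0) (x - flip x'))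
      (fun x' => Complex.I * zeroExt (symb 1 0) (x - x') +
        Complex.I * zeroExt (symb 1 0) (flip x - flip x') +
          (-1) * zeroExt (symb γ (-1)) (x - flip x'))
      fun x' hx' hne => by rw [unitKernel_eq hx hx' hne]; exact ⟨rfl, rfl⟩]
    have j1 := (i one_pos abs_neg_one_le_one h₁).const_mul (-1)
    have j2 := i' one_pos abs_one_le_one h₁ (flip x)
    have j3 := (i one_pos abs_zero_le_one h₂).const_mul Complex.I
    have j4 := (i' one_pos abs_zero_le_one h₂ (flip x)).const_mul Complex.I
    have j5 := (i' hγ abs_zero_le_one h₁ x).const_mul Complex.I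
    have j6 := (i' hγ abs_neg_one_le_one h₂ x).const_mul (-1)
    simp only [solSnd, stripConv_comp_flip_eq_integral, stripConv_eq_integral _ f₁,
      stripConv_eq_integral _ f₂]
    rw [← integral_const_mul, ← integral_const_mul, ← integral_const_mul, ← integral_const_mul,
      ← integral_const_mul, ← integral_add_six j1 j2 j3 j4 j5 j6]
    congr 1
    funext x'
    ring

/-! ### Classical solutions at `iλ` -/

theorem smul_mem_halfPlane {a : ℝ} (ha : 0 < a) {x : ℝ × ℝ} (hx : x ∈ halfPlane) :
    a • x ∈ halfPlane := mul_pos ha hx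

open scoped Pointwise in
theorem setIntegral_halfPlane_comp_smul {a : ℝ} (ha : 0 < a) (g : ℝ × ℝ → ℂ) :
    ∫ x in halfPlane, g (a • x) = ((a : ℂ) ^ 2)⁻¹ * ∫ x in halfPlane, g x := by
  have hset : a • halfPlane = halfPlane := by
    ext x
    rw [Set.mem_smul_set_iff_inv_smul_mem₀ ha.ne']
    refine ⟨fun h => ?_, fun h => smul_mem_halfPlane (inv_pos.2 ha) h⟩
    have := smul_mem_halfPlane ha h
    rwa [smul_inv_smul₀ ha.ne'] at this
  rw [Measure.setIntegral_comp_smul_of_pos volume g halfPlane ha, hset, Complex.real_smul]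
  simp

theorem fderiv_inv_mul_comp_smul {u : ℝ × ℝ → ℂ} (hu : Differentiable ℝ u) {a : ℝ} (ha : a ≠ 0)
    (x v : ℝ × ℝ) :
    fderiv ℝ (fun x => ((a⁻¹ : ℝ) : ℂ) * u (a • x)) x v = fderiv ℝ u (a • x) v := by
  have h1 : HasFDerivAt (fun x : ℝ × ℝ => a • x) (a • ContinuousLinearMap.id ℝ (ℝ × ℝ)) x :=
    (hasFDerivAt_id x).const_smul a
  have h2 := ((hu (a • x)).hasFDerivAt.comp x h1).const_mul ((a⁻¹ : ℝ) : ℂ)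
  rw [Function.comp_def] at h2
  rw [h2.fderiv]
  have ha' : (a : ℂ) ≠ 0 := Complex.ofReal_ne_zero.2 ha
  simp [ha']

theorem IsTest.comp_smul {φ : ℝ × ℝ → ℂ} (hφ : IsTest φ) {a : ℝ} (ha : a ≠ 0) :
    IsTest fun x => φ (a • x) :=
  ⟨hφ.1.comp (contDiff_const_smul a), hφ.2.comp_homeomorph (Homeomorph.smulOfNeZero a ha)⟩

theorem Nice.comp_smul {u : ℝ × ℝ → ℂ} (hu : Nice u) {a : ℝ} (ha : 0 < a) :
    Nice fun x => u (a • x) :=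
  hu.comp_linear (a • ContinuousLinearMap.id ℝ (ℝ × ℝ)) ha fun x => by
    simp [abs_mul, abs_of_pos ha, mul_add]

/-- The operator is homogeneous of degree one and the boundary condition is scale invariant. In the
kernel representation below, the factor a⁻¹ of the solution and the Jacobian a² combine to the
factor a. -/
theorem ClassicalSol.scale {γ a : ℝ} (ha : 0 < a) {f₁ f₂ u₁ u₂ : ℝ × ℝ → ℂ}
    (h : ClassicalSol γ 1 (fun x => f₁ (a⁻¹ • x)) (fun x => f₂ (a⁻¹ • x)) u₁ u₂) :
    ClassicalSol γ a f₁ f₂ (fun x => ((a⁻¹ : ℝ) : ℂ) * u₁ (a • x))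
      (fun x => ((a⁻¹ : ℝ) : ℂ) * u₂ (a • x)) where
  nice₁ := (h.nice₁.comp_smul ha).const_mul _
  nice₂ := (h.nice₂.comp_smul ha).const_mul _
  eq₁ x hx := by
    have := h.eq₁ (a • x) (smul_mem_halfPlane ha hx)
    rw [inv_smul_smul₀ ha.ne'] at this
    rw [fderiv_inv_mul_comp_smul h.nice₂.differentiable ha.ne',
      fderiv_inv_mul_comp_smul h.nice₂.differentiable ha.ne', ← this]
    have ha' : (a : ℂ) ≠ 0 := Complex.ofReal_ne_zero.2 ha.ne'
    push_cast
    field_simp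
  eq₂ x hx := by
    have := h.eq₂ (a • x) (smul_mem_halfPlane ha hx)
    rw [inv_smul_smul₀ ha.ne'] at this
    rw [fderiv_inv_mul_comp_smul h.nice₁.differentiable ha.ne',
      fderiv_inv_mul_comp_smul h.nice₁.differentiable ha.ne', ← this]
    have ha' : (a : ℂ) ≠ 0 := Complex.ofReal_ne_zero.2 ha.ne'
    push_cast
    field_simp
  boundary s := by
    have e : a • (s, (0 : ℝ)) = (a * s, 0) := by simp
    rw [e, h.boundary]
    ring

theorem IsKernelIntegral.scale {a : ℝ} (ha : 0 < a)
    {K : ℝ × ℝ → ℝ × ℝ → Matrix (Fin 2) (Fin 2) ℂ} {f₁ f₂ u₁ u₂ : ℝ × ℝ → ℂ}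
    (h : IsKernelIntegral K (fun x => f₁ (a⁻¹ • x)) (fun x => f₂ (a⁻¹ • x)) u₁ u₂) :
    IsKernelIntegral (fun x x' => (a : ℂ) • K (a • x) (a • x')) f₁ f₂
      (fun x => ((a⁻¹ : ℝ) : ℂ) * u₁ (a • x)) (fun x => ((a⁻¹ : ℝ) : ℂ) * u₂ (a • x)) := by
  have ha' : (a : ℂ) ≠ 0 := Complex.ofReal_ne_zero.2 ha.ne'
  have key : ∀ (x : ℝ × ℝ) (j : Fin 2),
      ((a⁻¹ : ℝ) : ℂ) * ∫ x' in halfPlane,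
        (K (a • x) x' j 0 * f₁ (a⁻¹ • x') + K (a • x) x' j 1 * f₂ (a⁻¹ • x')) =
      ∫ x' in halfPlane, (((a : ℂ) • K (a • x) (a • x')) j 0 * f₁ x' +
        ((a : ℂ) • K (a • x) (a • x')) j 1 * f₂ x') := fun x j => by
    have h1 := setIntegral_halfPlane_comp_smul ha fun x' =>
      K (a • x) x' j 0 * f₁ (a⁻¹ • x') + K (a • x) x' j 1 * f₂ (a⁻¹ • x')
    simp only [inv_smul_smul₀ ha.ne'] at h1
    have h2 : ∀ x', ((a : ℂ) • K (a • x) (a • x')) j 0 * f₁ x' +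
        ((a : ℂ) • K (a • x) (a • x')) j 1 * f₂ x' =
        (a : ℂ) * (K (a • x) (a • x') j 0 * f₁ x' + K (a • x) (a • x') j 1 * f₂ x') :=
      fun x' => by simp only [Matrix.smul_apply, smul_eq_mul]; ring
    simp only [h2]
    rw [integral_const_mul, h1]
    push_cast
    field_simp
  intro x hx
  obtain ⟨h1, h2⟩ := h (a • x) (smul_mem_halfPlane ha hx)
  exact ⟨(congrArg _ h1).trans (key x 0), (congrArg _ h2).trans (key x 1)⟩

/-- The reflection `x₁ ↦ -x₁`. -/
def mirror (x : ℝ × ℝ) : ℝ × ℝ := (-x.1, x.2)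

/-- The reflection `x₁ ↦ -x₁` as a continuous linear map. -/
def mirrorL : ℝ × ℝ →L[ℝ] ℝ × ℝ :=
  (-(ContinuousLinearMap.fst ℝ ℝ ℝ)).prod (ContinuousLinearMap.snd ℝ ℝ ℝ)

/-- The reflection `x₁ ↦ -x₁` as a homeomorphism. -/
def mirrorHomeomorph : ℝ × ℝ ≃ₜ ℝ × ℝ := (Homeomorph.neg ℝ).prodCongr (Homeomorph.refl ℝ)

theorem mirror_mirror (x : ℝ × ℝ) : mirror (mirror x) = x := by simp [mirror]

theorem setIntegral_halfPlane_comp_mirror (g : ℝ × ℝ → ℂ) :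
    ∫ x in halfPlane, g (mirror x) = ∫ x in halfPlane, g x := by
  have h : MeasurePreserving mirror :=
    (Measure.measurePreserving_neg volume).prod (MeasurePreserving.id volume)
  exact h.setIntegral_preimage_emb mirrorHomeomorph.measurableEmbedding g halfPlane

theorem Nice.comp_mirror {u : ℝ × ℝ → ℂ} (hu : Nice u) : Nice fun x => u (mirror x) :=
  hu.comp_linear mirrorL one_pos fun x => by simp [mirrorL]

theorem IsTest.conj_comp_mirror {φ : ℝ × ℝ → ℂ} (hφ : IsTest φ) :
    IsTest fun x => (starRingEnd ℂ) (φ (mirror x)) :=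
  ⟨Complex.conjCLE.contDiff.comp (hφ.1.comp mirrorL.contDiff),
    (hφ.2.comp_homeomorph mirrorHomeomorph).comp_left (g := starRingEnd ℂ) (map_zero _)⟩

theorem fderiv_conj_comp_mirror {u : ℝ × ℝ → ℂ} (hu : Differentiable ℝ u) (x v : ℝ × ℝ) :
    fderiv ℝ (fun x => (starRingEnd ℂ) (u (mirror x))) x v =
      (starRingEnd ℂ) (fderiv ℝ u (mirror x) (mirror v)) := by
  have := (Complex.conjCLE.toContinuousLinearMap.hasFDerivAt.comp x
    ((hu (mirror x)).hasFDerivAt.comp x mirrorL.hasFDerivAt)).fderiv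
  rw [Function.comp_def, Function.comp_def] at this
  exact congrArg (fun L : ℝ × ℝ →L[ℝ] ℂ => L v) this

/-- Conjugation changes the sign of -i∂₁ and the reflection of x₁ restores it; ∂₂ and the condition
with real γ are untouched. Only the spectral parameter is conjugated, from ia to -ia. -/
theorem ClassicalSol.conj_mirror {γ a : ℝ} {f₁ f₂ u₁ u₂ : ℝ × ℝ → ℂ}
    (h : ClassicalSol γ a (fun x => (starRingEnd ℂ) (f₁ (mirror x)))
      (fun x => (starRingEnd ℂ) (f₂ (mirror x))) u₁ u₂) :
    ClassicalSol γ (-a) f₁ f₂ (fun x => (starRingEnd ℂ) (u₁ (mirror x)))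
      (fun x => (starRingEnd ℂ) (u₂ (mirror x))) := by
  have e1 : mirror (1, 0) = -(1, 0) := by simp [mirror]
  have e2 : mirror (0, 1) = (0, 1) := by simp [mirror]
  refine ⟨h.nice₁.comp_mirror.conj, h.nice₂.comp_mirror.conj, fun x hx => ?_, fun x hx => ?_,
    fun s => ?_⟩
  · have := congrArg (starRingEnd ℂ) (h.eq₁ (mirror x) hx)
    rw [mirror_mirror, Complex.conj_conj] at this
    rw [fderiv_conj_comp_mirror h.nice₂.differentiable,
      fderiv_conj_comp_mirror h.nice₂.differentiable, e1, e2, ← this]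
    simp only [map_neg, map_sub, map_mul, Complex.conj_I, Complex.conj_ofReal,
      Complex.ofReal_neg]
    ring
  · have := congrArg (starRingEnd ℂ) (h.eq₂ (mirror x) hx)
    rw [mirror_mirror, Complex.conj_conj] at this
    rw [fderiv_conj_comp_mirror h.nice₁.differentiable,
      fderiv_conj_comp_mirror h.nice₁.differentiable, e1, e2, ← this]
    simp only [map_neg, map_sub, map_add, map_mul, Complex.conj_I,
      Complex.conj_ofReal, Complex.ofReal_neg]
    ring
  · have e : mirror (s, 0) = (-s, 0) := by simp [mirror]
    rw [e, h.boundary]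
    simp

theorem IsKernelIntegral.conj_mirror {K : ℝ × ℝ → ℝ × ℝ → Matrix (Fin 2) (Fin 2) ℂ}
    {f₁ f₂ u₁ u₂ : ℝ × ℝ → ℂ}
    (h : IsKernelIntegral K (fun x => (starRingEnd ℂ) (f₁ (mirror x)))
      (fun x => (starRingEnd ℂ) (f₂ (mirror x))) u₁ u₂) :
    IsKernelIntegral (fun x x' j k => (starRingEnd ℂ) (K (mirror x) (mirror x') j k)) f₁ f₂
      (fun x => (starRingEnd ℂ) (u₁ (mirror x))) (fun x => (starRingEnd ℂ) (u₂ (mirror x))) := by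
  have key : ∀ (x : ℝ × ℝ) (j : Fin 2), (starRingEnd ℂ) (∫ x' in halfPlane,
      (K (mirror x) x' j 0 * (starRingEnd ℂ) (f₁ (mirror x')) +
        K (mirror x) x' j 1 * (starRingEnd ℂ) (f₂ (mirror x')))) =
      ∫ x' in halfPlane, ((starRingEnd ℂ) (K (mirror x) (mirror x') j 0) * f₁ x' +
        (starRingEnd ℂ) (K (mirror x) (mirror x') j 1) * f₂ x') := fun x j => by
    rw [← setIntegral_halfPlane_comp_mirror, ← integral_conj]
    simp only [mirror_mirror, map_add, map_mul, Complex.conj_conj]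
  intro x hx
  obtain ⟨h1, h2⟩ := h (mirror x) hx
  exact ⟨(congrArg (starRingEnd ℂ) h1).trans (key x 0),
    (congrArg (starRingEnd ℂ) h2).trans (key x 1)⟩

/-! ### Symmetries of the kernel and the sign of λ. -/

theorem euclNorm_neg (y : ℝ × ℝ) : euclNorm (-y) = euclNorm y := by simp [euclNorm]

theorem euclNorm_mirror (y : ℝ × ℝ) : euclNorm (mirror y) = euclNorm y := by
  simp [euclNorm, mirror]

theorem planeKernel_mirror (y : ℝ × ℝ) (j k : Fin 2) :
    planeKernel (mirror y) j k = planeKernel (-y) k j := by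
  rw [planeKernel, planeKernel, euclNorm_mirror, euclNorm_neg]
  fin_cases j <;> fin_cases k <;> simp [mirror]

theorem mirrorKernel_symm (γ : ℝ) (y : ℝ × ℝ) (j k : Fin 2) :
    mirrorKernel γ y j k = mirrorKernel γ y k j := by
  rw [mirrorKernel]
  fin_cases j <;> fin_cases k <;> simp

/-- This reconciles the two descriptions of the kernel at negative λ: the conjugate of the mirrored
kernel, which solves the equation, is the adjoint kernel, which is the definition. -/
theorem unitKernel_mirror (γ : ℝ) (x x' : ℝ × ℝ) (j k : Fin 2) :
    unitKernel γ (mirror x) (mirror x') j k = unitKernel γ x' x k j := by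
  rw [unitKernel, unitKernel, Matrix.add_apply, Matrix.add_apply]
  have e : mirror x - mirror x' = mirror (x - x') := by
    simp only [mirror]; ext <;> simp; ring
  rw [e, planeKernel_mirror, neg_sub, mirrorKernel_symm]
  congr 2
  simp only [mirror]
  ext <;> simp <;> ring

theorem diracKernel_of_pos {γ lam : ℝ} (h : 0 < lam) (x x' : ℝ × ℝ) :
    diracKernel γ lam x x' = (lam : ℂ) • unitKernel γ (lam • x) (lam • x') := if_pos h

theorem diracKernel_of_neg {γ lam : ℝ} (h : lam < 0) (x x' : ℝ × ℝ) :
    diracKernel γ lam x x' = (diracKernel γ (-lam) x' x)ᴴ := by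
  rw [diracKernel, if_neg (not_lt.2 h.le), diracKernel_of_pos (neg_pos.2 h)]

theorem diracKernel_neg {γ lam : ℝ} (h : lam ≠ 0) (x x' : ℝ × ℝ) :
    diracKernel γ (-lam) x x' = (diracKernel γ lam x' x)ᴴ := by
  rcases lt_or_gt_of_ne h with h | h
  · rw [diracKernel_of_neg h, Matrix.conjTranspose_conjTranspose]
  · rw [diracKernel_of_neg (neg_neg_of_pos h), neg_neg]

theorem diracKernel_neg_eq_conj {γ a : ℝ} (h : 0 < a) (x x' : ℝ × ℝ) :
    diracKernel γ (-a) x x' =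
      fun j k => (starRingEnd ℂ) (diracKernel γ a (mirror x) (mirror x') j k) := by
  rw [diracKernel_neg h.ne', diracKernel_of_pos h, diracKernel_of_pos h]
  funext j k
  have e : ∀ x, a • mirror x = mirror (a • x) := fun x => by simp [mirror]
  rw [e, e, Matrix.conjTranspose_apply, Matrix.smul_apply, Matrix.smul_apply, unitKernel_mirror]
  rfl

theorem exists_classicalSol {γ lam : ℝ} (hγ : 0 < γ) (hlam : lam ≠ 0) {f₁ f₂ : ℝ × ℝ → ℂ}
    (h₁ : IsTest f₁) (h₂ : IsTest f₂) (s₁ : ∀ x : ℝ × ℝ, x.2 ≤ 0 → f₁ x = 0)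
    (s₂ : ∀ x : ℝ × ℝ, x.2 ≤ 0 → f₂ x = 0) :
    ∃ u₁ u₂, ClassicalSol γ lam f₁ f₂ u₁ u₂ ∧
      IsKernelIntegral (diracKernel γ lam) f₁ f₂ u₁ u₂ := by
  have pos : ∀ {a : ℝ}, 0 < a → ∀ {f₁ f₂ : ℝ × ℝ → ℂ}, IsTest f₁ → IsTest f₂ →
      (∀ x : ℝ × ℝ, x.2 ≤ 0 → f₁ x = 0) → (∀ x : ℝ × ℝ, x.2 ≤ 0 → f₂ x = 0) →
      ∃ u₁ u₂, ClassicalSol γ a f₁ f₂ u₁ u₂ ∧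
        IsKernelIntegral (diracKernel γ a) f₁ f₂ u₁ u₂ := by
    intro a ha f₁ f₂ h₁ h₂ s₁ s₂
    have hs : ∀ x : ℝ × ℝ, x.2 ≤ 0 → (a⁻¹ • x).2 ≤ 0 := fun x hx =>
      mul_nonpos_of_nonneg_of_nonpos (inv_pos.2 ha).le hx
    have h₁' := h₁.comp_smul (inv_ne_zero ha.ne')
    have h₂' := h₂.comp_smul (inv_ne_zero ha.ne')
    have hK : diracKernel γ a = fun x x' => (a : ℂ) • unitKernel γ (a • x) (a • x') := by
      funext x x'
      exact diracKernel_of_pos ha x x'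
    rw [hK]
    exact ⟨_, _, (classicalSol_one hγ h₁' h₂' (fun x hx => s₁ _ (hs x hx))
        (fun x hx => s₂ _ (hs x hx))).scale ha,
      (isKernelIntegral_one hγ h₁' h₂' (fun x hx => s₁ _ (hs x hx))
        (fun x hx => s₂ _ (hs x hx))).scale ha⟩
  rcases lt_or_gt_of_ne hlam with h | h
  · obtain ⟨u₁, u₂, hu, hk⟩ := pos (neg_pos.2 h) h₁.conj_comp_mirror h₂.conj_comp_mirror
      (fun x hx => by rw [s₁ _ (show (mirror x).2 ≤ 0 from hx), map_zero])
      (fun x hx => by rw [s₂ _ (show (mirror x).2 ≤ 0 from hx), map_zero])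
    have hK : diracKernel γ lam = fun x x' j k =>
        (starRingEnd ℂ) (diracKernel γ (-lam) (mirror x) (mirror x') j k) := by
      funext x x'
      rw [← diracKernel_neg_eq_conj (neg_pos.2 h), neg_neg]
    rw [hK]
    refine ⟨_, _, ?_, hk.conj_mirror⟩
    simpa using hu.conj_mirror
  · exact pos h h₁ h₂ s₁ s₂

/-! ### Size and continuity of the kernel -/

theorem norm_le_matSup (A : Matrix (Fin 2) (Fin 2) ℂ) (j k : Fin 2) : ‖A j k‖ ≤ matSup A :=
  le_ciSup (f := fun p : Fin 2 × Fin 2 => ‖A p.1 p.2‖) (Set.finite_range _).bddAbove (j, k)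

theorem matSup_le {A : Matrix (Fin 2) (Fin 2) ℂ} {B : ℝ} (h : ∀ j k, ‖A j k‖ ≤ B) : matSup A ≤ B :=
  ciSup_le fun p => h p.1 p.2

theorem besselInt_nonneg (ν r : ℝ) : 0 ≤ besselInt ν r :=
  integral_nonneg fun s => by positivity

theorem besselInt_integrand_le {ν r : ℝ} (hν : |ν| ≤ 1) {ρ : ℝ} (h : ρ ≤ r) (s : ℝ) :
    Real.exp (-(r * Real.cosh s)) * Real.exp (ν * s) ≤
      Real.exp |s| * Real.exp (-(ρ * Real.cosh s)) := by
  rw [mul_comm]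
  refine mul_le_mul (exp_mul_le_exp_abs hν s) (Real.exp_le_exp.2 (neg_le_neg ?_))
    (Real.exp_pos _).le (Real.exp_pos _).le
  exact mul_le_mul_of_nonneg_right h (Real.cosh_pos s).le

theorem integrable_besselInt {ν r : ℝ} (hν : |ν| ≤ 1) (hr : 0 < r) :
    Integrable fun s : ℝ => Real.exp (-(r * Real.cosh s)) * Real.exp (ν * s) := by
  refine (integrable_exp_abs_mul_exp_neg_cosh hr).mono' (by fun_prop)
    (Eventually.of_forall fun s => ?_)
  rw [Real.norm_of_nonneg (by positivity)]
  exact besselInt_integrand_le hν le_rfl s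

theorem besselInt_le {ν r c : ℝ} (hν : |ν| ≤ 1) (hr : 0 < r) (hc : 0 < c) (hc1 : c < 1) :
    besselInt ν r ≤ 4 / (1 - c) * (Real.exp (-(c * r)) / r) := by
  refine le_trans ?_ (integral_exp_abs_mul_exp_neg_cosh_le hr hc hc1)
  refine integral_mono (integrable_besselInt hν hr)
    (integrable_exp_abs_mul_exp_neg_cosh (by simpa using hr)) fun s => ?_
  exact besselInt_integrand_le hν (by simp) s

theorem continuousOn_besselInt {ν : ℝ} (hν : |ν| ≤ 1) : ContinuousOn (besselInt ν) (Ioi 0) := by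
  intro r hr
  have hr : 0 < r := hr
  refine ContinuousAt.continuousWithinAt (continuousAt_of_dominated
    (bound := fun s => Real.exp |s| * Real.exp (-(r / 2 * Real.cosh s))) ?_ ?_ ?_ ?_)
  · exact Eventually.of_forall fun r => Continuous.aestronglyMeasurable (by fun_prop)
  · filter_upwards [lt_mem_nhds (half_lt_self hr)] with r' h
    refine Eventually.of_forall fun s => ?_
    rw [Real.norm_of_nonneg (by positivity)]
    exact besselInt_integrand_le hν h.le s
  · exact integrable_exp_abs_mul_exp_neg_cosh (half_pos hr)
  · exact Eventually.of_forall fun s => by fun_prop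

theorem norm_add_mul_I_div_euclNorm_le {a b : ℝ} {y : ℝ × ℝ} (h : a ^ 2 + b ^ 2 = euclNorm y ^ 2) :
    ‖(a + b * Complex.I : ℂ) / euclNorm y‖ ≤ 1 := by
  rw [norm_div, Complex.norm_add_mul_I, h, Real.sqrt_sq (euclNorm_nonneg y), Complex.norm_real,
    Real.norm_of_nonneg (euclNorm_nonneg y)]
  exact div_self_le_one _

theorem norm_planeKernel_le {c : ℝ} (hc : 0 < c) (hc1 : c < 1) {y : ℝ × ℝ} (hy : y ≠ 0)
    (j k : Fin 2) : ‖planeKernel y j k‖ ≤ 4 / (1 - c) * yukawa c y := by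
  have hr := euclNorm_pos hy
  have h4 : ‖(1 / (4 * Real.pi) : ℂ)‖ ≤ 1 := by
    rw [norm_div, norm_mul, Complex.norm_real, Real.norm_of_nonneg Real.pi_pos.le]
    simp only [norm_one, Complex.norm_ofNat]
    rw [div_le_one (by positivity)]
    linarith [Real.pi_gt_three]
  have key : ∀ (z : ℂ) (ν : ℝ), ‖z‖ ≤ 1 → |ν| ≤ 1 →
      ‖(1 / (4 * Real.pi) : ℂ) * (z * besselInt ν (euclNorm y))‖ ≤ 4 / (1 - c) * yukawa c y := by
    intro z ν hz hν
    rw [norm_mul, norm_mul, Complex.norm_real, Real.norm_of_nonneg (besselInt_nonneg _ _)]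
    have h0 := besselInt_nonneg ν (euclNorm y)
    calc _ ≤ 1 * (1 * besselInt ν (euclNorm y)) := by gcongr
      _ ≤ _ := by
        rw [one_mul, one_mul]
        exact besselInt_le hν hr hc hc1
  have hsq : euclNorm y ^ 2 = y.1 ^ 2 + y.2 ^ 2 := Real.sq_sqrt (by positivity)
  have e1 := norm_add_mul_I_div_euclNorm_le (a := y.2) (b := y.1) (y := y) (by rw [hsq, add_comm])
  have e2 := norm_add_mul_I_div_euclNorm_le (a := -y.2) (b := y.1) (y := y)
    (by rw [hsq, neg_sq, add_comm])
  rw [Complex.ofReal_neg] at e2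
  fin_cases j <;> fin_cases k
  · exact key _ 0 (by simp) (by simp)
  · exact key _ 1 e1 (by simp)
  · exact key _ 1 e2 (by simp)
  · exact key _ 0 (by simp) (by simp)

theorem continuousOn_planeKernel : ContinuousOn planeKernel {0}ᶜ := by
  have h : ∀ ν : ℝ, |ν| ≤ 1 →
      ContinuousOn (fun y => (besselInt ν (euclNorm y) : ℂ)) {0}ᶜ := fun ν hν =>
    Complex.continuous_ofReal.comp_continuousOn ((continuousOn_besselInt hν).comp
      continuous_euclNorm.continuousOn fun y hy => euclNorm_pos hy)
  have h0 := h 0 (by simp)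
  have h1 := h 1 (by simp)
  have hr : ContinuousOn (fun y => (euclNorm y : ℂ)) {0}ᶜ :=
    (Complex.continuous_ofReal.comp continuous_euclNorm).continuousOn
  have hr0 : ∀ y ∈ ({0}ᶜ : Set (ℝ × ℝ)), (euclNorm y : ℂ) ≠ 0 := fun y hy =>
    Complex.ofReal_ne_zero.2 (euclNorm_pos hy).ne'
  refine continuousOn_pi.2 fun j => continuousOn_pi.2 fun k => ?_
  have c1 : ContinuousOn (fun y : ℝ × ℝ => ((y.2 : ℂ) + y.1 * Complex.I) / euclNorm y) {0}ᶜ :=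
    ContinuousOn.div (by fun_prop) hr hr0
  have c2 : ContinuousOn (fun y : ℝ × ℝ => (-(y.2 : ℂ) + y.1 * Complex.I) / euclNorm y) {0}ᶜ :=
    ContinuousOn.div (by fun_prop) hr hr0
  fin_cases j <;> fin_cases k
  · exact continuousOn_const.mul (continuousOn_const.mul h0)
  · exact continuousOn_const.mul (c1.mul h1)
  · exact continuousOn_const.mul (c2.mul h1)
  · exact continuousOn_const.mul (continuousOn_const.mul h0)

theorem continuousOn_mirrorKernel {γ : ℝ} (hγ : 0 < γ) :
    ContinuousOn (mirrorKernel γ) halfPlane := by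
  have h : ∀ {ν : ℝ}, |ν| ≤ 1 → ContinuousOn (stripKernel (symb γ ν)) halfPlane :=
    fun hν => (isSymbol_symb hγ hν).continuousOn_stripKernel
  refine continuousOn_pi.2 fun j => continuousOn_pi.2 fun k => ?_
  fin_cases j <;> fin_cases k
  · exact h abs_one_le_one
  · exact continuousOn_const.mul (h abs_zero_le_one)
  · exact continuousOn_const.mul (h abs_zero_le_one)
  · exact (h abs_neg_one_le_one).neg

/-- Pairs of distinct points of the half-plane. -/
def offDiagonal : Set ((ℝ × ℝ) × (ℝ × ℝ)) := {p | p.1 ∈ halfPlane ∧ p.2 ∈ halfPlane ∧ p.1 ≠ p.2}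

theorem continuousOn_unitKernel {γ : ℝ} (hγ : 0 < γ) :
    ContinuousOn (fun p : (ℝ × ℝ) × (ℝ × ℝ) => unitKernel γ p.1 p.2) offDiagonal := by
  refine (continuousOn_planeKernel.comp (f := fun p : (ℝ × ℝ) × (ℝ × ℝ) => p.1 - p.2)
    (by fun_prop) fun p hp => sub_ne_zero.2 hp.2.2).add
    ((continuousOn_mirrorKernel hγ).comp
      (f := fun p : (ℝ × ℝ) × (ℝ × ℝ) => (p.1.1 - p.2.1, p.1.2 + p.2.2)) (by fun_prop)
      fun p hp => show 0 < p.1.2 + p.2.2 from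
        add_pos (show 0 < p.1.2 from hp.1) (show 0 < p.2.2 from hp.2.1))

theorem continuousOn_diracKernel_of_pos {γ a : ℝ} (hγ : 0 < γ) (ha : 0 < a) :
    ContinuousOn (fun p : (ℝ × ℝ) × (ℝ × ℝ) => diracKernel γ a p.1 p.2) offDiagonal := by
  simp only [diracKernel_of_pos ha]
  have hm : MapsTo (fun p : (ℝ × ℝ) × (ℝ × ℝ) => (a • p.1, a • p.2)) offDiagonal offDiagonal :=
    fun p hp => ⟨smul_mem_halfPlane ha hp.1, smul_mem_halfPlane ha hp.2.1,
      fun h => hp.2.2 (smul_right_injective _ ha.ne' h)⟩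
  have hc : ContinuousOn (fun p : (ℝ × ℝ) × (ℝ × ℝ) => (a • p.1, a • p.2)) offDiagonal := by
    fun_prop
  exact ((continuousOn_unitKernel hγ).comp hc hm).const_smul (a : ℂ)

theorem continuousOn_diracKernel {γ lam : ℝ} (hγ : 0 < γ) (hlam : lam ≠ 0) :
    ContinuousOn (fun p : (ℝ × ℝ) × (ℝ × ℝ) => diracKernel γ lam p.1 p.2) offDiagonal := by
  rcases lt_or_gt_of_ne hlam with h | h
  · simp only [diracKernel_of_neg h]
    exact (continuous_id.matrix_conjTranspose).comp_continuousOn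
      ((continuousOn_diracKernel_of_pos hγ (neg_pos.2 h)).comp (f := Prod.swap)
        continuous_swap.continuousOn fun p hp => ⟨hp.2.1, hp.1, hp.2.2.symm⟩)
  · exact continuousOn_diracKernel_of_pos hγ h

theorem exp_neg_div_anti {c r r' : ℝ} (hc : 0 < c) (hr : 0 < r) (h : r ≤ r') :
    Real.exp (-(c * r')) / r' ≤ Real.exp (-(c * r)) / r := by
  gcongr

theorem exists_norm_unitKernel_le {γ c : ℝ} (hγ : 0 < γ) (hc : 0 < c) (hc1 : c < 1) :
    ∃ C : ℝ, 0 < C ∧ ∀ x ∈ halfPlane, ∀ x' ∈ halfPlane, x ≠ x' → ∀ j k,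
      ‖unitKernel γ x x' j k‖ ≤ C * yukawa c (x - x') := by
  obtain ⟨C, hC, h⟩ := exists_norm_stripKernel_symb_le hγ hc hc1
  have hC' : 0 < 4 / (1 - c) := div_pos (by norm_num) (sub_pos.2 hc1)
  refine ⟨4 / (1 - c) + C, by positivity, fun x hx x' hx' hne j k => ?_⟩
  have hx : 0 < x.2 := hx
  have hx' : 0 < x'.2 := hx'
  rw [unitKernel, Matrix.add_apply, add_mul]
  refine (norm_add_le _ _).trans
    (add_le_add (norm_planeKernel_le hc hc1 (sub_ne_zero.2 hne) j k) ?_)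
  -- A point of the half-plane is closer to x' than to the mirror image of x'.
  have hle : euclNorm (x - x') ≤ euclNorm (x.1 - x'.1, x.2 + x'.2) := by
    refine Real.sqrt_le_sqrt ?_
    simp only [Prod.fst_sub, Prod.snd_sub]
    nlinarith [mul_pos hx hx']
  have hb := exp_neg_div_anti hc (euclNorm_pos (sub_ne_zero.2 hne)) hle
  have key : ∀ ν : ℝ, |ν| ≤ 1 → ‖stripKernel (symb γ ν) (x.1 - x'.1, x.2 + x'.2)‖ ≤
      C * yukawa c (x - x') := fun ν hν =>
    (h ν hν _ (add_pos hx hx')).trans (mul_le_mul_of_nonneg_left hb hC.le)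
  fin_cases j <;> fin_cases k
  · exact key 1 abs_one_le_one
  · simpa [mirrorKernel] using key 0 abs_zero_le_one
  · simpa [mirrorKernel] using key 0 abs_zero_le_one
  · simpa [mirrorKernel] using key (-1) abs_neg_one_le_one

theorem euclNorm_smul {a : ℝ} (ha : 0 ≤ a) (y : ℝ × ℝ) : euclNorm (a • y) = a * euclNorm y := by
  rw [euclNorm, euclNorm]
  have : (a • y).1 ^ 2 + (a • y).2 ^ 2 = a ^ 2 * (y.1 ^ 2 + y.2 ^ 2) := by
    simp only [Prod.smul_fst, Prod.smul_snd, smul_eq_mul]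
    ring
  rw [this, Real.sqrt_mul (sq_nonneg a), Real.sqrt_sq ha]

theorem yukawa_neg (c : ℝ) (y : ℝ × ℝ) : yukawa c (-y) = yukawa c y := by
  rw [yukawa, yukawa, euclNorm_neg]

/-- The factor 1/r absorbs the prefactor λ of the kernel. For this reason the constant does not
depend on λ. -/
theorem mul_yukawa_smul {a : ℝ} (ha : 0 < a) (c : ℝ) (y : ℝ × ℝ) :
    a * yukawa c (a • y) = yukawa (c * a) y := by
  rw [yukawa, yukawa, euclNorm_smul ha.le, ← mul_assoc]
  field_simp

/-- The pointwise estimate of the resolvent kernel. -/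
theorem exists_norm_diracKernel_le {γ c : ℝ} (hγ : 0 < γ) (hc : 0 < c) (hc1 : c < 1) :
    ∃ C : ℝ, 0 < C ∧ ∀ lam : ℝ, lam ≠ 0 → ∀ x ∈ halfPlane, ∀ x' ∈ halfPlane, x ≠ x' → ∀ j k,
      ‖diracKernel γ lam x x' j k‖ ≤ C * yukawa (c * |lam|) (x - x') := by
  obtain ⟨C, hC, h⟩ := exists_norm_unitKernel_le hγ hc hc1
  have pos : ∀ a : ℝ, 0 < a → ∀ x ∈ halfPlane, ∀ x' ∈ halfPlane, x ≠ x' → ∀ j k,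
      ‖diracKernel γ a x x' j k‖ ≤ C * yukawa (c * a) (x - x') := by
    intro a ha x hx x' hx' hne j k
    rw [diracKernel_of_pos ha, Matrix.smul_apply, norm_smul, Complex.norm_real,
      Real.norm_of_nonneg ha.le, ← mul_yukawa_smul ha, mul_left_comm, smul_sub]
    exact mul_le_mul_of_nonneg_left (h _ (smul_mem_halfPlane ha hx) _ (smul_mem_halfPlane ha hx')
      (fun e => hne (smul_right_injective _ ha.ne' e)) j k) ha.le
  refine ⟨C, hC, fun lam hlam x hx x' hx' hne j k => ?_⟩
  rcases lt_or_gt_of_ne hlam with hl | hl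
  · rw [diracKernel_of_neg hl, Matrix.conjTranspose_apply, norm_star, ← yukawa_neg, neg_sub,
      abs_of_neg hl]
    exact pos _ (neg_pos.2 hl) x' hx' x hx hne.symm k j
  · rw [abs_of_pos hl]
    exact pos _ hl x hx x' hx' hne j k

theorem exists_kernelBound_diracKernel : ∃ C : ℝ → ℝ → ℝ, KernelBound diracKernel C := by
  have h : ∀ γ c : ℝ, ∃ C : ℝ, 0 < γ → c ∈ Ioo (0 : ℝ) 1 →
      ∀ lam : ℝ, lam ≠ 0 → ∀ x ∈ halfPlane, ∀ x' ∈ halfPlane, x ≠ x' →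
        matSup (diracKernel γ lam x x') ≤
          C * (Real.exp (-(c * |lam| * euclDist x x')) / euclDist x x') := fun γ c => by
    by_cases hh : 0 < γ ∧ c ∈ Ioo (0 : ℝ) 1
    · obtain ⟨C, -, hC⟩ := exists_norm_diracKernel_le hh.1 hh.2.1 hh.2.2
      exact ⟨C, fun _ _ lam hlam x hx x' hx' hne => matSup_le (hC lam hlam x hx x' hx' hne)⟩
    · exact ⟨0, fun h1 h2 => (hh ⟨h1, h2⟩).elim⟩
  choose C hC using h
  exact ⟨C, fun γ hγ c hc => hC γ c hγ hc⟩

/-! ### Integral operators on `L²` -/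

section Schur

open scoped ENNReal

/-- Cauchy–Schwarz for the splitting k g = √k · (√k g). -/
theorem lintegral_mul_sq_le {α : Type*} [MeasurableSpace α] {μ : Measure α} {k g : α → ℝ≥0∞}
    (hk : AEMeasurable k μ) (hg : AEMeasurable g μ) :
    (∫⁻ x, k x * g x ∂μ) ^ 2 ≤ (∫⁻ x, k x ∂μ) * ∫⁻ x, k x * g x ^ 2 ∂μ := by
  have h := ENNReal.lintegral_mul_le_Lp_mul_Lq μ Real.HolderConjugate.two_two
    (hk.pow_const (1 / 2 : ℝ)) ((hk.pow_const (1 / 2 : ℝ)).mul hg)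
  have e1 : ∀ x, k x ^ (1 / 2 : ℝ) * (k x ^ (1 / 2 : ℝ) * g x) = k x * g x := fun x => by
    rw [← mul_assoc, ← ENNReal.rpow_add_of_nonneg _ _ (by norm_num) (by norm_num)]
    norm_num
  have e2 : ∀ x, (k x ^ (1 / 2 : ℝ)) ^ (2 : ℝ) = k x := fun x => by
    rw [← ENNReal.rpow_mul]
    norm_num
  have e3 : ∀ x, (k x ^ (1 / 2 : ℝ) * g x) ^ (2 : ℝ) = k x * g x ^ 2 := fun x => by
    rw [ENNReal.mul_rpow_of_nonneg _ _ (by norm_num), e2, ENNReal.rpow_two]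
  simp only [Pi.mul_apply, e1, e2, e3] at h
  calc (∫⁻ x, k x * g x ∂μ) ^ 2 ≤
      ((∫⁻ x, k x ∂μ) ^ (1 / 2 : ℝ) * (∫⁻ x, k x * g x ^ 2 ∂μ) ^ (1 / 2 : ℝ)) ^ 2 := by gcongr
    _ = _ := by
      rw [mul_pow, ← ENNReal.rpow_two, ← ENNReal.rpow_two, ← ENNReal.rpow_mul, ← ENNReal.rpow_mul]
      norm_num

/-- The Schur test. -/
theorem lintegral_lintegral_mul_sq_le {α : Type*} [MeasurableSpace α] {μ : Measure α} [SFinite μ]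
    {k : α → α → ℝ≥0∞} (hk : Measurable (Function.uncurry k)) {A : ℝ≥0∞}
    (h1 : ∀ x, ∫⁻ x', k x x' ∂μ ≤ A) (h2 : ∀ x', ∫⁻ x, k x x' ∂μ ≤ A) {g : α → ℝ≥0∞}
    (hg : AEMeasurable g μ) :
    ∫⁻ x, (∫⁻ x', k x x' * g x' ∂μ) ^ 2 ∂μ ≤ A ^ 2 * ∫⁻ x, g x ^ 2 ∂μ := by
  calc ∫⁻ x, (∫⁻ x', k x x' * g x' ∂μ) ^ 2 ∂μ
      ≤ ∫⁻ x, A * ∫⁻ x', k x x' * g x' ^ 2 ∂μ ∂μ := by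
        refine lintegral_mono fun x => (lintegral_mul_sq_le ?_ hg).trans (by gcongr; exact h1 x)
        exact (hk.comp measurable_prodMk_left).aemeasurable
    _ = A * ∫⁻ x', ∫⁻ x, k x x' * g x' ^ 2 ∂μ ∂μ := by
        have hm : AEMeasurable (Function.uncurry fun x x' => k x x' * g x' ^ 2) (μ.prod μ) :=
          hk.aemeasurable.mul (hg.comp_snd.pow_const 2)
        rw [lintegral_const_mul'' A hm.lintegral_prod_right, lintegral_lintegral_swap hm]
    _ ≤ A * ∫⁻ x', A * g x' ^ 2 ∂μ := by
        gcongr with x'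
        have hk' : Measurable fun x => k x x' := hk.comp measurable_prodMk_right
        rw [lintegral_mul_const _ hk']
        gcongr
        exact h2 x'
    _ = _ := by
        rw [lintegral_const_mul'' _ (hg.pow_const 2), ← mul_assoc, sq]

end Schur

/-! ### Matrices acting on spinors, and measurability of kernels. -/

theorem act_add (A : Matrix (Fin 2) (Fin 2) ℂ) (v w : Spinor) : act A (v + w) = act A v + act A w := by
  simp only [act, WithLp.ofLp_add, Matrix.mulVec_add, WithLp.toLp_add]

theorem act_smul (A : Matrix (Fin 2) (Fin 2) ℂ) (z : ℂ) (v : Spinor) :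
    act A (z • v) = z • act A v := by
  simp only [act, WithLp.ofLp_smul, Matrix.mulVec_smul, WithLp.toLp_smul]

theorem act_apply (A : Matrix (Fin 2) (Fin 2) ℂ) (v : Spinor) (j : Fin 2) :
    act A v j = A j 0 * v 0 + A j 1 * v 1 := by
  fin_cases j <;> simp [act]

theorem norm_spinor_le (v : Spinor) : ‖v‖ ≤ ‖v 0‖ + ‖v 1‖ := by
  rw [EuclideanSpace.norm_eq, Fin.sum_univ_two]
  refine Real.sqrt_le_iff.2 ⟨by positivity, ?_⟩
  nlinarith [norm_nonneg (v 0), norm_nonneg (v 1)]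

theorem norm_act_le {A : Matrix (Fin 2) (Fin 2) ℂ} {B : ℝ} (h : ∀ j k, ‖A j k‖ ≤ B) (v : Spinor) :
    ‖act A v‖ ≤ 4 * B * ‖v‖ := by
  have hB : 0 ≤ B := (norm_nonneg _).trans (h 0 0)
  have hc : ∀ j, ‖act A v j‖ ≤ 2 * B * ‖v‖ := fun j => by
    rw [act_apply]
    refine (norm_add_le _ _).trans ?_
    rw [norm_mul, norm_mul]
    have h0 := mul_le_mul (h j 0) (PiLp.norm_apply_le v 0) (norm_nonneg _) hB
    have h1 := mul_le_mul (h j 1) (PiLp.norm_apply_le v 1) (norm_nonneg _) hB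
    linarith
  refine (norm_spinor_le _).trans ?_
  linarith [hc 0, hc 1]

theorem continuous_act : Continuous fun p : Matrix (Fin 2) (Fin 2) ℂ × Spinor => act p.1 p.2 := by
  unfold act
  fun_prop

/-- The Lebesgue measure of the half-plane. -/
abbrev volHalf : Measure (ℝ × ℝ) := (volume : Measure (ℝ × ℝ)).restrict halfPlane

/-- The diagonal is a null set of the product measure, so continuity away from it is enough. -/
theorem aestronglyMeasurable_of_continuousOn_offDiagonal
    {K : ℝ × ℝ → ℝ × ℝ → Matrix (Fin 2) (Fin 2) ℂ}
    (hK : ContinuousOn (fun p : (ℝ × ℝ) × (ℝ × ℝ) => K p.1 p.2) offDiagonal) :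
    AEStronglyMeasurable (fun p : (ℝ × ℝ) × (ℝ × ℝ) => K p.1 p.2) (volHalf.prod volHalf) := by
  have hd : MeasurableSet {p : (ℝ × ℝ) × (ℝ × ℝ) | p.1 ≠ p.2} :=
    (isClosed_eq continuous_fst continuous_snd).measurableSet.compl
  have hm : MeasurableSet offDiagonal :=
    (measurable_fst measurableSet_halfPlane).inter ((measurable_snd measurableSet_halfPlane).inter hd)
  have hne : ∀ᵐ p ∂(volHalf.prod volHalf), p.1 ≠ p.2 := by
    rw [Measure.ae_prod_iff_ae_ae hd]
    exact Eventually.of_forall fun x => (Measure.ae_ne volHalf x).mono fun x' h => h.symm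
  have : volHalf.prod volHalf = (volume.prod volume).restrict offDiagonal := by
    rw [Measure.prod_restrict]
    refine Measure.restrict_congr_set ?_
    rw [Measure.prod_restrict, ae_restrict_iff' (measurableSet_halfPlane.prod
      measurableSet_halfPlane)] at hne
    filter_upwards [hne] with p hp
    exact propext ⟨fun h => ⟨h.1, h.2, hp h⟩, fun h => ⟨h.1, h.2.1⟩⟩
  have : TopologicalSpace.PseudoMetrizableSpace (Matrix (Fin 2) (Fin 2) ℂ) :=
    inferInstanceAs (TopologicalSpace.PseudoMetrizableSpace (Fin 2 → Fin 2 → ℂ))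
  rw [‹volHalf.prod volHalf = _›]
  exact hK.aestronglyMeasurable hm

/-- The data of a kernel that defines a bounded operator by the Schur test. -/
structure SchurKernel (K : ℝ × ℝ → ℝ × ℝ → Matrix (Fin 2) (Fin 2) ℂ) (B a : ℝ) : Prop where
  pos : 0 < a
  nonneg : 0 ≤ B
  continuousOn : ContinuousOn (fun p : (ℝ × ℝ) × (ℝ × ℝ) => K p.1 p.2) offDiagonal
  bound : ∀ x ∈ halfPlane, ∀ x' ∈ halfPlane, x ≠ x' → ∀ j k, ‖K x x' j k‖ ≤ B * yukawa a (x - x')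

theorem exists_schurKernel_diracKernel {γ lam : ℝ} (hγ : 0 < γ) (hlam : lam ≠ 0) :
    ∃ B a, SchurKernel (diracKernel γ lam) B a := by
  obtain ⟨C, hC, h⟩ := exists_norm_diracKernel_le hγ (c := 1 / 2) (by norm_num) (by norm_num)
  exact ⟨C, 1 / 2 * |lam|, ⟨by positivity, hC.le, continuousOn_diracKernel hγ hlam, h lam hlam⟩⟩

section

open scoped ENNReal

variable {K : ℝ × ℝ → ℝ × ℝ → Matrix (Fin 2) (Fin 2) ℂ} {B a : ℝ}

theorem lintegral_yukawa_le (a : ℝ) (x : ℝ × ℝ) :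
    ∫⁻ x', ‖yukawa a (x - x')‖ₑ ∂volHalf ≤ ∫⁻ y, ‖yukawa a y‖ₑ :=
  (lintegral_mono' Measure.restrict_le_self le_rfl).trans
    (lintegral_sub_left_eq_self (fun y => ‖yukawa a y‖ₑ) x).le

theorem SchurKernel.enorm_act_le (hK : SchurKernel K B a) {x x' : ℝ × ℝ} (hx : x ∈ halfPlane)
    (hx' : x' ∈ halfPlane) (hne : x ≠ x') (v : Spinor) :
    ‖act (K x x') v‖ₑ ≤ ENNReal.ofReal (4 * B) * (‖yukawa a (x - x')‖ₑ * ‖v‖ₑ) := by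
  have h := norm_act_le (hK.bound x hx x' hx' hne) v
  rw [← mul_assoc] at h
  rw [← ofReal_norm, ← ofReal_norm, ← ofReal_norm,
    ← ENNReal.ofReal_mul (norm_nonneg _), ← ENNReal.ofReal_mul (by linarith [hK.nonneg]),
    Real.norm_of_nonneg (yukawa_nonneg _ _), ← mul_assoc]
  exact ENNReal.ofReal_le_ofReal h

theorem SchurKernel.lintegral_enorm_act_le (hK : SchurKernel K B a) {x : ℝ × ℝ}
    (hx : x ∈ halfPlane) (f : ℝ × ℝ → Spinor) :
    ∫⁻ x', ‖act (K x x') (f x')‖ₑ ∂volHalf ≤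
      ENNReal.ofReal (4 * B) * ∫⁻ x', ‖yukawa a (x - x')‖ₑ * ‖f x'‖ₑ ∂volHalf := by
  rw [← lintegral_const_mul' _ _ ENNReal.ofReal_ne_top]
  refine lintegral_mono_ae ?_
  filter_upwards [ae_restrict_mem measurableSet_halfPlane, Measure.ae_ne volHalf x] with x' hx' hne
  exact hK.enorm_act_le hx hx' hne.symm _

theorem SchurKernel.aestronglyMeasurable (hK : SchurKernel K B a) {f : ℝ × ℝ → Spinor}
    (hf : AEStronglyMeasurable f volHalf) :
    AEStronglyMeasurable (fun p : (ℝ × ℝ) × (ℝ × ℝ) => act (K p.1 p.2) (f p.2))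
      (volHalf.prod volHalf) :=
  continuous_act.comp_aestronglyMeasurable
    ((aestronglyMeasurable_of_continuousOn_offDiagonal hK.continuousOn).prodMk hf.comp_snd)

theorem lintegral_yukawa_mul_sq_le (a : ℝ) {f : ℝ × ℝ → Spinor}
    (hf : AEStronglyMeasurable f volHalf) :
    ∫⁻ x, (∫⁻ x', ‖yukawa a (x - x')‖ₑ * ‖f x'‖ₑ ∂volHalf) ^ 2 ∂volHalf ≤
      (∫⁻ y, ‖yukawa a y‖ₑ) ^ 2 * ∫⁻ x, ‖f x‖ₑ ^ 2 ∂volHalf := by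
  refine lintegral_lintegral_mul_sq_le (k := fun x x' => ‖yukawa a (x - x')‖ₑ) ?_
    (lintegral_yukawa_le a) (fun x' => ?_) hf.enorm
  · exact ((measurable_yukawa a).comp (measurable_fst.sub measurable_snd)).enorm
  · have : ∀ x, yukawa a (x - x') = yukawa a (x' - x) := fun x => by rw [← yukawa_neg, neg_sub]
    simp only [this]
    exact lintegral_yukawa_le a x'

theorem lintegral_enorm_sq_eq {E : Type*} [NormedAddCommGroup E] {α : Type*} [MeasurableSpace α]
    {μ : Measure α} (f : α → E) : ∫⁻ x, ‖f x‖ₑ ^ 2 ∂μ = eLpNorm f 2 μ ^ 2 := by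
  have := eLpNorm_nnreal_pow_eq_lintegral (f := f) (μ := μ) (p := 2) two_ne_zero
  simpa using this.symm

theorem SchurKernel.ae_integrable (hK : SchurKernel K B a) {f : ℝ × ℝ → Spinor}
    (hf : MemLp f 2 volHalf) :
    ∀ᵐ x ∂volHalf, IntegrableOn (fun x' => act (K x x') (f x')) halfPlane := by
  have h1 := lintegral_yukawa_mul_sq_le a hf.1
  rw [lintegral_enorm_sq_eq f] at h1
  have hfin : ∫⁻ x, (∫⁻ x', ‖yukawa a (x - x')‖ₑ * ‖f x'‖ₑ ∂volHalf) ^ 2 ∂volHalf ≠ ⊤ :=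
    ne_top_of_le_ne_top (ENNReal.mul_ne_top
      (ENNReal.pow_ne_top (integrable_yukawa hK.pos).2.ne) (ENNReal.pow_ne_top hf.2.ne)) h1
  have hm : AEMeasurable (fun x => (∫⁻ x', ‖yukawa a (x - x')‖ₑ * ‖f x'‖ₑ ∂volHalf) ^ 2) volHalf := by
    refine AEMeasurable.pow_const (AEMeasurable.lintegral_prod_right'
      (f := fun p : (ℝ × ℝ) × (ℝ × ℝ) => ‖yukawa a (p.1 - p.2)‖ₑ * ‖f p.2‖ₑ) ?_) 2
    exact ((measurable_yukawa a).comp (measurable_fst.sub measurable_snd)).enorm.aemeasurable.mul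
      hf.1.enorm.comp_snd
  filter_upwards [ae_lt_top' hm hfin, ae_restrict_mem measurableSet_halfPlane,
    (hK.aestronglyMeasurable hf.1).prodMk_left] with x hx hxh hmx
  refine ⟨hmx, (hK.lintegral_enorm_act_le hxh f).trans_lt (ENNReal.mul_lt_top
    ENNReal.ofReal_lt_top ?_)⟩
  simpa using hx

/-- The integral operator with kernel `K`. -/
def kernelInt (K : ℝ × ℝ → ℝ × ℝ → Matrix (Fin 2) (Fin 2) ℂ) (f : ℝ × ℝ → Spinor) (x : ℝ × ℝ) :
    Spinor := ∫ x' in halfPlane, act (K x x') (f x')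

theorem SchurKernel.eLpNorm_kernelInt_le (hK : SchurKernel K B a) {f : ℝ × ℝ → Spinor}
    (hf : MemLp f 2 volHalf) :
    eLpNorm (kernelInt K f) 2 volHalf ≤
      ENNReal.ofReal (4 * B) * (∫⁻ y, ‖yukawa a y‖ₑ) * eLpNorm f 2 volHalf := by
  rw [← ENNReal.pow_le_pow_left_iff two_ne_zero, ← lintegral_enorm_sq_eq, mul_pow, mul_pow]
  have hm := lintegral_yukawa_mul_sq_le a hf.1
  rw [lintegral_enorm_sq_eq f] at hm
  calc ∫⁻ x, ‖kernelInt K f x‖ₑ ^ 2 ∂volHalf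
      ≤ ∫⁻ x, ENNReal.ofReal (4 * B) ^ 2 *
          (∫⁻ x', ‖yukawa a (x - x')‖ₑ * ‖f x'‖ₑ ∂volHalf) ^ 2 ∂volHalf := by
        refine lintegral_mono_ae ?_
        filter_upwards [ae_restrict_mem measurableSet_halfPlane] with x hx
        rw [← mul_pow]
        gcongr
        exact (enorm_integral_le_lintegral_enorm _).trans (hK.lintegral_enorm_act_le hx f)
    _ ≤ _ := by
        rw [lintegral_const_mul' _ _ (ENNReal.pow_ne_top ENNReal.ofReal_ne_top), mul_assoc]
        gcongr

theorem SchurKernel.memLp_kernelInt (hK : SchurKernel K B a) {f : ℝ × ℝ → Spinor}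
    (hf : MemLp f 2 volHalf) : MemLp (kernelInt K f) 2 volHalf :=
  ⟨(hK.aestronglyMeasurable hf.1).integral_prod_right',
    (hK.eLpNorm_kernelInt_le hf).trans_lt (ENNReal.mul_lt_top (ENNReal.mul_lt_top
      ENNReal.ofReal_lt_top (integrable_yukawa hK.pos).2) hf.2)⟩

theorem SchurKernel.exists_isIntegralKernel (hK : SchurKernel K B a) :
    ∃ R : L2Spinor →L[ℂ] L2Spinor, IsIntegralKernel R K := by
  let T : L2Spinor →ₗ[ℂ] L2Spinor :=
    { toFun := fun f => (hK.memLp_kernelInt (Lp.memLp f)).toLp _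
      map_add' := fun f g => by
        refine Lp.ext ?_
        filter_upwards [(hK.memLp_kernelInt (Lp.memLp (f + g))).coeFn_toLp,
          (hK.memLp_kernelInt (Lp.memLp f)).coeFn_toLp, (hK.memLp_kernelInt (Lp.memLp g)).coeFn_toLp,
          Lp.coeFn_add ((hK.memLp_kernelInt (Lp.memLp f)).toLp _)
            ((hK.memLp_kernelInt (Lp.memLp g)).toLp _), hK.ae_integrable (Lp.memLp f),
          hK.ae_integrable (Lp.memLp g)] with x h1 h2 h3 h4 h5 h6
        rw [h1, h4, Pi.add_apply, h2, h3, kernelInt, kernelInt, kernelInt, ← integral_add h5 h6]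
        refine integral_congr_ae ?_
        filter_upwards [Lp.coeFn_add f g] with x' h
        rw [h, Pi.add_apply, act_add]
      map_smul' := fun z f => by
        refine Lp.ext ?_
        filter_upwards [(hK.memLp_kernelInt (Lp.memLp (z • f))).coeFn_toLp,
          (hK.memLp_kernelInt (Lp.memLp f)).coeFn_toLp,
          Lp.coeFn_smul z ((hK.memLp_kernelInt (Lp.memLp f)).toLp _)] with x h1 h2 h3
        rw [h1, RingHom.id_apply, h3, Pi.smul_apply, h2, kernelInt, kernelInt, ← integral_smul]
        refine integral_congr_ae ?_
        filter_upwards [Lp.coeFn_smul z f] with x' h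
        rw [h, Pi.smul_apply, act_smul] }
  have hfin : ENNReal.ofReal (4 * B) * (∫⁻ y, ‖yukawa a y‖ₑ) ≠ ⊤ :=
    ENNReal.mul_ne_top ENNReal.ofReal_ne_top (integrable_yukawa hK.pos).2.ne
  refine ⟨T.mkContinuous (ENNReal.ofReal (4 * B) * (∫⁻ y, ‖yukawa a y‖ₑ)).toReal fun f => ?_,
    fun f => ?_⟩
  · have := hK.eLpNorm_kernelInt_le (Lp.memLp f)
    rw [Lp.norm_def f, ← ENNReal.toReal_mul]
    refine (Lp.norm_toLp _ (hK.memLp_kernelInt (Lp.memLp f))).le.trans ?_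
    exact ENNReal.toReal_mono (ENNReal.mul_ne_top hfin (Lp.memLp f).2.ne) this
  · filter_upwards [hK.ae_integrable (Lp.memLp f),
      (hK.memLp_kernelInt (Lp.memLp f)).coeFn_toLp] with x h1 h2
    exact ⟨h1, h2⟩

end

/-! ### Spinors with two given components -/

section Spin

/-- The spinor with components `a` and `b`. -/
def spin (a b : ℂ) : Spinor := !₂[a, b]

@[simp] theorem spin_apply_zero (a b : ℂ) : spin a b 0 = a := rfl

@[simp] theorem spin_apply_one (a b : ℂ) : spin a b 1 = b := rfl

theorem spinor_ext {v w : Spinor} (h0 : v 0 = w 0) (h1 : v 1 = w 1) : v = w := by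
  ext j
  fin_cases j
  · exact h0
  · exact h1

/-- `spin` as a continuous linear map. -/
def spinL : ℂ × ℂ →L[ℝ] Spinor :=
  LinearMap.toContinuousLinearMap
    { toFun := fun p => spin p.1 p.2
      map_add' := fun p q => spinor_ext (by simp) (by simp)
      map_smul' := fun r p => spinor_ext (by simp) (by simp) }

@[simp] theorem spinL_apply (p : ℂ × ℂ) : spinL p = spin p.1 p.2 := rfl

variable {α : Type*} [MeasurableSpace α] {μ : Measure α}

theorem memLp_spin {a b : α → ℂ} (ha : MemLp a 2 μ) (hb : MemLp b 2 μ) :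
    MemLp (fun x => spin (a x) (b x)) 2 μ := by
  refine MemLp.of_eval_piLp fun j => ?_
  fin_cases j
  · exact ha
  · exact hb

/-- The element of `L²` with components `a` and `b`. -/
def spinL2 {a b : α → ℂ} (ha : MemLp a 2 μ) (hb : MemLp b 2 μ) : Lp Spinor 2 μ :=
  (memLp_spin ha hb).toLp _

theorem coeFn_spinL2 {a b : α → ℂ} (ha : MemLp a 2 μ) (hb : MemLp b 2 μ) :
    spinL2 ha hb =ᵐ[μ] fun x => spin (a x) (b x) := (memLp_spin ha hb).coeFn_toLp

theorem norm_sq_spinL2 {a b : α → ℂ} (ha : MemLp a 2 μ) (hb : MemLp b 2 μ) :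
    ‖spinL2 ha hb‖ ^ 2 = (∫ x, ‖a x‖ ^ 2 ∂μ) + ∫ x, ‖b x‖ ^ 2 ∂μ := by
  rw [← integral_add ((memLp_two_iff_integrable_sq_norm ha.1).1 ha)
    ((memLp_two_iff_integrable_sq_norm hb.1).1 hb), ← @inner_self_eq_norm_sq ℂ, L2.inner_def,
    ← integral_re (L2.integrable_inner _ _)]
  refine integral_congr_ae ?_
  filter_upwards [coeFn_spinL2 ha hb] with x hx
  rw [hx, inner_self_eq_norm_sq, EuclideanSpace.norm_sq_eq, Fin.sum_univ_two]
  rfl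

theorem spinL2_sub {a b a' b' : α → ℂ} (ha : MemLp a 2 μ) (hb : MemLp b 2 μ)
    (ha' : MemLp a' 2 μ) (hb' : MemLp b' 2 μ) :
    spinL2 (a := fun x => a x - a' x) (b := fun x => b x - b' x) (ha.sub ha') (hb.sub hb') =
      spinL2 ha hb - spinL2 ha' hb' := by
  rw [spinL2, spinL2, spinL2, ← MemLp.toLp_sub]
  congr 1
  funext x
  exact spinor_ext (by simp) (by simp)

theorem memLp_component (u : Lp Spinor 2 μ) (j : Fin 2) : MemLp (fun x => u x j) 2 μ :=
  (Lp.memLp u).eval_piLp j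

end Spin

/-! ### Rapidly decaying functions as elements of `L²` -/

theorem Nice.memLp {u : ℝ × ℝ → ℂ} (hu : Nice u) : MemLp u 2 volHalf := by
  have h : MemLp u 2 volume := by
    rw [memLp_two_iff_integrable_sq_norm hu.continuous.aestronglyMeasurable]
    refine ((hu.expDecay.mul hu.expDecay).integrable
      (hu.continuous.mul hu.continuous).aestronglyMeasurable).norm.congr
      (Eventually.of_forall fun x => ?_)
    simp only [norm_mul, sq]
  exact h.restrict _

theorem Nice.memLp_slice {u : ℝ × ℝ → ℂ} (hu : Nice u) :
    MemLp (fun s : ℝ => u (s, 0)) 2 volume := by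
  have hc : Continuous fun s : ℝ => u (s, 0) := hu.continuous.comp (by fun_prop)
  rw [memLp_two_iff_integrable_sq_norm hc.aestronglyMeasurable]
  refine ((hu.expDecay.mul hu.expDecay).integrable_slice
    (hu.continuous.mul hu.continuous) 0).norm.congr (Eventually.of_forall fun x => ?_)
  simp only [norm_mul, sq]

theorem Nice.sub {u w : ℝ × ℝ → ℂ} (hu : Nice u) (hw : Nice w) : Nice fun x => u x - w x := by
  simpa [sub_eq_add_neg] using hu.add (hw.const_mul (-1))

section WeakDerivative

variable {u₁ u₂ : ℝ × ℝ → ℂ}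

theorem hasFDerivAt_spin (h₁ : Nice u₁) (h₂ : Nice u₂) (x : ℝ × ℝ) :
    HasFDerivAt (fun x => spin (u₁ x) (u₂ x))
      (spinL.comp ((fderiv ℝ u₁ x).prod (fderiv ℝ u₂ x))) x :=
  spinL.hasFDerivAt.comp x
    ((h₁.differentiable x).hasFDerivAt.prodMk (h₂.differentiable x).hasFDerivAt)

theorem continuous_spin {a b : ℝ × ℝ → ℂ} (ha : Continuous a) (hb : Continuous b) :
    Continuous fun x => spin (a x) (b x) :=
  spinL.continuous.comp (ha.prodMk hb)

theorem fderiv_smul_spin (h₁ : Nice u₁) (h₂ : Nice u₂) {φ : ℝ × ℝ → ℝ} (hφ : ContDiff ℝ ∞ φ)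
    (x v : ℝ × ℝ) :
    fderiv ℝ (fun x => φ x • spin (u₁ x) (u₂ x)) x v =
      fderiv ℝ φ x v • spin (u₁ x) (u₂ x) + φ x • spin (fderiv ℝ u₁ x v) (fderiv ℝ u₂ x v) := by
  have h := ((hφ.differentiable (by simp) x).hasFDerivAt.smul (hasFDerivAt_spin h₁ h₂ x)).fderiv
  rw [show (fun x => φ x • spin (u₁ x) (u₂ x)) = φ • (fun x => spin (u₁ x) (u₂ x)) from rfl, h]
  simp [add_comm]

theorem continuous_fderiv_apply {φ : ℝ × ℝ → ℝ} (hφ : ContDiff ℝ ∞ φ) (v : ℝ × ℝ) :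
    Continuous fun x => fderiv ℝ φ x v :=
  (hφ.continuous_fderiv (by simp)).clm_apply continuous_const

theorem integrable_smul_spin {φ : ℝ × ℝ → ℝ} (hφ : Continuous φ) (hs : HasCompactSupport φ)
    {a b : ℝ × ℝ → ℂ} (ha : Continuous a) (hb : Continuous b) :
    Integrable fun x => φ x • spin (a x) (b x) :=
  (hφ.smul (continuous_spin ha hb)).integrable_of_hasCompactSupport hs.smul_right

theorem hasCompactSupport_fderiv_apply {φ : ℝ × ℝ → ℝ} (hs : HasCompactSupport φ) (v : ℝ × ℝ) :
    HasCompactSupport fun x => fderiv ℝ φ x v :=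
  (hs.fderiv (𝕜 := ℝ)).comp_left (g := fun L : ℝ × ℝ →L[ℝ] ℝ => L v) rfl

theorem integrable_fderiv_smul_spin (h₁ : Nice u₁) (h₂ : Nice u₂) {φ : ℝ × ℝ → ℝ}
    (hφ : ContDiff ℝ ∞ φ) (hs : HasCompactSupport φ) (v : ℝ × ℝ) :
    Integrable fun x => fderiv ℝ (fun x => φ x • spin (u₁ x) (u₂ x)) x v := by
  simp only [fderiv_smul_spin h₁ h₂ hφ]
  exact (integrable_smul_spin (continuous_fderiv_apply hφ v) (hasCompactSupport_fderiv_apply hs v) h₁.continuous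
    h₂.continuous).add (integrable_smul_spin hφ.continuous hs (h₁.fderiv v).continuous
      (h₂.fderiv v).continuous)

theorem setIntegral_smul_spinL2 {φ : ℝ × ℝ → ℝ} {a b : ℝ × ℝ → ℂ} (ha : MemLp a 2 volHalf)
    (hb : MemLp b 2 volHalf) :
    ∫ x in halfPlane, φ x • spinL2 ha hb x = ∫ x in halfPlane, φ x • spin (a x) (b x) := by
  refine integral_congr_ae ?_
  filter_upwards [coeFn_spinL2 ha hb] with x hx
  rw [hx]

theorem setIntegral_fderiv_smul_spin (h₁ : Nice u₁) (h₂ : Nice u₂) {φ : ℝ × ℝ → ℝ}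
    (hφ : ContDiff ℝ ∞ φ) (hs : HasCompactSupport φ) (v : ℝ × ℝ) :
    ∫ x in halfPlane, fderiv ℝ (fun x => φ x • spin (u₁ x) (u₂ x)) x v =
      (∫ x in halfPlane, fderiv ℝ φ x v • spin (u₁ x) (u₂ x)) +
        ∫ x in halfPlane, φ x • spin (fderiv ℝ u₁ x v) (fderiv ℝ u₂ x v) := by
  simp only [fderiv_smul_spin h₁ h₂ hφ]
  exact integral_add (integrable_smul_spin (continuous_fderiv_apply hφ v) (hasCompactSupport_fderiv_apply hs v)
    h₁.continuous h₂.continuous).integrableOn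
    (integrable_smul_spin hφ.continuous hs (h₁.fderiv v).continuous
      (h₂.fderiv v).continuous).integrableOn

theorem differentiable_smul_spin (h₁ : Nice u₁) (h₂ : Nice u₂) {φ : ℝ × ℝ → ℝ}
    (hφ : ContDiff ℝ ∞ φ) : Differentiable ℝ fun x => φ x • spin (u₁ x) (u₂ x) :=
  (hφ.differentiable (by simp)).smul fun x => (hasFDerivAt_spin h₁ h₂ x).differentiableAt

theorem isTrace_spinL2 (h₁ : Nice u₁) (h₂ : Nice u₂) :
    IsTrace (spinL2 h₁.memLp h₂.memLp) (spinL2 (h₁.fderiv (0, 1)).memLp (h₂.fderiv (0, 1)).memLp)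
      (spinL2 h₁.memLp_slice h₂.memLp_slice) := by
  intro φ hφ hs
  rw [setIntegral_smul_spinL2, setIntegral_smul_spinL2, ← setIntegral_fderiv_smul_spin h₁ h₂ hφ hs,
    setIntegral_halfPlane_fderiv_snd (differentiable_smul_spin h₁ h₂ hφ)
      (integrable_smul_spin hφ.continuous hs h₁.continuous h₂.continuous).integrableOn
      (integrable_fderiv_smul_spin h₁ h₂ hφ hs _).integrableOn]
  congr 1
  refine integral_congr_ae ?_
  filter_upwards [coeFn_spinL2 h₁.memLp_slice h₂.memLp_slice] with s hx
  rw [hx]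

theorem isWeakDeriv_fst_spinL2 (h₁ : Nice u₁) (h₂ : Nice u₂) :
    IsWeakDeriv (1, 0) (spinL2 h₁.memLp h₂.memLp)
      (spinL2 (h₁.fderiv (1, 0)).memLp (h₂.fderiv (1, 0)).memLp) := by
  intro φ hφ hs _
  rw [setIntegral_smul_spinL2, setIntegral_smul_spinL2, ← add_eq_zero_iff_eq_neg,
    ← setIntegral_fderiv_smul_spin h₁ h₂ hφ hs,
    setIntegral_halfPlane_fderiv_fst (differentiable_smul_spin h₁ h₂ hφ)
      (integrable_smul_spin hφ.continuous hs h₁.continuous h₂.continuous).integrableOn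
      (integrable_fderiv_smul_spin h₁ h₂ hφ hs _).integrableOn]

theorem IsTrace.isWeakDeriv {u d : L2Spinor} {τ : Lp Spinor 2 (volume : Measure ℝ)}
    (h : IsTrace u d τ) : IsWeakDeriv (0, 1) u d := by
  intro φ hφ hs ht
  rw [← add_eq_zero_iff_eq_neg, h φ hφ hs]
  have : ∀ s : ℝ, φ (s, 0) = 0 := fun s => by
    by_contra hne
    exact lt_irrefl (0 : ℝ) (ht (subset_tsupport φ hne))
  simp [this]

end WeakDerivative

/-! ### Density of test functions -/

/-- Pairs of test functions in the open half-plane. -/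
structure IsTestPair (f₁ f₂ : ℝ × ℝ → ℂ) : Prop where
  test₁ : IsTest f₁
  test₂ : IsTest f₂
  supp₁ : ∀ x : ℝ × ℝ, x.2 ≤ 0 → f₁ x = 0
  supp₂ : ∀ x : ℝ × ℝ, x.2 ≤ 0 → f₂ x = 0

/-- The element of `L²` given by a pair of test functions. -/
def IsTestPair.toL2 {f₁ f₂ : ℝ × ℝ → ℂ} (h : IsTestPair f₁ f₂) : L2Spinor :=
  spinL2 h.test₁.nice.memLp h.test₂.nice.memLp

theorem IsTest.zero : IsTest fun _ => 0 := ⟨contDiff_const, HasCompactSupport.zero⟩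

theorem IsTest.add {f g : ℝ × ℝ → ℂ} (hf : IsTest f) (hg : IsTest g) : IsTest fun x => f x + g x :=
  ⟨hf.1.add hg.1, hf.2.add hg.2⟩

theorem IsTest.const_mul {f : ℝ × ℝ → ℂ} (hf : IsTest f) (z : ℂ) : IsTest fun x => z * f x :=
  ⟨contDiff_const.mul hf.1, hf.2.mul_left⟩

/-- The subspace of test functions in the open half-plane. -/
def testSubspace : Submodule ℂ L2Spinor where
  carrier := {f | ∃ (f₁ f₂ : ℝ × ℝ → ℂ) (h : IsTestPair f₁ f₂), f = h.toL2}
  zero_mem' := by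
    refine ⟨_, _, ⟨IsTest.zero, IsTest.zero, fun _ _ => rfl, fun _ _ => rfl⟩, ?_⟩
    refine Lp.ext ?_
    filter_upwards [Lp.coeFn_zero Spinor 2 volHalf,
      coeFn_spinL2 IsTest.zero.nice.memLp IsTest.zero.nice.memLp] with x h1 h2
    rw [h1, IsTestPair.toL2, h2]
    exact spinor_ext rfl rfl
  add_mem' := by
    rintro _ _ ⟨f₁, f₂, hf, rfl⟩ ⟨g₁, g₂, hg, rfl⟩
    have h : IsTestPair (fun x => f₁ x + g₁ x) (fun x => f₂ x + g₂ x) :=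
      ⟨hf.test₁.add hg.test₁, hf.test₂.add hg.test₂,
        fun x hx => by rw [hf.supp₁ x hx, hg.supp₁ x hx, add_zero],
        fun x hx => by rw [hf.supp₂ x hx, hg.supp₂ x hx, add_zero]⟩
    refine ⟨_, _, h, ?_⟩
    rw [IsTestPair.toL2, IsTestPair.toL2, IsTestPair.toL2, spinL2, spinL2, spinL2, ← MemLp.toLp_add]
    congr 1
    funext x
    exact spinor_ext (by simp) (by simp)
  smul_mem' := by
    rintro z _ ⟨f₁, f₂, hf, rfl⟩
    have h : IsTestPair (fun x => z * f₁ x) (fun x => z * f₂ x) :=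
      ⟨hf.test₁.const_mul z, hf.test₂.const_mul z,
        fun x hx => by rw [hf.supp₁ x hx, mul_zero], fun x hx => by rw [hf.supp₂ x hx, mul_zero]⟩
    refine ⟨_, _, h, ?_⟩
    rw [IsTestPair.toL2, IsTestPair.toL2, spinL2, spinL2, ← MemLp.toLp_const_smul]
    congr 1
    funext x
    exact spinor_ext (by simp) (by simp)

theorem IsTestPair.mem {f₁ f₂ : ℝ × ℝ → ℂ} (h : IsTestPair f₁ f₂) : h.toL2 ∈ testSubspace :=
  ⟨f₁, f₂, h, rfl⟩

theorem inner_spin (a b : ℂ) (v : Spinor) :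
    inner ℂ (spin a b) v = (starRingEnd ℂ) a * v 0 + (starRingEnd ℂ) b * v 1 := by
  simp [PiLp.inner_apply, Fin.sum_univ_two, mul_comm]

theorem IsTestPair.inner_toL2 {f₁ f₂ : ℝ × ℝ → ℂ} (h : IsTestPair f₁ f₂) (g : L2Spinor) :
    inner ℂ h.toL2 g = ∫ x in halfPlane,
      ((starRingEnd ℂ) (f₁ x) * g x 0 + (starRingEnd ℂ) (f₂ x) * g x 1) := by
  rw [L2.inner_def]
  refine integral_congr_ae ?_
  filter_upwards [coeFn_spinL2 h.test₁.nice.memLp h.test₂.nice.memLp] with x hx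
  rw [IsTestPair.toL2, hx, inner_spin]

theorem eq_zero_of_inner_testSubspace {g : L2Spinor}
    (h : ∀ (f₁ f₂ : ℝ × ℝ → ℂ) (hf : IsTestPair f₁ f₂), inner ℂ hf.toL2 g = 0) : g = 0 := by
  have supp : ∀ {φ : ℝ × ℝ → ℝ}, tsupport φ ⊆ halfPlane → ∀ x : ℝ × ℝ, x.2 ≤ 0 → (φ x : ℂ) = 0 := by
    intro φ ht x hx
    by_contra hne
    exact absurd (ht (subset_tsupport φ fun e => hne (by rw [e, Complex.ofReal_zero])))
      (not_lt.2 hx)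
  have test : ∀ {φ : ℝ × ℝ → ℝ}, ContDiff ℝ ∞ φ → HasCompactSupport φ →
      IsTest fun x => (φ x : ℂ) := fun hφ hs =>
    ⟨Complex.ofRealCLM.contDiff.comp hφ, hs.comp_left (g := fun r : ℝ => (r : ℂ)) rfl⟩
  have key : ∀ j : Fin 2, ∀ᵐ x ∂volHalf, x ∈ halfPlane → g x j = 0 := fun j => by
    refine isOpen_halfPlane.ae_eq_zero_of_integral_contDiff_smul_eq_zero
      (((memLp_component g j).locallyIntegrable (by norm_num)).locallyIntegrableOn _) ?_
    intro φ hφ hs ht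
    fin_cases j
    · have := h _ _ ⟨test hφ hs, IsTest.zero, supp ht, fun _ _ => rfl⟩
      rw [IsTestPair.inner_toL2] at this
      simpa using this
    · have := h _ _ ⟨IsTest.zero, test hφ hs, fun _ _ => rfl, supp ht⟩
      rw [IsTestPair.inner_toL2] at this
      simpa using this
  refine Lp.ext ?_
  filter_upwards [key 0, key 1, ae_restrict_mem measurableSet_halfPlane,
    Lp.coeFn_zero Spinor 2 volHalf] with x h0 h1 hx hz
  rw [hz]
  exact spinor_ext (h0 hx) (h1 hx)

theorem dense_testSubspace : Dense (testSubspace : Set L2Spinor) := by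
  rw [Submodule.dense_iff_topologicalClosure_eq_top, Submodule.topologicalClosure_eq_top_iff,
    Submodule.eq_bot_iff]
  exact fun g hg => eq_zero_of_inner_testSubspace fun f₁ f₂ hf =>
    (Submodule.mem_orthogonal _ _).1 hg _ hf.mem

/-! ### Energy identities -/

theorem Nice.integrable_mul {a b : ℝ × ℝ → ℂ} (ha : Nice a) (hb : Nice b) :
    Integrable fun x => a x * b x :=
  (ha.expDecay.mul hb.expDecay).integrable (ha.continuous.mul hb.continuous).aestronglyMeasurable

theorem fderiv_mul_apply {a b : ℝ × ℝ → ℂ} (ha : Nice a) (hb : Nice b) (x v : ℝ × ℝ) :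
    fderiv ℝ (fun x => a x * b x) x v = a x * fderiv ℝ b x v + fderiv ℝ a x v * b x := by
  rw [fderiv_fun_mul (ha.differentiable x) (hb.differentiable x)]
  simp [mul_comm]

theorem fderiv_conj_apply {u : ℝ × ℝ → ℂ} (hu : Nice u) (x v : ℝ × ℝ) :
    fderiv ℝ (fun x => (starRingEnd ℂ) (u x)) x v = (starRingEnd ℂ) (fderiv ℝ u x v) := by
  have := (Complex.conjCLE.toContinuousLinearMap.hasFDerivAt.comp x
    (hu.differentiable x).hasFDerivAt).fderiv
  rw [Function.comp_def] at this
  exact congrArg (fun L : ℝ × ℝ →L[ℝ] ℂ => L v) this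

theorem Nice.setIntegral_fderiv_fst_mul {a b : ℝ × ℝ → ℂ} (ha : Nice a) (hb : Nice b) :
    ∫ x in halfPlane, (a x * _root_.fderiv ℝ b x (1, 0) + _root_.fderiv ℝ a x (1, 0) * b x) = 0 := by
  have h := setIntegral_halfPlane_fderiv_fst (F := fun x => a x * b x)
    (ha.differentiable.mul hb.differentiable) (ha.integrable_mul hb).integrableOn
  simp only [fderiv_mul_apply ha hb] at h
  exact h ((ha.integrable_mul (hb.fderiv _)).add ((ha.fderiv _).integrable_mul hb)).integrableOn

theorem Nice.setIntegral_fderiv_snd_mul {a b : ℝ × ℝ → ℂ} (ha : Nice a) (hb : Nice b) :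
    ∫ x in halfPlane, (a x * _root_.fderiv ℝ b x (0, 1) + _root_.fderiv ℝ a x (0, 1) * b x) =
      -∫ s : ℝ, a (s, 0) * b (s, 0) := by
  have h := setIntegral_halfPlane_fderiv_snd (F := fun x => a x * b x)
    (ha.differentiable.mul hb.differentiable) (ha.integrable_mul hb).integrableOn
  simp only [fderiv_mul_apply ha hb] at h
  exact h ((ha.integrable_mul (hb.fderiv _)).add ((ha.fderiv _).integrable_mul hb)).integrableOn

theorem Nice.fderiv_comm {u : ℝ × ℝ → ℂ} (hu : Nice u) (x v w : ℝ × ℝ) :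
    _root_.fderiv ℝ (fun x => _root_.fderiv ℝ u x v) x w = _root_.fderiv ℝ (fun x => _root_.fderiv ℝ u x w) x v := by
  have hd : DifferentiableAt ℝ (_root_.fderiv ℝ u) x :=
    (hu.contDiff.fderiv_right (m := 1) (by norm_cast)).differentiable (by simp) x
  have hs : IsSymmSndFDerivAt ℝ u x := hu.contDiff.contDiffAt.isSymmSndFDerivAt
    (by
      rw [minSmoothness_of_isRCLikeNormedField]
      exact WithTop.coe_le_coe.2 (le_top (a := (2 : ℕ∞))))
  rw [fderiv_clm_apply hd (differentiableAt_const v), fderiv_clm_apply hd (differentiableAt_const w)]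
  simpa using hs w v

/-- The square of the `L²` norm on the half-plane. -/
def energy (w : ℝ × ℝ → ℂ) : ℝ := ∫ x in halfPlane, ‖w x‖ ^ 2

theorem energy_nonneg (w : ℝ × ℝ → ℂ) : 0 ≤ energy w := integral_nonneg fun x => by positivity

theorem ofReal_energy (w : ℝ × ℝ → ℂ) :
    (energy w : ℂ) = ∫ x in halfPlane, w x * (starRingEnd ℂ) (w x) := by
  rw [energy, ← integral_complex_ofReal]
  congr 1
  funext x
  rw [Complex.mul_conj']
  push_cast
  rfl

/-- The boundary term `∫ w conj(∂₁ w)`. -/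
def boundaryForm (w : ℝ × ℝ → ℂ) : ℂ :=
  ∫ s : ℝ, w (s, 0) * (starRingEnd ℂ) (fderiv ℝ w (s, 0) (1, 0))

/-- The integrand is ∂₂(w conj ∂₁w) - ∂₁(w conj ∂₂w), the mixed second derivatives cancelling. Only
the first term leaves a boundary contribution. -/
theorem Nice.setIntegral_null_form {w : ℝ × ℝ → ℂ} (hw : Nice w) :
    ∫ x in halfPlane, ((starRingEnd ℂ) (_root_.fderiv ℝ w x (1, 0)) * _root_.fderiv ℝ w x (0, 1) -
      _root_.fderiv ℝ w x (1, 0) * (starRingEnd ℂ) (_root_.fderiv ℝ w x (0, 1))) = -boundaryForm w := by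
  have h1 := hw.setIntegral_fderiv_fst_mul (hw.fderiv (0, 1)).conj
  have h2 := hw.setIntegral_fderiv_snd_mul (hw.fderiv (1, 0)).conj
  rw [boundaryForm, ← h2, ← sub_zero (∫ x in halfPlane, _ + _), ← h1, ← integral_sub]
  · congr 1
    funext x
    rw [fderiv_conj_apply (hw.fderiv _), fderiv_conj_apply (hw.fderiv _),
      hw.fderiv_comm x (0, 1) (1, 0)]
    ring
  · exact ((hw.integrable_mul ((hw.fderiv _).conj.fderiv _)).add
      ((hw.fderiv _).integrable_mul (hw.fderiv _).conj)).integrableOn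
  · exact ((hw.integrable_mul ((hw.fderiv _).conj.fderiv _)).add
      ((hw.fderiv _).integrable_mul (hw.fderiv _).conj)).integrableOn

theorem nice_dirac {w : ℝ × ℝ → ℂ} (hw : Nice w) (ε : ℂ) : Nice (dirac ε w) :=
  ((hw.fderiv _).const_mul _).add ((hw.fderiv _).const_mul _)

/-- In the expansion of |-i∂₁w + ε∂₂w|² the cross term is iε times the null form, hence a pure
boundary term. -/
theorem Nice.energy_dirac {w : ℝ × ℝ → ℂ} (hw : Nice w) {ε : ℝ} (hε : ε ^ 2 = 1) :
    (energy (dirac ε w) : ℂ) = energy (fun x => _root_.fderiv ℝ w x (1, 0)) +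
      energy (fun x => _root_.fderiv ℝ w x (0, 1)) - ε * Complex.I * boundaryForm w := by
  have i1 := ((hw.fderiv (1, 0)).integrable_mul (hw.fderiv (1, 0)).conj).integrableOn (s := halfPlane)
  have i2 := ((hw.fderiv (0, 1)).integrable_mul (hw.fderiv (0, 1)).conj).integrableOn (s := halfPlane)
  have i3 := ((hw.fderiv (1, 0)).conj.integrable_mul (hw.fderiv (0, 1))).integrableOn
    (s := halfPlane)
  have i4 := ((hw.fderiv (1, 0)).integrable_mul (hw.fderiv (0, 1)).conj).integrableOn (s := halfPlane)
  have i12 : IntegrableOn (fun x => _root_.fderiv ℝ w x (1, 0) * (starRingEnd ℂ) (_root_.fderiv ℝ w x (1, 0)) +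
      _root_.fderiv ℝ w x (0, 1) * (starRingEnd ℂ) (_root_.fderiv ℝ w x (0, 1))) halfPlane := i1.add i2
  have i34 : IntegrableOn (fun x => ε * Complex.I *
      ((starRingEnd ℂ) (_root_.fderiv ℝ w x (1, 0)) * _root_.fderiv ℝ w x (0, 1) -
        _root_.fderiv ℝ w x (1, 0) * (starRingEnd ℂ) (_root_.fderiv ℝ w x (0, 1)))) halfPlane :=
    (i3.sub i4).const_mul _
  rw [sub_eq_add_neg, ← mul_neg, ← hw.setIntegral_null_form, ofReal_energy, ofReal_energy,
    ofReal_energy, ← integral_const_mul, ← integral_add i1 i2, ← integral_add i12 i34]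
  congr 1
  funext x
  have hε' : (ε : ℂ) ^ 2 = 1 := by exact_mod_cast hε
  simp only [dirac, map_add, map_mul, map_neg, Complex.conj_I, Complex.conj_ofReal]
  linear_combination (-(_root_.fderiv ℝ w x (1, 0) * (starRingEnd ℂ) (_root_.fderiv ℝ w x (1, 0)))) *
    Complex.I_sq + _root_.fderiv ℝ w x (0, 1) * (starRingEnd ℂ) (_root_.fderiv ℝ w x (0, 1)) * hε'

/-- Rapidly decaying spinors that satisfy the boundary condition. -/
structure BoundaryPair (γ : ℝ) (u₁ u₂ : ℝ × ℝ → ℂ) : Prop where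
  nice₁ : Nice u₁
  nice₂ : Nice u₂
  boundary : ∀ s : ℝ, u₂ (s, 0) = γ * u₁ (s, 0)

theorem ClassicalSol.boundaryPair {γ lam : ℝ} {f₁ f₂ u₁ u₂ : ℝ × ℝ → ℂ}
    (h : ClassicalSol γ lam f₁ f₂ u₁ u₂) : BoundaryPair γ u₁ u₂ :=
  ⟨h.nice₁, h.nice₂, h.boundary⟩

namespace BoundaryPair

variable {γ : ℝ} {u₁ u₂ w₁ w₂ : ℝ × ℝ → ℂ}

/-- The boundary condition may be differentiated along the boundary, so each of the two factors of
the form contributes one γ. -/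
theorem boundaryForm_eq (h : BoundaryPair γ u₁ u₂) :
    boundaryForm u₂ = γ ^ 2 * boundaryForm u₁ := by
  rw [boundaryForm, boundaryForm, ← integral_const_mul]
  congr 1
  funext s
  have h1 := hasDerivAt_slice_fst h.nice₂.differentiable s 0
  have h2 := (hasDerivAt_slice_fst h.nice₁.differentiable s 0).const_mul (γ : ℂ)
  simp only [h.boundary] at h1
  rw [h1.unique h2, h.boundary, map_mul, Complex.conj_ofReal]
  ring

/-- The two components enter with opposite ε, and the weight γ² on the first makes the boundary
terms cancel. This is the source of H¹ regularity, with constants that degenerate as γ → 0 or γ → ∞.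
-/
theorem energy_identity (h : BoundaryPair γ u₁ u₂) :
    γ ^ 2 * energy (dirac 1 u₁) + energy (dirac (-1) u₂) =
      γ ^ 2 * (energy (fun x => fderiv ℝ u₁ x (1, 0)) + energy (fun x => fderiv ℝ u₁ x (0, 1))) +
      (energy (fun x => fderiv ℝ u₂ x (1, 0)) + energy (fun x => fderiv ℝ u₂ x (0, 1))) := by
  have h1 := h.nice₁.energy_dirac (ε := 1) (by norm_num)
  have h2 := h.nice₂.energy_dirac (ε := -1) (by norm_num)
  rw [h.boundaryForm_eq] at h2
  have : ((γ ^ 2 * energy (dirac 1 u₁) + energy (dirac (-1) u₂) : ℝ) : ℂ) =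
      ((γ ^ 2 * (energy (fun x => fderiv ℝ u₁ x (1, 0)) + energy (fun x => fderiv ℝ u₁ x (0, 1))) +
      (energy (fun x => fderiv ℝ u₂ x (1, 0)) + energy (fun x => fderiv ℝ u₂ x (0, 1))) : ℝ) : ℂ) := by
    push_cast at h1 h2 ⊢
    rw [h1, h2]
    ring
  exact_mod_cast this

/-- The element of `L²`. -/
def toL2 (h : BoundaryPair γ u₁ u₂) : L2Spinor := spinL2 h.nice₁.memLp h.nice₂.memLp

/-- The derivative in direction `v` as an element of `L²`. -/
def derivL2 (h : BoundaryPair γ u₁ u₂) (v : ℝ × ℝ) : L2Spinor :=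
  spinL2 (h.nice₁.fderiv v).memLp (h.nice₂.fderiv v).memLp

/-- The trace as an element of `L²`. -/
def traceL2 (h : BoundaryPair γ u₁ u₂) : Lp Spinor 2 (volume : Measure ℝ) :=
  spinL2 h.nice₁.memLp_slice h.nice₂.memLp_slice

/-- The image under the Dirac operator as an element of `L²`. -/
def diracL2 (h : BoundaryPair γ u₁ u₂) : L2Spinor :=
  spinL2 (nice_dirac h.nice₂ (-1)).memLp (nice_dirac h.nice₁ 1).memLp

/-- Removing the weights from the energy identity costs (1 + γ)² on one side and (1 + γ⁻¹)² on the
other. The numbers `a` and `b` stand for the energies of either partial derivative. -/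
theorem energy_le (hγ : 0 < γ) (h : BoundaryPair γ u₁ u₂) {a b : ℝ} (ha : 0 ≤ a) (hb : 0 ≤ b)
    (ha' : a ≤ energy (fun x => fderiv ℝ u₁ x (1, 0)) + energy (fun x => fderiv ℝ u₁ x (0, 1)))
    (hb' : b ≤ energy (fun x => fderiv ℝ u₂ x (1, 0)) + energy (fun x => fderiv ℝ u₂ x (0, 1))) :
    a + b ≤ ((1 + γ⁻¹) * (1 + γ)) ^ 2 * (energy (dirac (-1) u₂) + energy (dirac 1 u₁)) := by
  have key := h.energy_identity
  set Q := energy (dirac (-1) u₂) + energy (dirac 1 u₁)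
  have e1 := energy_nonneg (dirac (-1) u₂)
  have e2 := energy_nonneg (dirac 1 u₁)
  have hQ : γ ^ 2 * a + b ≤ (1 + γ) ^ 2 * Q := by
    have h1 : γ ^ 2 * a + b ≤ γ ^ 2 * energy (dirac 1 u₁) + energy (dirac (-1) u₂) := by
      rw [key]
      gcongr
    have : γ ^ 2 * energy (dirac 1 u₁) + energy (dirac (-1) u₂) ≤ (1 + γ) ^ 2 * Q := by
      simp only [Q]
      nlinarith [mul_nonneg hγ.le e1, mul_nonneg hγ.le e2, mul_nonneg (sq_nonneg γ) e1]
    exact h1.trans this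
  have hab : a + b ≤ (1 + γ⁻¹) ^ 2 * (γ ^ 2 * a + b) := by
    have hg : γ⁻¹ * γ = 1 := inv_mul_cancel₀ hγ.ne'
    have : (1 + γ⁻¹) ^ 2 * (γ ^ 2 * a + b) = (γ + γ⁻¹ * γ) ^ 2 * a + (1 + γ⁻¹) ^ 2 * b := by ring
    rw [this, hg]
    have hi : 0 < γ⁻¹ := inv_pos.2 hγ
    nlinarith [mul_nonneg hγ.le ha, mul_nonneg (sq_nonneg γ) ha, mul_nonneg hi.le hb,
      mul_nonneg (sq_nonneg γ⁻¹) hb]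
  calc a + b ≤ (1 + γ⁻¹) ^ 2 * ((1 + γ) ^ 2 * Q) :=
        hab.trans (mul_le_mul_of_nonneg_left hQ (sq_nonneg _))
    _ = _ := by ring

theorem norm_sq_diracL2 (h : BoundaryPair γ u₁ u₂) :
    ‖h.diracL2‖ ^ 2 = energy (dirac (-1) u₂) + energy (dirac 1 u₁) := norm_sq_spinL2 _ _

theorem norm_derivL2_fst_le (hγ : 0 < γ) (h : BoundaryPair γ u₁ u₂) :
    ‖h.derivL2 (1, 0)‖ ≤ (1 + γ⁻¹) * (1 + γ) * ‖h.diracL2‖ := by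
  refine le_of_sq_le_sq ?_ (by positivity)
  rw [mul_pow, h.norm_sq_diracL2, derivL2, norm_sq_spinL2]
  exact h.energy_le hγ (energy_nonneg _) (energy_nonneg _)
    (le_add_of_nonneg_right (energy_nonneg _)) (le_add_of_nonneg_right (energy_nonneg _))

theorem norm_derivL2_snd_le (hγ : 0 < γ) (h : BoundaryPair γ u₁ u₂) :
    ‖h.derivL2 (0, 1)‖ ≤ (1 + γ⁻¹) * (1 + γ) * ‖h.diracL2‖ := by
  refine le_of_sq_le_sq ?_ (by positivity)
  rw [mul_pow, h.norm_sq_diracL2, derivL2, norm_sq_spinL2]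
  exact h.energy_le hγ (energy_nonneg _) (energy_nonneg _)
    (le_add_of_nonneg_left (energy_nonneg _)) (le_add_of_nonneg_left (energy_nonneg _))

end BoundaryPair

theorem Nice.integrable_norm_sq {u : ℝ × ℝ → ℂ} (hu : Nice u) :
    IntegrableOn (fun x => ‖u x‖ ^ 2) halfPlane :=
  (memLp_two_iff_integrable_sq_norm hu.memLp.1).1 hu.memLp

/-- The trace inequality: the boundary integral is -∫ ∂₂|u|², and 2|u||∂₂u| ≤ |u|² + |∂₂u|². -/
theorem Nice.integral_slice_norm_sq_le {u : ℝ × ℝ → ℂ} (hu : Nice u) :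
    ∫ s : ℝ, ‖u (s, 0)‖ ^ 2 ≤ energy u + energy (fun x => _root_.fderiv ℝ u x (0, 1)) := by
  have h := hu.setIntegral_fderiv_snd_mul hu.conj
  have e : ((∫ s : ℝ, ‖u (s, 0)‖ ^ 2 : ℝ) : ℂ) = ∫ s : ℝ, u (s, 0) * (starRingEnd ℂ) (u (s, 0)) := by
    rw [← integral_complex_ofReal]
    congr 1
    funext s
    rw [Complex.mul_conj']
    push_cast
    rfl
  have hn : ∫ s : ℝ, ‖u (s, 0)‖ ^ 2 = ‖∫ s : ℝ, u (s, 0) * (starRingEnd ℂ) (u (s, 0))‖ := by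
    rw [← e, Complex.norm_real, Real.norm_of_nonneg (integral_nonneg fun s => by positivity)]
  rw [hn, ← norm_neg, ← h, energy, energy,
    ← integral_add hu.integrable_norm_sq (hu.fderiv _).integrable_norm_sq]
  refine norm_integral_le_of_norm_le
    (hu.integrable_norm_sq.add (hu.fderiv (0, 1)).integrable_norm_sq)
    (Eventually.of_forall fun x => (norm_add_le _ _).trans ?_)
  rw [fderiv_conj_apply hu, norm_mul, norm_mul, RCLike.norm_conj, RCLike.norm_conj]
  nlinarith [sq_nonneg (‖u x‖ - ‖_root_.fderiv ℝ u x (0, 1)‖)]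

namespace BoundaryPair

variable {γ : ℝ} {u₁ u₂ w₁ w₂ : ℝ × ℝ → ℂ}

theorem norm_traceL2_le (h : BoundaryPair γ u₁ u₂) :
    ‖h.traceL2‖ ≤ ‖h.toL2‖ + ‖h.derivL2 (0, 1)‖ := by
  refine le_of_sq_le_sq ?_ (by positivity)
  have h1 : ‖h.traceL2‖ ^ 2 ≤ ‖h.toL2‖ ^ 2 + ‖h.derivL2 (0, 1)‖ ^ 2 := by
    rw [traceL2, toL2, derivL2, norm_sq_spinL2, norm_sq_spinL2, norm_sq_spinL2]
    have e1 := h.nice₁.integral_slice_norm_sq_le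
    have e2 := h.nice₂.integral_slice_norm_sq_le
    simp only [energy] at e1 e2
    linarith
  nlinarith [norm_nonneg h.toL2, norm_nonneg (h.derivL2 (0, 1))]

theorem sub (h : BoundaryPair γ u₁ u₂) (h' : BoundaryPair γ w₁ w₂) :
    BoundaryPair γ (fun x => u₁ x - w₁ x) fun x => u₂ x - w₂ x :=
  ⟨h.nice₁.sub h'.nice₁, h.nice₂.sub h'.nice₂, fun s => by
    simp only [h.boundary, h'.boundary]; ring⟩

theorem toL2_sub (h : BoundaryPair γ u₁ u₂) (h' : BoundaryPair γ w₁ w₂) :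
    (h.sub h').toL2 = h.toL2 - h'.toL2 := spinL2_sub _ _ _ _

theorem traceL2_sub (h : BoundaryPair γ u₁ u₂) (h' : BoundaryPair γ w₁ w₂) :
    (h.sub h').traceL2 = h.traceL2 - h'.traceL2 := spinL2_sub _ _ _ _

theorem fderiv_sub_apply {u w : ℝ × ℝ → ℂ} (hu : Nice u) (hw : Nice w) (x v : ℝ × ℝ) :
    fderiv ℝ (fun x => u x - w x) x v = fderiv ℝ u x v - fderiv ℝ w x v := by
  rw [fderiv_fun_sub (hu.differentiable x) (hw.differentiable x)]
  rfl

theorem derivL2_sub (h : BoundaryPair γ u₁ u₂) (h' : BoundaryPair γ w₁ w₂) (v : ℝ × ℝ) :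
    (h.sub h').derivL2 v = h.derivL2 v - h'.derivL2 v := by
  rw [derivL2, derivL2, derivL2, ← spinL2_sub]
  simp only [fderiv_sub_apply h.nice₁ h'.nice₁, fderiv_sub_apply h.nice₂ h'.nice₂]

theorem diracL2_sub (h : BoundaryPair γ u₁ u₂) (h' : BoundaryPair γ w₁ w₂) :
    (h.sub h').diracL2 = h.diracL2 - h'.diracL2 := by
  rw [diracL2, diracL2, diracL2, ← spinL2_sub]
  congr 1 <;>
  · funext x
    simp only [dirac, fderiv_sub_apply h.nice₁ h'.nice₁, fderiv_sub_apply h.nice₂ h'.nice₂]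
    ring

end BoundaryPair

/-! ### The resolvent maps into the domain -/

theorem exists_tendsto_of_norm_sub_le {E F : Type*} [NormedAddCommGroup E] [NormedAddCommGroup F]
    [CompleteSpace F] {a : ℕ → E} {b : ℕ → F} (ha : CauchySeq a) {C : ℝ}
    (h : ∀ m n, ‖b m - b n‖ ≤ C * ‖a m - a n‖) : ∃ l, Tendsto b atTop (𝓝 l) := by
  refine cauchySeq_tendsto_of_complete (Metric.cauchySeq_iff.2 fun ε hε => ?_)
  obtain ⟨N, hN⟩ := Metric.cauchySeq_iff.1 ha (ε / (|C| + 1)) (by positivity)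
  refine ⟨N, fun m hm n hn => ?_⟩
  have h1 := hN m hm n hn
  rw [dist_eq_norm, lt_div_iff₀ (by positivity)] at h1
  rw [dist_eq_norm]
  refine (h m n).trans_lt (lt_of_le_of_lt ?_ h1)
  nlinarith [le_abs_self C, norm_nonneg (a m - a n)]

theorem continuous_integral_smul {α : Type*} [MeasurableSpace α] {μ : Measure α} {ψ : α → ℝ}
    (hψ : MemLp ψ 2 μ) : Continuous fun u : Lp Spinor 2 μ => ∫ x, ψ x • u x ∂μ := by
  have h := ((ContinuousLinearMap.lpPairing μ 2 2 (ContinuousLinearMap.lsmul ℝ ℝ (E := Spinor)))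
    (hψ.toLp ψ)).continuous
  refine h.congr fun u => ?_
  rw [ContinuousLinearMap.lpPairing_eq_integral]
  refine integral_congr_ae ?_
  filter_upwards [hψ.coeFn_toLp] with x hx
  rw [hx]
  rfl

theorem memLp_of_hasCompactSupport {φ : ℝ × ℝ → ℝ} (hφ : Continuous φ) (hs : HasCompactSupport φ) :
    MemLp φ 2 volHalf :=
  (hφ.memLp_of_hasCompactSupport hs).restrict _

/-- Each test function imposes one equation between functionals that are continuous on L². The same
reason makes the trace relation closed. -/
theorem isClosed_isWeakDeriv (v : ℝ × ℝ) : IsClosed {p : L2Spinor × L2Spinor | IsWeakDeriv v p.1 p.2} := by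
  simp only [IsWeakDeriv, ofPred_forall]
  refine isClosed_iInter fun φ => isClosed_iInter fun hφ => isClosed_iInter fun hs =>
    isClosed_iInter fun _ => ?_
  exact isClosed_eq ((continuous_integral_smul (memLp_of_hasCompactSupport
      (continuous_fderiv_apply hφ v) (hasCompactSupport_fderiv_apply hs v))).comp continuous_fst)
    ((continuous_integral_smul (memLp_of_hasCompactSupport hφ.continuous hs)).comp
      continuous_snd).neg

theorem isClosed_isTrace :
    IsClosed {p : L2Spinor × L2Spinor × Lp Spinor 2 (volume : Measure ℝ) |
      IsTrace p.1 p.2.1 p.2.2} := by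
  simp only [IsTrace, ofPred_forall]
  refine isClosed_iInter fun φ => isClosed_iInter fun hφ => isClosed_iInter fun hs => ?_
  have hs0 : HasCompactSupport fun s : ℝ => φ (s, 0) :=
    hs.comp_isClosedEmbedding (Isometry.isClosedEmbedding (Isometry.of_dist_eq fun a b => by
      simp [Prod.dist_eq]))
  have hm : MemLp (fun s : ℝ => φ (s, 0)) 2 volume :=
    (hφ.continuous.comp (by fun_prop : Continuous fun s : ℝ => (s, (0 : ℝ)))).memLp_of_hasCompactSupport
      hs0
  exact isClosed_eq (((continuous_integral_smul (memLp_of_hasCompactSupport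
      (continuous_fderiv_apply hφ _) (hasCompactSupport_fderiv_apply hs _))).comp continuous_fst).add
    ((continuous_integral_smul (memLp_of_hasCompactSupport hφ.continuous hs)).comp
      (continuous_fst.comp continuous_snd)))
    ((continuous_integral_smul hm).comp (continuous_snd.comp continuous_snd)).neg

/-- The action of a matrix on spinors as a continuous linear map. -/
def actL (A : Matrix (Fin 2) (Fin 2) ℂ) : Spinor →L[ℂ] Spinor :=
  LinearMap.toContinuousLinearMap
    { toFun := act A
      map_add' := act_add A
      map_smul' := act_smul A }

@[simp] theorem actL_apply (A : Matrix (Fin 2) (Fin 2) ℂ) (v : Spinor) : actL A v = act A v := rfl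

/-- The differential expression `-i (σ₁ d₁ + σ₂ d₂)` on `L²`. -/
def diracExpr (d₁ d₂ : L2Spinor) : L2Spinor :=
  (-Complex.I) • ((actL σ₁).compLpL 2 volHalf d₁ + (actL σ₂).compLpL 2 volHalf d₂)

theorem continuous_diracExpr : Continuous fun p : L2Spinor × L2Spinor => diracExpr p.1 p.2 := by
  unfold diracExpr
  fun_prop

theorem coeFn_diracExpr (d₁ d₂ : L2Spinor) :
    diracExpr d₁ d₂ =ᵐ[volHalf] fun x => (-Complex.I) • (act σ₁ (d₁ x) + act σ₂ (d₂ x)) := by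
  filter_upwards [Lp.coeFn_smul (-Complex.I) ((actL σ₁).compLpL 2 volHalf d₁ +
    (actL σ₂).compLpL 2 volHalf d₂), Lp.coeFn_add ((actL σ₁).compLpL 2 volHalf d₁)
      ((actL σ₂).compLpL 2 volHalf d₂), (actL σ₁).coeFn_compLpL d₁, (actL σ₂).coeFn_compLpL d₂]
    with x h1 h2 h3 h4
  rw [diracExpr, h1, Pi.smul_apply, h2, Pi.add_apply, h3, h4]
  rfl

/-- The functional `v ↦ v₂ - γ v₁`. -/
def boundaryL (γ : ℝ) : Spinor →L[ℂ] ℂ :=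
  (EuclideanSpace.proj 1 : Spinor →L[ℂ] ℂ) - (γ : ℂ) • (EuclideanSpace.proj 0 : Spinor →L[ℂ] ℂ)

theorem compLpL_boundaryL_eq_zero_iff {γ : ℝ} (τ : Lp Spinor 2 (volume : Measure ℝ)) :
    (boundaryL γ).compLpL 2 volume τ = 0 ↔ ∀ᵐ s : ℝ, τ s 1 = (γ : ℂ) * τ s 0 := by
  rw [Lp.eq_zero_iff_ae_eq_zero]
  refine eventually_congr ?_
  filter_upwards [(boundaryL γ).coeFn_compLpL (p := 2) τ] with s hs
  rw [hs, ← sub_eq_zero (b := (γ : ℂ) * τ s 0)]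
  rfl

theorem BoundaryPair.diracExpr_eq {γ : ℝ} {u₁ u₂ : ℝ × ℝ → ℂ} (h : BoundaryPair γ u₁ u₂) :
    diracExpr (h.derivL2 (1, 0)) (h.derivL2 (0, 1)) = h.diracL2 := by
  refine Lp.ext ?_
  filter_upwards [coeFn_diracExpr (h.derivL2 (1, 0)) (h.derivL2 (0, 1)),
    coeFn_spinL2 (h.nice₁.fderiv (1, 0)).memLp (h.nice₂.fderiv (1, 0)).memLp,
    coeFn_spinL2 (h.nice₁.fderiv (0, 1)).memLp (h.nice₂.fderiv (0, 1)).memLp,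
    coeFn_spinL2 (nice_dirac h.nice₂ (-1)).memLp (nice_dirac h.nice₁ 1).memLp] with x h1 h2 h3 h4
  rw [h1, BoundaryPair.derivL2, BoundaryPair.derivL2, h2, h3, BoundaryPair.diracL2, h4]
  refine spinor_ext ?_ ?_
  · simp only [PiLp.smul_apply, PiLp.add_apply, act_apply, smul_eq_mul, spin_apply_zero,
      spin_apply_one, σ₁, σ₂, dirac, Matrix.of_apply, Matrix.cons_val_zero, Matrix.cons_val_one,
      Matrix.cons_val', Matrix.cons_val_fin_one]
    linear_combination (fderiv ℝ u₂ x (0, 1)) * Complex.I_sq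
  · simp only [PiLp.smul_apply, PiLp.add_apply, act_apply, smul_eq_mul, spin_apply_zero,
      spin_apply_one, σ₁, σ₂, dirac, Matrix.of_apply, Matrix.cons_val_zero, Matrix.cons_val_one,
      Matrix.cons_val', Matrix.cons_val_fin_one]
    linear_combination (-fderiv ℝ u₁ x (0, 1)) * Complex.I_sq

theorem ClassicalSol.diracL2_eq {γ lam : ℝ} {f₁ f₂ u₁ u₂ : ℝ × ℝ → ℂ}
    (h : ClassicalSol γ lam f₁ f₂ u₁ u₂) (hf : IsTestPair f₁ f₂) :
    h.boundaryPair.diracL2 = hf.toL2 + (Complex.I * (lam : ℂ)) • h.boundaryPair.toL2 := by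
  refine Lp.ext ?_
  filter_upwards [Lp.coeFn_add hf.toL2 ((Complex.I * (lam : ℂ)) • h.boundaryPair.toL2),
    Lp.coeFn_smul (Complex.I * (lam : ℂ)) h.boundaryPair.toL2,
    coeFn_spinL2 hf.test₁.nice.memLp hf.test₂.nice.memLp,
    coeFn_spinL2 h.nice₁.memLp h.nice₂.memLp,
    coeFn_spinL2 (nice_dirac h.nice₂ (-1)).memLp (nice_dirac h.nice₁ 1).memLp,
    ae_restrict_mem measurableSet_halfPlane] with x h1 h2 h3 h4 h5 hx
  rw [h1, Pi.add_apply, h2, Pi.smul_apply, IsTestPair.toL2, h3, BoundaryPair.toL2, h4,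
    BoundaryPair.diracL2, h5]
  have e1 := h.eq₁ x hx
  have e2 := h.eq₂ x hx
  refine spinor_ext ?_ ?_
  · simp only [PiLp.smul_apply, PiLp.add_apply, smul_eq_mul, spin_apply_zero, ← e1, dirac]
    ring
  · simp only [PiLp.smul_apply, PiLp.add_apply, smul_eq_mul, spin_apply_one, ← e2, dirac]
    ring

theorem IsIntegralKernel.apply_toL2 {R : L2Spinor →L[ℂ] L2Spinor}
    {K : ℝ × ℝ → ℝ × ℝ → Matrix (Fin 2) (Fin 2) ℂ} (hR : IsIntegralKernel R K) {γ : ℝ}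
    {f₁ f₂ u₁ u₂ : ℝ × ℝ → ℂ} (hf : IsTestPair f₁ f₂) (hu : BoundaryPair γ u₁ u₂)
    (hK : IsKernelIntegral K f₁ f₂ u₁ u₂) : R hf.toL2 = hu.toL2 := by
  refine Lp.ext ?_
  have hc := coeFn_spinL2 hf.test₁.nice.memLp hf.test₂.nice.memLp
  filter_upwards [hR hf.toL2, coeFn_spinL2 hu.nice₁.memLp hu.nice₂.memLp,
    ae_restrict_mem measurableSet_halfPlane] with x h1 h2 hx
  obtain ⟨hi, he⟩ := h1
  rw [he, BoundaryPair.toL2, h2]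
  have comp : ∀ j : Fin 2, (∫ x' in halfPlane, act (K x x') (hf.toL2 x')) j =
      ∫ x' in halfPlane, (K x x' j 0 * f₁ x' + K x x' j 1 * f₂ x') := fun j => by
    have := (EuclideanSpace.proj j : Spinor →L[ℂ] ℂ).integral_comp_comm hi
    refine this.symm.trans (integral_congr_ae ?_)
    filter_upwards [hc] with x' hx'
    refine (act_apply (K x x') (hf.toL2 x') j).trans ?_
    rw [IsTestPair.toL2, hx']
    rfl
  obtain ⟨k1, k2⟩ := hK x hx
  exact spinor_ext ((comp 0).trans k1.symm) ((comp 1).trans k2.symm)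

namespace BoundaryPair

variable {γ : ℝ} {u₁ u₂ w₁ w₂ : ℝ × ℝ → ℂ}

theorem norm_derivL2_fst_sub_le (hγ : 0 < γ) (h : BoundaryPair γ u₁ u₂)
    (h' : BoundaryPair γ w₁ w₂) : ‖h.derivL2 (1, 0) - h'.derivL2 (1, 0)‖ ≤
      (1 + γ⁻¹) * (1 + γ) * ‖h.diracL2 - h'.diracL2‖ := by
  have := (h.sub h').norm_derivL2_fst_le hγ
  rwa [derivL2_sub h h', diracL2_sub h h'] at this

theorem norm_derivL2_snd_sub_le (hγ : 0 < γ) (h : BoundaryPair γ u₁ u₂)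
    (h' : BoundaryPair γ w₁ w₂) : ‖h.derivL2 (0, 1) - h'.derivL2 (0, 1)‖ ≤
      (1 + γ⁻¹) * (1 + γ) * ‖h.diracL2 - h'.diracL2‖ := by
  have := (h.sub h').norm_derivL2_snd_le hγ
  rwa [derivL2_sub h h', diracL2_sub h h'] at this

theorem norm_traceL2_sub_le (h : BoundaryPair γ u₁ u₂)
    (h' : BoundaryPair γ w₁ w₂) : ‖h.traceL2 - h'.traceL2‖ ≤
      2 * ‖(h.toL2, h.derivL2 (0, 1)) - (h'.toL2, h'.derivL2 (0, 1))‖ := by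
  have := (h.sub h').norm_traceL2_le
  rw [derivL2_sub h h', traceL2_sub h h', toL2_sub h h'] at this
  rw [Prod.mk_sub_mk, Prod.norm_mk]
  linarith [le_max_left ‖h.toL2 - h'.toL2‖ ‖h.derivL2 (0, 1) - h'.derivL2 (0, 1)‖,
    le_max_right ‖h.toL2 - h'.toL2‖ ‖h.derivL2 (0, 1) - h'.derivL2 (0, 1)‖]

theorem compLpL_traceL2 (h : BoundaryPair γ u₁ u₂) :
    (boundaryL γ).compLpL 2 volume h.traceL2 = 0 := by
  refine (compLpL_boundaryL_eq_zero_iff _).2 ?_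
  filter_upwards [coeFn_spinL2 h.nice₁.memLp_slice h.nice₂.memLp_slice] with s hs
  rw [traceL2, hs]
  exact h.boundary s

/-- Limits of rapidly decaying functions in the graph norm lie in the graph. -/
theorem diracGraph_of_tendsto (hγ : 0 < γ) {u₁ u₂ : ℕ → ℝ × ℝ → ℂ}
    (b : ∀ n, BoundaryPair γ (u₁ n) (u₂ n)) {U F : L2Spinor}
    (tU : Tendsto (fun n => (b n).toL2) atTop (𝓝 U))
    (tF : Tendsto (fun n => (b n).diracL2) atTop (𝓝 F)) : DiracGraph γ U F := by
  -- Differences again satisfy the boundary condition, so the energy estimate makes both derivatives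
  -- Cauchy; the trace inequality then does the same for the traces.
  obtain ⟨d₁, t1⟩ := exists_tendsto_of_norm_sub_le (b := fun n => (b n).derivL2 (1, 0))
    tF.cauchySeq fun m n => norm_derivL2_fst_sub_le hγ (b m) (b n)
  obtain ⟨d₂, t2⟩ := exists_tendsto_of_norm_sub_le (b := fun n => (b n).derivL2 (0, 1))
    tF.cauchySeq fun m n => norm_derivL2_snd_sub_le hγ (b m) (b n)
  obtain ⟨τ, t3⟩ := exists_tendsto_of_norm_sub_le (b := fun n => (b n).traceL2)
    (tU.prodMk_nhds t2).cauchySeq fun m n => norm_traceL2_sub_le (b m) (b n)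
  have hw : IsWeakDeriv (1, 0) U d₁ :=
    (isClosed_isWeakDeriv (1, 0)).mem_of_tendsto (tU.prodMk_nhds t1)
      (Eventually.of_forall fun n => isWeakDeriv_fst_spinL2 (b n).nice₁ (b n).nice₂)
  have ht : IsTrace U d₂ τ :=
    isClosed_isTrace.mem_of_tendsto (tU.prodMk_nhds (t2.prodMk_nhds t3))
      (Eventually.of_forall fun n => isTrace_spinL2 (b n).nice₁ (b n).nice₂)
  refine ⟨d₁, d₂, τ, hw, ht.isWeakDeriv, ht, ?_, ?_⟩
  · rw [← compLpL_boundaryL_eq_zero_iff]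
    exact tendsto_nhds_unique ((((boundaryL γ).compLpL 2 volume).continuous.tendsto τ).comp t3)
      (tendsto_const_nhds.congr fun n => (compLpL_traceL2 (b n)).symm)
  · have : F = diracExpr d₁ d₂ :=
      tendsto_nhds_unique tF (((continuous_diracExpr.tendsto (d₁, d₂)).comp
        (t1.prodMk_nhds t2)).congr fun n => (b n).diracExpr_eq)
    rw [this]
    exact coeFn_diracExpr d₁ d₂

end BoundaryPair

/-- For test data the integral operator produces the classical solution. General data follow by
density, since both R f and its Dirac image f + iλ R f depend continuously on f. -/
theorem diracGraph_resolvent {γ lam : ℝ} (hγ : 0 < γ) (hlam : lam ≠ 0)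
    {R : L2Spinor →L[ℂ] L2Spinor} (hR : IsIntegralKernel R (diracKernel γ lam)) (f : L2Spinor) :
    DiracGraph γ (R f) (f + (Complex.I * (lam : ℂ)) • R f) := by
  obtain ⟨g, hg, hlim⟩ := mem_closure_iff_seq_limit.1 (dense_testSubspace f)
  choose f₁ f₂ hf hfeq using hg
  have hsol := fun n => exists_classicalSol hγ hlam (hf n).test₁ (hf n).test₂ (hf n).supp₁
    (hf n).supp₂
  choose u₁ u₂ hu hK using hsol
  have hU : ∀ n, R (g n) = (hu n).boundaryPair.toL2 := fun n => by
    rw [hfeq n]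
    exact hR.apply_toL2 (hf n) (hu n).boundaryPair (hK n)
  have tR : Tendsto (fun n => R (g n)) atTop (𝓝 (R f)) := (R.continuous.tendsto f).comp hlim
  refine BoundaryPair.diracGraph_of_tendsto hγ (fun n => (hu n).boundaryPair) (tR.congr hU) ?_
  refine (hlim.add (tR.const_smul (Complex.I * (lam : ℂ)))).congr fun n => ?_
  rw [hU n, hfeq n]
  exact ((hu n).diracL2_eq (hf n)).symm

/-! ### Green's formula against rapidly decaying functions -/

theorem integrable_mul_component {α : Type*} [MeasurableSpace α] {μ : Measure α} {w : α → ℂ}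
    (hw : MemLp w 2 μ) (u : Lp Spinor 2 μ) (j : Fin 2) : Integrable (fun x => w x * u x j) μ :=
  hw.integrable_mul (memLp_component u j)

theorem integral_smul_apply {α : Type*} [MeasurableSpace α] {μ : Measure α} {ψ : α → ℝ}
    (hψ : MemLp ψ 2 μ) (u : Lp Spinor 2 μ) (j : Fin 2) :
    (∫ x, ψ x • u x ∂μ) j = ∫ x, (ψ x : ℂ) * u x j ∂μ := by
  have hi : Integrable (fun x => ψ x • u x) μ :=
    memLp_one_iff_integrable.1 ((Lp.memLp u).smul hψ)
  refine ((EuclideanSpace.proj j : Spinor →L[ℂ] ℂ).integral_comp_comm hi).symm.trans ?_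
  congr 1

section Test

variable {w : ℝ × ℝ → ℂ}

theorem IsTest.re_im (hw : IsTest w) :
    (ContDiff ℝ ∞ (fun x => (w x).re) ∧ HasCompactSupport fun x => (w x).re) ∧
      ContDiff ℝ ∞ (fun x => (w x).im) ∧ HasCompactSupport fun x => (w x).im :=
  ⟨⟨Complex.reCLM.contDiff.comp hw.1, hw.2.comp_left (g := Complex.re) rfl⟩,
    Complex.imCLM.contDiff.comp hw.1, hw.2.comp_left (g := Complex.im) rfl⟩

theorem fderiv_re_im (hw : Differentiable ℝ w) (x v : ℝ × ℝ) :
    fderiv ℝ (fun x => (w x).re) x v = (fderiv ℝ w x v).re ∧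
      fderiv ℝ (fun x => (w x).im) x v = (fderiv ℝ w x v).im := by
  have h1 := (Complex.reCLM.hasFDerivAt.comp x (hw x).hasFDerivAt).fderiv
  have h2 := (Complex.imCLM.hasFDerivAt.comp x (hw x).hasFDerivAt).fderiv
  exact ⟨congrArg (fun L : ℝ × ℝ →L[ℝ] ℝ => L v) h1, congrArg (fun L : ℝ × ℝ →L[ℝ] ℝ => L v) h2⟩

theorem integral_mul_component_eq {α : Type*} [MeasurableSpace α] {μ : Measure α} {w : α → ℂ}
    (hw : MemLp w 2 μ) (u : Lp Spinor 2 μ) (j : Fin 2) :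
    ∫ x, w x * u x j ∂μ = (∫ x, (w x).re • u x ∂μ) j + Complex.I * (∫ x, (w x).im • u x ∂μ) j := by
  have hre : MemLp (fun x => (w x).re) 2 μ := hw.re
  have him : MemLp (fun x => (w x).im) 2 μ := hw.im
  rw [integral_smul_apply hre, integral_smul_apply him, ← integral_const_mul, ← integral_add]
  · congr 1
    funext x
    conv_lhs => rw [← Complex.re_add_im (w x)]
    ring
  · exact integrable_mul_component hre.ofReal u j
  · exact (integrable_mul_component him.ofReal u j).const_mul _

theorem IsTrace.integral_test {u d : L2Spinor} {τ : Lp Spinor 2 (volume : Measure ℝ)}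
    (h : IsTrace u d τ) (hw : IsTest w) (j : Fin 2) :
    (∫ x in halfPlane, fderiv ℝ w x (0, 1) * u x j) + ∫ x in halfPlane, w x * d x j =
      -∫ s : ℝ, w (s, 0) * τ s j := by
  have hd := hw.nice.differentiable
  rw [integral_mul_component_eq (hw.nice.fderiv _).memLp, integral_mul_component_eq hw.nice.memLp,
    integral_mul_component_eq hw.nice.memLp_slice]
  have h1 := congrArg (fun v : Spinor => v j) (h _ hw.re_im.1.1 hw.re_im.1.2)
  have h2 := congrArg (fun v : Spinor => v j) (h _ hw.re_im.2.1 hw.re_im.2.2)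
  simp only [fderiv_re_im hd, PiLp.add_apply, PiLp.neg_apply] at h1 h2
  linear_combination h1 + Complex.I * h2

theorem IsWeakDeriv.integral_test {v : ℝ × ℝ} {u d : L2Spinor} (h : IsWeakDeriv v u d)
    (hw : IsTest w) (hs : tsupport w ⊆ halfPlane) (j : Fin 2) :
    (∫ x in halfPlane, fderiv ℝ w x v * u x j) + ∫ x in halfPlane, w x * d x j = 0 := by
  have hd := hw.nice.differentiable
  rw [integral_mul_component_eq (hw.nice.fderiv _).memLp, integral_mul_component_eq hw.nice.memLp]
  have h1 := congrArg (fun v : Spinor => v j) (h _ hw.re_im.1.1 hw.re_im.1.2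
    ((tsupport_comp_subset (g := Complex.re) rfl w).trans hs))
  have h2 := congrArg (fun v : Spinor => v j) (h _ hw.re_im.2.1 hw.re_im.2.2
    ((tsupport_comp_subset (g := Complex.im) rfl w).trans hs))
  simp only [fderiv_re_im hd, PiLp.neg_apply] at h1 h2
  linear_combination h1 + Complex.I * h2

end Test

/-- A sequence of cutoff functions that exhausts `s`, with derivative in direction `v` bounded
by `M`. -/
structure IsCutoff (s : Set (ℝ × ℝ)) (v : ℝ × ℝ) (M : ℝ) (θ : ℕ → ℝ × ℝ → ℝ) : Prop where
  contDiff : ∀ n, ContDiff ℝ ∞ (θ n)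
  hasCompactSupport : ∀ n, HasCompactSupport (θ n)
  abs_le : ∀ n x, |θ n x| ≤ 1
  abs_fderiv_le : ∀ n x, |_root_.fderiv ℝ (θ n) x v| ≤ M
  eventually : ∀ x ∈ s, ∀ᶠ n in atTop, θ n =ᶠ[𝓝 x] fun _ => 1

namespace IsCutoff

variable {s : Set (ℝ × ℝ)} {v : ℝ × ℝ} {M : ℝ} {θ : ℕ → ℝ × ℝ → ℝ} {w : ℝ × ℝ → ℂ}

theorem isTest_mul (h : IsCutoff s v M θ) (hw : Nice w) (n : ℕ) :
    IsTest fun x => (θ n x : ℂ) * w x :=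
  ⟨(Complex.ofRealCLM.contDiff.comp (h.contDiff n)).mul hw.contDiff,
    ((h.hasCompactSupport n).comp_left (g := fun r : ℝ => (r : ℂ)) rfl).mul_right⟩

theorem norm_mul_le (h : IsCutoff s v M θ) (n : ℕ) (x : ℝ × ℝ) (z : ℂ) :
    ‖(θ n x : ℂ) * z‖ ≤ ‖z‖ := by
  rw [norm_mul, Complex.norm_real]
  exact mul_le_of_le_one_left (norm_nonneg _) (h.abs_le n x)

theorem norm_fderiv_mul_le (h : IsCutoff s v M θ) (hw : Nice w) (n : ℕ) (x : ℝ × ℝ) :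
    ‖fderiv ℝ (fun x => (θ n x : ℂ) * w x) x v‖ ≤ ‖fderiv ℝ w x v‖ + M * ‖w x‖ := by
  have h1 : HasFDerivAt (fun x => (θ n x : ℂ)) (Complex.ofRealCLM.comp (fderiv ℝ (θ n) x)) x :=
    Complex.ofRealCLM.hasFDerivAt.comp x ((h.contDiff n).differentiable (by simp) x).hasFDerivAt
  rw [(h1.fun_mul (hw.differentiable x).hasFDerivAt).fderiv]
  refine (norm_add_le _ _).trans (add_le_add ?_ ?_)
  · exact h.norm_mul_le n x _
  · change ‖w x * ((fderiv ℝ (θ n) x v : ℝ) : ℂ)‖ ≤ _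
    rw [norm_mul, Complex.norm_real, mul_comm]
    exact mul_le_mul_of_nonneg_right (h.abs_fderiv_le n x) (norm_nonneg _)

theorem tendsto_integral (h : IsCutoff halfPlane v M θ) (hw : Nice w) (u : L2Spinor) (j : Fin 2) :
    Tendsto (fun n => ∫ x in halfPlane, ((θ n x : ℂ) * w x) * u x j) atTop
      (𝓝 (∫ x in halfPlane, w x * u x j)) := by
  refine tendsto_integral_of_dominated_convergence (fun x => ‖w x * u x j‖)
    (fun n => (integrable_mul_component (h.isTest_mul hw n).nice.memLp u j).1)
    (integrable_mul_component hw.memLp u j).norm (fun n => Eventually.of_forall fun x => ?_) ?_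
  · rw [mul_assoc]
    exact h.norm_mul_le n x _
  · filter_upwards [ae_restrict_mem measurableSet_halfPlane] with x hx
    refine tendsto_const_nhds.congr' ?_
    filter_upwards [h.eventually x hx] with n hn
    rw [hn.eq_of_nhds, Complex.ofReal_one, one_mul]

theorem tendsto_integral_fderiv (h : IsCutoff halfPlane v M θ) (hw : Nice w) (u : L2Spinor)
    (j : Fin 2) :
    Tendsto (fun n => ∫ x in halfPlane, fderiv ℝ (fun x => (θ n x : ℂ) * w x) x v * u x j) atTop
      (𝓝 (∫ x in halfPlane, fderiv ℝ w x v * u x j)) := by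
  refine tendsto_integral_of_dominated_convergence
    (fun x => ‖fderiv ℝ w x v * u x j‖ + M * ‖w x * u x j‖)
    (fun n => (integrable_mul_component ((h.isTest_mul hw n).nice.fderiv v).memLp u j).1)
    ((integrable_mul_component (hw.fderiv v).memLp u j).norm.add
      ((integrable_mul_component hw.memLp u j).norm.const_mul M))
    (fun n => Eventually.of_forall fun x => ?_) ?_
  · rw [norm_mul, norm_mul, norm_mul, ← mul_assoc, ← add_mul]
    exact mul_le_mul_of_nonneg_right (h.norm_fderiv_mul_le hw n x) (norm_nonneg _)
  · filter_upwards [ae_restrict_mem measurableSet_halfPlane] with x hx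
    refine tendsto_const_nhds.congr' ?_
    filter_upwards [h.eventually x hx] with n hn
    have : (fun x => (θ n x : ℂ) * w x) =ᶠ[𝓝 x] w := by
      filter_upwards [hn] with y hy
      rw [hy, Complex.ofReal_one, one_mul]
    rw [this.fderiv_eq]

end IsCutoff

/-- Smooth cutoff functions of growing discs. -/
def discCutoff (n : ℕ) (x : ℝ × ℝ) : ℝ :=
  (⟨1, 2, one_pos, one_lt_two⟩ : ContDiffBump (0 : ℝ × ℝ)) (((n : ℝ) + 1)⁻¹ • x)

theorem exists_isCutoff_discCutoff (v : ℝ × ℝ) : ∃ M, 0 ≤ M ∧ IsCutoff univ v M discCutoff := by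
  set χ : ContDiffBump (0 : ℝ × ℝ) := ⟨1, 2, one_pos, one_lt_two⟩ with hχ
  have hc : ContDiff ℝ ∞ χ := χ.contDiff
  have hcd : Continuous fun x => fderiv ℝ χ x v := continuous_fderiv_apply hc v
  obtain ⟨M, hM⟩ := hcd.bounded_above_of_compact_support
    (hasCompactSupport_fderiv_apply χ.hasCompactSupport v)
  have hM0 : 0 ≤ M := (norm_nonneg _).trans (hM 0)
  have hpos : ∀ n : ℕ, 0 < ((n : ℝ) + 1)⁻¹ := fun n => by positivity
  refine ⟨M, hM0, fun n => hc.comp (contDiff_const_smul _),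
    fun n => χ.hasCompactSupport.comp_homeomorph (Homeomorph.smulOfNeZero _ (hpos n).ne'),
    fun n x => ?_, fun n x => ?_, fun x _ => ?_⟩
  · change |χ (((n : ℝ) + 1)⁻¹ • x)| ≤ 1
    rw [abs_of_nonneg χ.nonneg]
    exact χ.le_one
  · have h1 : HasFDerivAt (fun x : ℝ × ℝ => ((n : ℝ) + 1)⁻¹ • x)
        (((n : ℝ) + 1)⁻¹ • ContinuousLinearMap.id ℝ (ℝ × ℝ)) x :=
      (hasFDerivAt_id x).const_smul (((n : ℝ) + 1)⁻¹)
    have h2 : HasFDerivAt (discCutoff n) _ x :=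
      ((hc.differentiable (by simp) (((n : ℝ) + 1)⁻¹ • x)).hasFDerivAt).comp x h1
    rw [h2.fderiv]
    simp only [ContinuousLinearMap.comp_apply, smul_apply, ContinuousLinearMap.id_apply, map_smul,
      smul_eq_mul, abs_mul, abs_of_pos (hpos n)]
    refine (mul_le_of_le_one_left (abs_nonneg _) (inv_le_one_of_one_le₀ ?_)).trans (hM _)
    linarith [n.cast_nonneg (α := ℝ)]
  · obtain ⟨N, hN⟩ := exists_nat_gt ‖x‖
    filter_upwards [eventually_ge_atTop N] with n hn
    have hlt : ∀ᶠ y in 𝓝 x, ‖y‖ < (n : ℝ) + 1 := continuous_norm.continuousAt.eventually_lt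
      continuousAt_const (by linarith [(Nat.cast_le (α := ℝ)).2 hn])
    filter_upwards [hlt] with y hy
    refine χ.one_of_mem_closedBall ?_
    rw [mem_closedBall_zero_iff, norm_smul, Real.norm_of_nonneg (hpos n).le, inv_mul_le_iff₀
      (by positivity), mul_one]
    exact hy.le

/-- Smooth cutoff functions of growing discs supported away from the boundary. -/
def innerCutoff (n : ℕ) (x : ℝ × ℝ) : ℝ :=
  discCutoff n x * Real.smoothTransition (((n : ℝ) + 1) * x.2 - 1)

theorem tsupport_innerCutoff_subset (n : ℕ) : tsupport (innerCutoff n) ⊆ halfPlane := by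
  have hcl : IsClosed {x : ℝ × ℝ | 1 ≤ ((n : ℝ) + 1) * x.2} :=
    isClosed_le continuous_const (by fun_prop)
  refine (closure_minimal (fun x hx => ?_) hcl).trans fun x hx => ?_
  · by_contra hlt
    have hlt : ¬1 ≤ ((n : ℝ) + 1) * x.2 := hlt
    refine hx ?_
    rw [innerCutoff, Real.smoothTransition.zero_of_nonpos (by linarith [not_le.1 hlt]), mul_zero]
  · have h : 1 ≤ ((n : ℝ) + 1) * x.2 := hx
    exact pos_of_mul_pos_right (by linarith) (by positivity : (0 : ℝ) ≤ (n : ℝ) + 1)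

/-- The transition layer at the boundary gets steeper with n, but it depends on x₂ alone and is
invisible to ∂₁. Hence the weak ∂₁-equation extends to functions that do not vanish on the boundary.
-/
theorem exists_isCutoff_innerCutoff : ∃ M, IsCutoff halfPlane (1, 0) M innerCutoff := by
  obtain ⟨M, hM0, h⟩ := exists_isCutoff_discCutoff (1, 0)
  have hb : ∀ t, |Real.smoothTransition t| ≤ 1 := fun t => by
    rw [abs_of_nonneg (Real.smoothTransition.nonneg t)]
    exact Real.smoothTransition.le_one t
  have hs : ∀ n : ℕ, ContDiff ℝ ∞ fun x : ℝ × ℝ => Real.smoothTransition (((n : ℝ) + 1) * x.2 - 1) :=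
    fun n => Real.smoothTransition.contDiff.comp (by fun_prop)
  refine ⟨M, fun n => (h.contDiff n).mul (hs n), fun n => (h.hasCompactSupport n).mul_right,
    fun n x => ?_, fun n x => ?_, fun x hx => ?_⟩
  · rw [innerCutoff, abs_mul]
    exact mul_le_one₀ (h.abs_le n x) (abs_nonneg _) (hb _)
  · have hd := (hs n).differentiable (by simp) x
    have h0 : fderiv ℝ (fun x : ℝ × ℝ => Real.smoothTransition (((n : ℝ) + 1) * x.2 - 1)) x (1, 0) =
        0 := by
      have h1 := hd.hasFDerivAt.comp_hasDerivAt x.1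
        ((hasDerivAt_id x.1).prodMk (hasDerivAt_const x.1 x.2))
      have h3 : HasDerivAt (fun _ : ℝ => Real.smoothTransition (((n : ℝ) + 1) * x.2 - 1)) 0 x.1 :=
        hasDerivAt_const _ _
      exact h1.unique h3
    have h2 : fderiv ℝ (innerCutoff n) x = _ :=
      fderiv_fun_mul ((h.contDiff n).differentiable (by simp) x) hd
    rw [h2]
    simp only [add_apply, smul_apply, smul_eq_mul, h0, mul_zero, zero_add, abs_mul]
    exact (mul_le_of_le_one_left (abs_nonneg _) (hb _)).trans (h.abs_fderiv_le n x)
  · have hx : 0 < x.2 := hx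
    obtain ⟨N, hN⟩ := exists_nat_gt (2 / x.2)
    filter_upwards [h.eventually x (mem_univ x), eventually_ge_atTop N] with n h1 hn
    have hlt : ∀ᶠ y : ℝ × ℝ in 𝓝 x, 2 < ((n : ℝ) + 1) * y.2 := by
      refine continuousAt_const.eventually_lt (by fun_prop) ?_
      rw [div_lt_iff₀ hx] at hN
      nlinarith [(Nat.cast_le (α := ℝ)).2 hn]
    filter_upwards [h1, hlt] with y hy1 hy2
    rw [innerCutoff, hy1, Real.smoothTransition.one_of_one_le (by linarith), mul_one]

theorem IsTrace.integral_nice {u d : L2Spinor} {τ : Lp Spinor 2 (volume : Measure ℝ)}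
    (h : IsTrace u d τ) {w : ℝ × ℝ → ℂ} (hw : Nice w) (j : Fin 2) :
    (∫ x in halfPlane, fderiv ℝ w x (0, 1) * u x j) + ∫ x in halfPlane, w x * d x j =
      -∫ s : ℝ, w (s, 0) * τ s j := by
  obtain ⟨M, -, hc⟩ := exists_isCutoff_discCutoff (0, 1)
  have hc' : IsCutoff halfPlane (0, 1) M discCutoff :=
    ⟨hc.contDiff, hc.hasCompactSupport, hc.abs_le, hc.abs_fderiv_le,
      fun x _ => hc.eventually x (mem_univ x)⟩
  have t1 := (hc'.tendsto_integral_fderiv hw u j).add (hc'.tendsto_integral hw d j)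
  simp only [h.integral_test (hc'.isTest_mul hw _) j] at t1
  refine tendsto_nhds_unique t1 (Tendsto.neg ?_)
  refine tendsto_integral_of_dominated_convergence (fun s => ‖w (s, 0) * τ s j‖)
    (fun n => (integrable_mul_component (hc'.isTest_mul hw n).nice.memLp_slice τ j).1)
    (integrable_mul_component hw.memLp_slice τ j).norm (fun n => Eventually.of_forall fun s => ?_)
    (Eventually.of_forall fun s => ?_)
  · rw [mul_assoc]
    exact hc.norm_mul_le n _ _
  · refine tendsto_const_nhds.congr' ?_
    filter_upwards [hc.eventually (s, 0) (mem_univ _)] with n hn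
    rw [hn.eq_of_nhds, Complex.ofReal_one, one_mul]

theorem IsWeakDeriv.integral_nice {u d : L2Spinor} (h : IsWeakDeriv (1, 0) u d) {w : ℝ × ℝ → ℂ}
    (hw : Nice w) (j : Fin 2) :
    (∫ x in halfPlane, fderiv ℝ w x (1, 0) * u x j) + ∫ x in halfPlane, w x * d x j = 0 := by
  obtain ⟨M, hc⟩ := exists_isCutoff_innerCutoff
  have t1 := (hc.tendsto_integral_fderiv hw u j).add (hc.tendsto_integral hw d j)
  have hs : ∀ n, tsupport (fun x => (innerCutoff n x : ℂ) * w x) ⊆ halfPlane := fun n =>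
    (tsupport_mul_subset_left.trans
      (tsupport_comp_subset (g := fun r : ℝ => (r : ℂ)) rfl _)).trans (tsupport_innerCutoff_subset n)
  simp only [h.integral_test (hc.isTest_mul hw _) (hs _) j] at t1
  exact tendsto_nhds_unique t1 tendsto_const_nhds

/-! ### Uniqueness -/

theorem inner_spinL2 {α : Type*} [MeasurableSpace α] {μ : Measure α} {a b : α → ℂ}
    (ha : MemLp a 2 μ) (hb : MemLp b 2 μ) (g : Lp Spinor 2 μ) :
    inner ℂ (spinL2 ha hb) g =
      (∫ x, (starRingEnd ℂ) (a x) * g x 0 ∂μ) + ∫ x, (starRingEnd ℂ) (b x) * g x 1 ∂μ := by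
  have ha' : MemLp (fun x => (starRingEnd ℂ) (a x)) 2 μ := ha.star
  have hb' : MemLp (fun x => (starRingEnd ℂ) (b x)) 2 μ := hb.star
  rw [L2.inner_def, ← integral_add (integrable_mul_component ha' g 0)
    (integrable_mul_component hb' g 1)]
  refine integral_congr_ae ?_
  filter_upwards [coeFn_spinL2 ha hb] with x hx
  rw [hx, inner_spin]

theorem integral_linear_comb {α : Type*} [MeasurableSpace α] {μ : Measure α} {F G H : α → ℂ}
    (hF : Integrable F μ) (hG : Integrable G μ) (hH : Integrable H μ) (a b c : ℂ) :
    ∫ x, (a * F x + b * G x + c * H x) ∂μ =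
      a * (∫ x, F x ∂μ) + b * (∫ x, G x ∂μ) + c * ∫ x, H x ∂μ := by
  rw [integral_add (f := fun x => a * F x + b * G x) ((hF.const_mul a).add (hG.const_mul b))
    (hH.const_mul c), integral_add (hF.const_mul a) (hG.const_mul b), integral_const_mul,
    integral_const_mul, integral_const_mul]

/-- Symmetry of the operator: ⟨g, u⟩ = ⟨(𝒟₀ + iλ)v, u⟩ = ⟨v, (𝒟₀ - iλ)u⟩ = ⟨v, f⟩. Green's formula
is available because v is smooth and rapidly decaying while u has weak derivatives and a trace. -/
theorem ClassicalSol.inner_eq {γ lam : ℝ} {g₁ g₂ v₁ v₂ : ℝ × ℝ → ℂ}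
    (hv : ClassicalSol γ (-lam) g₁ g₂ v₁ v₂) (hg : IsTestPair g₁ g₂) {u f : L2Spinor}
    (h : DiracGraph γ u (f + (Complex.I * (lam : ℂ)) • u)) :
    inner ℂ hg.toL2 u = inner ℂ hv.boundaryPair.toL2 f := by
  obtain ⟨d₁, d₂, τ, hw, -, ht, hb, he⟩ := h
  have n1 := hv.nice₁.conj
  have n2 := hv.nice₂.conj
  rw [IsTestPair.toL2, inner_spinL2, BoundaryPair.toL2, inner_spinL2]
  have a1 : ∫ x in halfPlane, (starRingEnd ℂ) (g₁ x) * u x 0 =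
      Complex.I * (∫ x in halfPlane, fderiv ℝ (fun x => (starRingEnd ℂ) (v₂ x)) x (1, 0) * u x 0) +
      (-1) * (∫ x in halfPlane, fderiv ℝ (fun x => (starRingEnd ℂ) (v₂ x)) x (0, 1) * u x 0) +
      (-(Complex.I * lam)) * ∫ x in halfPlane, (starRingEnd ℂ) (v₁ x) * u x 0 := by
    rw [← integral_linear_comb (integrable_mul_component (n2.fderiv _).memLp u 0)
      (integrable_mul_component (n2.fderiv _).memLp u 0) (integrable_mul_component n1.memLp u 0)]
    refine setIntegral_congr_fun measurableSet_halfPlane fun x hx => ?_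
    simp only [← hv.eq₁ x hx, fderiv_conj_apply hv.nice₂, map_sub, map_mul, map_neg,
      Complex.conj_I, Complex.conj_ofReal]
    push_cast
    ring
  have a2 : ∫ x in halfPlane, (starRingEnd ℂ) (g₂ x) * u x 1 =
      Complex.I * (∫ x in halfPlane, fderiv ℝ (fun x => (starRingEnd ℂ) (v₁ x)) x (1, 0) * u x 1) +
      1 * (∫ x in halfPlane, fderiv ℝ (fun x => (starRingEnd ℂ) (v₁ x)) x (0, 1) * u x 1) +
      (-(Complex.I * lam)) * ∫ x in halfPlane, (starRingEnd ℂ) (v₂ x) * u x 1 := by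
    rw [← integral_linear_comb (integrable_mul_component (n1.fderiv _).memLp u 1)
      (integrable_mul_component (n1.fderiv _).memLp u 1) (integrable_mul_component n2.memLp u 1)]
    refine setIntegral_congr_fun measurableSet_halfPlane fun x hx => ?_
    simp only [← hv.eq₂ x hx, fderiv_conj_apply hv.nice₁, map_sub, map_add, map_mul, map_neg,
      Complex.conj_I, Complex.conj_ofReal]
    push_cast
    ring
  have hf : ∀ᵐ x ∂volHalf, f x 0 = (-Complex.I) * d₁ x 1 + (-1) * d₂ x 1 +
      (-(Complex.I * lam)) * u x 0 ∧ f x 1 = (-Complex.I) * d₁ x 0 + 1 * d₂ x 0 +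
      (-(Complex.I * lam)) * u x 1 := by
    filter_upwards [he, Lp.coeFn_add f ((Complex.I * (lam : ℂ)) • u),
      Lp.coeFn_smul (Complex.I * (lam : ℂ)) u] with x h1 h2 h3
    rw [h2, Pi.add_apply, h3, Pi.smul_apply] at h1
    have e0 := congrArg (fun v : Spinor => v 0) h1
    have e1 := congrArg (fun v : Spinor => v 1) h1
    simp only [PiLp.smul_apply, PiLp.add_apply, act_apply, smul_eq_mul, σ₁, σ₂, Matrix.of_apply,
      Matrix.cons_val_zero, Matrix.cons_val_one, Matrix.cons_val', Matrix.cons_val_fin_one]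
      at e0 e1
    exact ⟨by linear_combination e0 + d₂ x 1 * Complex.I_sq,
      by linear_combination e1 - d₂ x 0 * Complex.I_sq⟩
  have b1 : ∫ x in halfPlane, (starRingEnd ℂ) (v₁ x) * f x 0 =
      (-Complex.I) * (∫ x in halfPlane, (starRingEnd ℂ) (v₁ x) * d₁ x 1) +
      (-1) * (∫ x in halfPlane, (starRingEnd ℂ) (v₁ x) * d₂ x 1) +
      (-(Complex.I * lam)) * ∫ x in halfPlane, (starRingEnd ℂ) (v₁ x) * u x 0 := by
    rw [← integral_linear_comb (integrable_mul_component n1.memLp d₁ 1)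
      (integrable_mul_component n1.memLp d₂ 1) (integrable_mul_component n1.memLp u 0)]
    refine integral_congr_ae ?_
    filter_upwards [hf] with x hx
    rw [hx.1]
    ring
  have b2 : ∫ x in halfPlane, (starRingEnd ℂ) (v₂ x) * f x 1 =
      (-Complex.I) * (∫ x in halfPlane, (starRingEnd ℂ) (v₂ x) * d₁ x 0) +
      1 * (∫ x in halfPlane, (starRingEnd ℂ) (v₂ x) * d₂ x 0) +
      (-(Complex.I * lam)) * ∫ x in halfPlane, (starRingEnd ℂ) (v₂ x) * u x 1 := by
    rw [← integral_linear_comb (integrable_mul_component n2.memLp d₁ 0)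
      (integrable_mul_component n2.memLp d₂ 0) (integrable_mul_component n2.memLp u 1)]
    refine integral_congr_ae ?_
    filter_upwards [hf] with x hx
    rw [hx.2]
    ring
  -- The boundary terms of Green's formula cancel because v and the trace of u satisfy the same
  -- condition with real γ.
  have c : ∫ s : ℝ, (starRingEnd ℂ) (v₂ (s, 0)) * τ s 0 =
      ∫ s : ℝ, (starRingEnd ℂ) (v₁ (s, 0)) * τ s 1 := by
    refine integral_congr_ae ?_
    filter_upwards [hb] with s hs
    rw [hs, hv.boundary, map_mul, Complex.conj_ofReal]
    ring
  have t1 := ht.integral_nice n1 1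
  have t2 := ht.integral_nice n2 0
  have w1 := hw.integral_nice n1 1
  have w2 := hw.integral_nice n2 0
  rw [a1, a2, b1, b2]
  linear_combination Complex.I * w2 + Complex.I * w1 - t2 + t1 + c

/-- For uniqueness, the pairings of a solution with test pairs depend on the datum f only, by
solving the problem at -iλ, and such pairings determine an element of L². -/
theorem isResolvent_of_isIntegralKernel {γ lam : ℝ} (hγ : 0 < γ) (hlam : lam ≠ 0)
    {R : L2Spinor →L[ℂ] L2Spinor} (hR : IsIntegralKernel R (diracKernel γ lam)) :
    IsResolvent γ (Complex.I * (lam : ℂ)) R := by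
  refine fun u f => ⟨fun h => ?_, fun h => h ▸ diracGraph_resolvent hγ hlam hR f⟩
  rw [← sub_eq_zero]
  refine eq_zero_of_inner_testSubspace fun g₁ g₂ hg => ?_
  obtain ⟨v₁, v₂, hv, -⟩ := exists_classicalSol hγ (neg_ne_zero.2 hlam) hg.test₁ hg.test₂ hg.supp₁
    hg.supp₂
  rw [inner_sub_right, hv.inner_eq hg h, hv.inner_eq hg (diracGraph_resolvent hγ hlam hR f),
    sub_self]

theorem isResolventKernel_diracKernel {γ lam : ℝ} (hγ : 0 < γ) (hlam : lam ≠ 0) :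
    IsResolventKernel γ (Complex.I * (lam : ℂ)) (diracKernel γ lam) := by
  obtain ⟨B, a, hK⟩ := exists_schurKernel_diracKernel hγ hlam
  obtain ⟨R, hR⟩ := hK.exists_isIntegralKernel
  exact ⟨⟨R, isResolvent_of_isIntegralKernel hγ hlam hR, hR⟩, continuousOn_diracKernel hγ hlam⟩

/-! ### The explicit formula -/

theorem bracket_sinh (s : ℝ) : bracket (Real.sinh s) = Real.cosh s := by
  rw [bracket, add_comm, ← Real.cosh_sq, Real.sqrt_sq (Real.cosh_pos s).le]

theorem boundaryCoeff_sinh (γ s : ℝ) : boundaryCoeff γ (Real.sinh s) = refl γ s := by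
  rw [boundaryCoeff, refl, bracket_sinh, Real.cosh_add_sinh, Complex.ofReal_exp]

/-- The symbol of the kernel of the whole plane above (`ε = 1`) and below (`ε = -1`) the
singularity. -/
def planeSymbol (ε s : ℝ) : Matrix (Fin 2) (Fin 2) ℂ :=
  !![Complex.I, ((Real.sinh s + Real.cosh s * ε : ℝ) : ℂ);
    ((Real.sinh s - Real.cosh s * ε : ℝ) : ℂ), Complex.I]

/-- The Jacobian cosh s of ξ = sinh s cancels the denominator ⟨ξ⟩. -/
theorem cosh_mul_lineKernel_sinh (s z : ℝ) (j k : Fin 2) :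
    (Real.cosh s : ℂ) * lineKernel (Real.sinh s) z j k =
      1 / 2 * Real.exp (-(|z| * Real.cosh s)) * planeSymbol (Real.sign z) s j k := by
  have hc : (Real.cosh s : ℂ) ≠ 0 := Complex.ofReal_ne_zero.2 (Real.cosh_pos s).ne'
  rw [lineKernel, Matrix.smul_apply, smul_eq_mul, bracket_sinh, planeSymbol, ← mul_assoc,
    mul_comm (Real.cosh s) |z|]
  congr 1
  push_cast
  push_cast at hc
  field_simp

theorem planeSymbol_mul_σ₁ (ε s : ℝ) : planeSymbol ε s * σ₁ =
    !![((Real.sinh s + Real.cosh s * ε : ℝ) : ℂ), Complex.I;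
      Complex.I, ((Real.sinh s - Real.cosh s * ε : ℝ) : ℂ)] := by
  rw [planeSymbol, σ₁]
  ext j k
  fin_cases j <;> fin_cases k <;> simp

theorem cosh_mul_fiberKernel_sinh {γ t t' : ℝ} (ht : 0 < t + t') (s : ℝ) (j k : Fin 2) :
    (Real.cosh s : ℂ) * fiberKernel γ (Real.sinh s) t t' j k =
      1 / 2 * (Real.exp (-(|t - t'| * Real.cosh s)) * planeSymbol (Real.sign (t - t')) s j k +
        Real.exp (-((t + t') * Real.cosh s)) * (refl γ s * (planeSymbol 1 s * σ₁) j k)) := by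
  have h : (Real.cosh s : ℂ) * (lineKernel (Real.sinh s) (t + t') * σ₁) j k =
      1 / 2 * Real.exp (-((t + t') * Real.cosh s)) * (planeSymbol 1 s * σ₁) j k := by
    have h0 := cosh_mul_lineKernel_sinh s (t + t') j
    rw [Real.sign_of_pos ht, abs_of_pos ht] at h0
    rw [Matrix.mul_apply, Matrix.mul_apply, Fin.sum_univ_two, Fin.sum_univ_two]
    linear_combination σ₁ 0 k * h0 0 + σ₁ 1 k * h0 1
  rw [fiberKernel, Matrix.add_apply, Matrix.smul_apply, smul_eq_mul, boundaryCoeff_sinh]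
  linear_combination cosh_mul_lineKernel_sinh s (t - t') j k + refl γ s * h

theorem phase_eq_mul (a t s : ℝ) : phase (a, t) s =
    Complex.exp (Complex.I * ((Real.sinh s * a : ℝ) : ℂ)) * Real.exp (-(t * Real.cosh s)) := by
  rw [phase, Complex.ofReal_exp, ← Complex.exp_add]
  congr 1
  push_cast
  ring

theorem freeKernel_eq_stripKernel_add {γ : ℝ} {x x' : ℝ × ℝ} (hx : x ∈ halfPlane)
    (hx' : x' ∈ halfPlane) (hne : x.2 ≠ x'.2) {j k : Fin 2} {b b' : ℝ → ℂ} (hb : IsSymbol b)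
    (hb' : IsSymbol b') (h : ∀ s, planeSymbol (Real.sign (x.2 - x'.2)) s j k = b s)
    (h' : ∀ s : ℝ, refl γ s * (planeSymbol 1 s * σ₁) j k = b' s) :
    freeKernel γ x x' j k = stripKernel b (x.1 - x'.1, |x.2 - x'.2|) +
      stripKernel b' (x.1 - x'.1, x.2 + x'.2) := by
  have hp : 0 < x.2 + x'.2 := add_pos hx hx'
  have hy : 0 < |x.2 - x'.2| := abs_pos.2 (sub_ne_zero.2 hne)
  rw [freeKernel, ← integral_cosh_mul_comp_sinh, stripKernel, stripKernel, ← mul_add,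
    ← integral_add (hb.integrable_phase_mul (y := (x.1 - x'.1, |x.2 - x'.2|)) hy)
      (hb'.integrable_phase_mul (y := (x.1 - x'.1, x.2 + x'.2)) hp)]
  have e : ∀ s : ℝ, Real.cosh s • (Complex.exp (Complex.I *
      ((Real.sinh s * (x.1 - x'.1) : ℝ) : ℂ)) * fiberKernel γ (Real.sinh s) x.2 x'.2 j k) =
      1 / 2 * (phase (x.1 - x'.1, |x.2 - x'.2|) s * b s +
        phase (x.1 - x'.1, x.2 + x'.2) s * b' s) := fun s => by
    rw [Complex.real_smul, mul_left_comm, cosh_mul_fiberKernel_sinh hp, phase_eq_mul, phase_eq_mul,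
      h, h']
    ring
  simp only [e]
  -- The factor 1/2 of the fibre kernel turns 1/(2π) into the 1/(4π) of `stripKernel`.
  rw [integral_const_mul, ← mul_assoc]
  congr 1
  have hπ : (Real.pi : ℂ) ≠ 0 := Complex.ofReal_ne_zero.2 Real.pi_ne_zero
  field_simp
  norm_num

theorem sinh_add_cosh_eq_symb (s : ℝ) : ((Real.sinh s + Real.cosh s : ℝ) : ℂ) = symb 1 1 s := by
  rw [symb_one, Real.sinh_add_cosh, Complex.ofReal_exp, Complex.ofReal_one, one_mul]

theorem sinh_sub_cosh_eq_symb (s : ℝ) :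
    ((Real.sinh s - Real.cosh s : ℝ) : ℂ) = (-1) * symb 1 (-1) s := by
  rw [symb_one, Real.sinh_sub_cosh]
  push_cast
  ring_nf

theorem freeKernel_eq_unitKernel {γ : ℝ} (hγ : 0 < γ) {x x' : ℝ × ℝ} (hx : x ∈ halfPlane)
    (hx' : x' ∈ halfPlane) (hne : x.2 ≠ x'.2) : freeKernel γ x x' = unitKernel γ x x' := by
  have g : ∀ {γ ν : ℝ}, 0 < γ → |ν| ≤ 1 → IsSymbol (symb γ ν) :=
    fun hγ hν => isSymbol_symb hγ hν
  have s0 := (g one_pos abs_zero_le_one).const_mul Complex.I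
  have s1 := g one_pos abs_one_le_one
  have s2 := (g one_pos abs_neg_one_le_one).const_mul (-1)
  have t0 := (g hγ abs_zero_le_one).const_mul Complex.I
  have t1 := g hγ abs_one_le_one
  have t2 := (g hγ abs_neg_one_le_one).const_mul (-1)
  have r0 : ∀ s : ℝ, refl γ s * Complex.I = Complex.I * symb γ 0 s := fun s => by
    rw [symb, Complex.ofReal_zero, zero_mul, Complex.exp_zero, mul_one, mul_comm]
  have r1 : ∀ s : ℝ, refl γ s * ((Real.sinh s + Real.cosh s : ℝ) : ℂ) = symb γ 1 s := fun s => by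
    rw [sinh_add_cosh_eq_symb, symb_one, symb]
  have r2 : ∀ s : ℝ, refl γ s * ((Real.sinh s - Real.cosh s : ℝ) : ℂ) = (-1) * symb γ (-1) s :=
    fun s => by rw [sinh_sub_cosh_eq_symb, symb_one, symb]; ring
  have p0 : ∀ s : ℝ, Complex.I = Complex.I * symb 1 0 s := fun s => by
    rw [symb_one, Complex.ofReal_zero, zero_mul, Complex.exp_zero, mul_one]
  have p00 : ∀ s : ℝ, planeSymbol (Real.sign (x.2 - x'.2)) s 0 0 = Complex.I * symb 1 0 s := p0
  have p11 : ∀ s : ℝ, planeSymbol (Real.sign (x.2 - x'.2)) s 1 1 = Complex.I * symb 1 0 s := p0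
  rcases lt_or_gt_of_ne hne with hlt | hlt
  · have hs : Real.sign (x.2 - x'.2) = -1 := Real.sign_of_neg (sub_neg.2 hlt)
    have q1 : ∀ s : ℝ, planeSymbol (Real.sign (x.2 - x'.2)) s 0 1 = (-1) * symb 1 (-1) s := fun s => by
      rw [hs, ← sinh_sub_cosh_eq_symb]; simp [planeSymbol, sub_eq_add_neg]
    have q2 : ∀ s : ℝ, planeSymbol (Real.sign (x.2 - x'.2)) s 1 0 = symb 1 1 s := fun s => by
      rw [hs, ← sinh_add_cosh_eq_symb]; simp [planeSymbol]
    have e : (x.1 - x'.1, |x.2 - x'.2|) = flip (x - x') := by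
      rw [abs_of_neg (sub_neg.2 hlt)]; rfl
    ext j k
    rw [unitKernel, planeKernel_of_neg (y := x - x') (sub_neg.2 hlt), mirrorKernel,
      Matrix.add_apply]
    fin_cases j <;> fin_cases k
    · refine (freeKernel_eq_stripKernel_add hx hx' hne s0 t1 p00 fun s => ?_).trans ?_
      · rw [← r1, planeSymbol_mul_σ₁]; simp
      · rw [e, stripKernel_const_mul]; rfl
    · refine (freeKernel_eq_stripKernel_add hx hx' hne s2 t0 q1 fun s => ?_).trans ?_
      · rw [← r0, planeSymbol_mul_σ₁]; simp
      · rw [e, stripKernel_const_mul, stripKernel_const_mul]; simp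
    · refine (freeKernel_eq_stripKernel_add hx hx' hne s1 t0 q2 fun s => ?_).trans ?_
      · rw [← r0, planeSymbol_mul_σ₁]; simp
      · rw [e, stripKernel_const_mul]; rfl
    · refine (freeKernel_eq_stripKernel_add hx hx' hne s0 t2 p11 fun s => ?_).trans ?_
      · rw [← r2, planeSymbol_mul_σ₁]; simp
      · rw [e, stripKernel_const_mul, stripKernel_const_mul]; simp
  · have hs : Real.sign (x.2 - x'.2) = 1 := Real.sign_of_pos (sub_pos.2 hlt)
    have q1 : ∀ s : ℝ, planeSymbol (Real.sign (x.2 - x'.2)) s 0 1 = symb 1 1 s := fun s => by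
      rw [hs, ← sinh_add_cosh_eq_symb]; simp [planeSymbol]
    have q2 : ∀ s : ℝ, planeSymbol (Real.sign (x.2 - x'.2)) s 1 0 = (-1) * symb 1 (-1) s := fun s => by
      rw [hs, ← sinh_sub_cosh_eq_symb]; simp [planeSymbol]
    have e : (x.1 - x'.1, |x.2 - x'.2|) = x - x' := by
      rw [abs_of_pos (sub_pos.2 hlt)]; rfl
    ext j k
    rw [unitKernel, planeKernel_of_pos (y := x - x') (sub_pos.2 hlt), mirrorKernel,
      Matrix.add_apply]
    fin_cases j <;> fin_cases k
    · refine (freeKernel_eq_stripKernel_add hx hx' hne s0 t1 p00 fun s => ?_).trans ?_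
      · rw [← r1, planeSymbol_mul_σ₁]; simp
      · rw [e, stripKernel_const_mul]; rfl
    · refine (freeKernel_eq_stripKernel_add hx hx' hne s1 t0 q1 fun s => ?_).trans ?_
      · rw [← r0, planeSymbol_mul_σ₁]; simp
      · rw [e, stripKernel_const_mul]; rfl
    · refine (freeKernel_eq_stripKernel_add hx hx' hne s2 t0 q2 fun s => ?_).trans ?_
      · rw [← r0, planeSymbol_mul_σ₁]; simp
      · rw [e, stripKernel_const_mul, stripKernel_const_mul]; simp
    · refine (freeKernel_eq_stripKernel_add hx hx' hne s0 t2 p11 fun s => ?_).trans ?_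
      · rw [← r2, planeSymbol_mul_σ₁]; simp
      · rw [e, stripKernel_const_mul, stripKernel_const_mul]; simp

/-! ### Lower bounds for the constants -/

theorem const_mul_le_integral {f : ℝ → ℝ} (hf : Integrable f) (h0 : ∀ s, 0 ≤ f s) {a b m : ℝ}
    (hab : a ≤ b) (hm : ∀ s ∈ Icc a b, m ≤ f s) : (b - a) * m ≤ ∫ s, f s := by
  have h1 := setIntegral_ge_of_const_le measurableSet_Icc (by simp) hm hf.integrableOn
  rw [Real.volume_real_Icc_of_le hab, smul_eq_mul] at h1
  exact h1.trans (setIntegral_le_integral hf (Eventually.of_forall h0))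

/-- The real part of the diagonal entries of the boundary kernel on the normal axis. -/
def normalIntegrand (γ t s : ℝ) : ℝ :=
  Real.exp (-(t * Real.cosh s)) *
    (Real.exp s * (γ * (1 + Real.exp s ^ 2) / (1 + γ ^ 2 * Real.exp s ^ 2)))

theorem re_refl (γ s : ℝ) :
    (refl γ s).re = γ * (1 + Real.exp s ^ 2) / (1 + γ ^ 2 * Real.exp s ^ 2) := by
  rw [refl, ← Complex.ofReal_exp, Complex.div_re]
  generalize Real.exp s = E
  have h1 : Complex.normSq (1 + Complex.I * γ * (E : ℂ)) = 1 + γ ^ 2 * E ^ 2 := by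
    rw [Complex.normSq_apply]
    simp
    ring
  rw [h1, ← add_div]
  congr 1
  simp
  ring

theorem re_phase_mul_symb (γ ν t s : ℝ) : (phase (0, t) s * symb γ ν s).re =
    Real.exp (-(t * Real.cosh s)) *
      (Real.exp (ν * s) * (γ * (1 + Real.exp s ^ 2) / (1 + γ ^ 2 * Real.exp s ^ 2))) := by
  rw [phase_eq_mul, symb, ← re_refl, mul_zero, Complex.ofReal_zero, mul_zero, Complex.exp_zero,
    one_mul, Complex.re_ofReal_mul, ← Complex.ofReal_mul, ← Complex.ofReal_exp, mul_comm (refl γ s),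
    Complex.re_ofReal_mul]

theorem re_stripKernel {b : ℝ → ℂ} (hb : IsSymbol b) {t : ℝ} (ht : 0 < t) :
    (stripKernel b (0, t)).re = 1 / (4 * Real.pi) * ∫ s : ℝ, (phase (0, t) s * b s).re := by
  have e : (1 / (4 * Real.pi) : ℂ) = ((1 / (4 * Real.pi) : ℝ) : ℂ) := by push_cast; rfl
  have hi := integral_re (hb.integrable_phase_mul (y := (0, t)) ht)
  rw [stripKernel, e, Complex.re_ofReal_mul]
  exact congrArg _ hi.symm

theorem integrable_normalIntegrand {γ t : ℝ} (hγ : 0 < γ) (ht : 0 < t) :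
    Integrable (normalIntegrand γ t) := by
  refine ((isSymbol_symb hγ abs_one_le_one).integrable_phase_mul (y := (0, t)) ht).re.congr
    (Eventually.of_forall fun s => ?_)
  refine (re_phase_mul_symb γ 1 t s).trans ?_
  rw [one_mul, normalIntegrand]

theorem re_stripKernel_symb_one {γ t : ℝ} (hγ : 0 < γ) (ht : 0 < t) :
    (stripKernel (symb γ 1) (0, t)).re = 1 / (4 * Real.pi) * ∫ s, normalIntegrand γ t s := by
  rw [re_stripKernel (isSymbol_symb hγ abs_one_le_one) ht]
  simp only [re_phase_mul_symb, one_mul, normalIntegrand]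

/-- Under s ↦ -s the real part of the coefficient for γ becomes the one for 1/γ, and ν = -1 becomes
ν = 1. This duality reduces the limit γ → ∞ to γ → 0. -/
theorem re_stripKernel_symb_neg_one {γ t : ℝ} (hγ : 0 < γ) (ht : 0 < t) :
    (stripKernel (symb γ (-1)) (0, t)).re = 1 / (4 * Real.pi) * ∫ s, normalIntegrand γ⁻¹ t s := by
  rw [re_stripKernel (isSymbol_symb hγ abs_neg_one_le_one) ht, ← integral_neg_eq_self]
  congr 2
  funext s
  rw [re_phase_mul_symb, normalIntegrand, Real.cosh_neg, neg_mul_neg, one_mul, Real.exp_neg s]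
  have := Real.exp_pos s
  congr 2
  field_simp
  ring

/-- The window of length log 2 starting at s = -log γ, the real part of the pole, is where 1 ≤ γe^s
≤ 2. There cosh s ≤ e^s ≤ 2/γ keeps the damping above e^{-6}, and the rest of the integrand is at
least γe^{3s}/(1 + 4) ≥ 1/(5γ²). -/
theorem le_integral_normalIntegrand {γ : ℝ} (hγ : 0 < γ) (hγ1 : γ ≤ 1) :
    Real.log 2 * (Real.exp (-6) / (5 * γ ^ 2)) ≤ ∫ s, normalIntegrand γ (3 * γ) s := by
  have h := const_mul_le_integral (f := normalIntegrand γ (3 * γ)) (a := -Real.log γ) (b := -Real.log γ + Real.log 2)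
    (m := Real.exp (-6) / (5 * γ ^ 2)) (integrable_normalIntegrand hγ (by positivity))
    (fun s => by unfold normalIntegrand; positivity)
    (by linarith [Real.log_nonneg one_le_two]) fun s hs => ?_
  · simpa using h
  · have hs0 : 0 ≤ s := le_trans (by linarith [Real.log_nonpos hγ.le hγ1]) hs.1
    have h1 : 1 ≤ γ * Real.exp s := by
      have := Real.exp_le_exp.2 hs.1
      rw [Real.exp_neg, Real.exp_log hγ] at this
      rwa [inv_le_iff_one_le_mul₀' hγ] at this
    have h2 : γ * Real.exp s ≤ 2 := by
      have := Real.exp_le_exp.2 hs.2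
      rw [Real.exp_add, Real.exp_neg, Real.exp_log hγ, Real.exp_log two_pos] at this
      rwa [inv_mul_eq_div, le_div_iff₀' hγ] at this
    have hcosh : Real.cosh s ≤ Real.exp s := by
      rw [Real.cosh_eq]
      linarith [Real.exp_le_exp.2 (neg_le_self hs0)]
    have e1 : Real.exp (-6) ≤ Real.exp (-(3 * γ * Real.cosh s)) :=
      Real.exp_le_exp.2 (by nlinarith)
    have e2 : 1 / (5 * γ ^ 2) ≤
        Real.exp s * (γ * (1 + Real.exp s ^ 2) / (1 + γ ^ 2 * Real.exp s ^ 2)) := by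
      have hp := Real.exp_pos s
      rw [← mul_div_assoc, div_le_div_iff₀ (by positivity) (by positivity), one_mul]
      have h3 : γ ^ 2 * Real.exp s ^ 2 ≤ 4 := by nlinarith
      have h4 : 1 ≤ (γ * Real.exp s) ^ 3 := one_le_pow₀ h1
      have h5 : Real.exp s * (γ * (1 + Real.exp s ^ 2)) * (5 * γ ^ 2) =
          5 * (γ * Real.exp s) ^ 3 + 5 * (γ * Real.exp s) * γ ^ 2 := by ring
      rw [h5]
      nlinarith [mul_pos (mul_pos hγ hp) (pow_pos hγ 2)]
    calc Real.exp (-6) / (5 * γ ^ 2) = Real.exp (-6) * (1 / (5 * γ ^ 2)) := by ring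
      _ ≤ _ := mul_le_mul e1 e2 (by positivity) (Real.exp_pos _).le

/-! ### Testing the kernel bound at two points of a normal line. -/

theorem diracKernel_one (γ : ℝ) (x x' : ℝ × ℝ) : diracKernel γ 1 x x' = unitKernel γ x x' := by
  rw [diracKernel_of_pos one_pos, one_smul, one_smul, Complex.ofReal_one, one_smul]

theorem KernelBound.norm_unitKernel_le {C : ℝ → ℝ → ℝ} (hC : KernelBound diracKernel C) {γ c : ℝ}
    (hγ : 0 < γ) (hc : c ∈ Ioo (0 : ℝ) 1) {r t : ℝ} (hr : 0 < r) (ht : 0 < t) (j k : Fin 2) :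
    ‖unitKernel γ (0, t + r) (0, t) j k‖ ≤ C γ c * (Real.exp (-(c * r)) / r) := by
  have h := hC γ hγ c hc 1 one_ne_zero (0, t + r) (show 0 < t + r by positivity) (0, t) ht
    fun h => by simpa [hr.ne'] using congrArg Prod.snd h
  have hd : euclDist (0, t + r) (0, t) = r := by
    rw [euclDist]
    simp only [sub_self, add_sub_cancel_left]
    rw [zero_pow two_ne_zero, zero_add, Real.sqrt_sq hr.le]
  rw [diracKernel_one, hd, abs_one, mul_one] at h
  exact (norm_le_matSup _ j k).trans h

/-- The diagonal entries of the free kernel are purely imaginary, so the real part isolates the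
boundary term. -/
theorem re_unitKernel_zero {γ : ℝ} {r t : ℝ} : (unitKernel γ (0, t + r) (0, t) 0 0).re =
    (stripKernel (symb γ 1) (0, t + r + t)).re := by
  rw [unitKernel, Matrix.add_apply, Complex.add_re]
  have : (1 / (4 * Real.pi) : ℂ) = ((1 / (4 * Real.pi) : ℝ) : ℂ) := by push_cast; rfl
  simp only [planeKernel, mirrorKernel, Matrix.of_apply, Matrix.cons_val_zero, Matrix.cons_val',
    Matrix.cons_val_fin_one, this, Complex.re_ofReal_mul, Complex.re_mul_ofReal, Complex.I_re,
    zero_mul, mul_zero, zero_add, sub_self]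

theorem re_unitKernel_one {γ : ℝ} {r t : ℝ} : (unitKernel γ (0, t + r) (0, t) 1 1).re =
    -(stripKernel (symb γ (-1)) (0, t + r + t)).re := by
  rw [unitKernel, Matrix.add_apply, Complex.add_re]
  have : (1 / (4 * Real.pi) : ℂ) = ((1 / (4 * Real.pi) : ℝ) : ℂ) := by push_cast; rfl
  simp only [planeKernel, mirrorKernel, Matrix.of_apply, Matrix.cons_val_one, Matrix.cons_val',
    Matrix.cons_val_fin_one, this, Complex.re_ofReal_mul, Complex.re_mul_ofReal, Complex.I_re,
    zero_mul, mul_zero, zero_add, sub_self, Complex.neg_re]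

/-- The constant in the lower bounds for `γ → 0` and `γ → ∞`. -/
def lowerConst : ℝ := 1 / (4 * Real.pi) * (Real.log 2 * (Real.exp (-6) / 5))

theorem lowerConst_pos : 0 < lowerConst := by
  have := Real.log_pos one_lt_two
  unfold lowerConst
  positivity

/-- At scale δ the kernel is at least of order δ⁻², while the bound allows B/δ. The height 3δ is the
sum 2δ + δ of the heights of two points at distance δ. -/
theorem lowerConst_div_le_of_le {δ c N : ℝ} (hδ : 0 < δ) (hδ1 : δ ≤ 1) (hc : 0 < c) {B : ℝ}
    (hB : 1 / (4 * Real.pi) * (∫ s, normalIntegrand δ (3 * δ) s) ≤ N)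
    (hN : N ≤ B * (Real.exp (-(c * δ)) / δ)) : lowerConst / δ ≤ B := by
  have h1 : lowerConst / δ ^ 2 ≤ N := by
    refine le_trans (le_of_eq ?_) ((mul_le_mul_of_nonneg_left
      (le_integral_normalIntegrand hδ hδ1) (by positivity)).trans hB)
    rw [lowerConst]
    field_simp
  have h2 := h1.trans hN
  have hl := lowerConst_pos
  have hB0 : 0 < B := by
    by_contra hneg
    have : B * (Real.exp (-(c * δ)) / δ) ≤ 0 :=
      mul_nonpos_of_nonpos_of_nonneg (not_lt.1 hneg) (by positivity)
    have : 0 < lowerConst / δ ^ 2 := by positivity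
    linarith
  have h3 : Real.exp (-(c * δ)) ≤ 1 := Real.exp_le_one_iff.2 (by nlinarith)
  have h4 : lowerConst / δ ^ 2 ≤ B / δ := h2.trans (by
    rw [← mul_div_assoc]
    gcongr
    exact mul_le_of_le_one_right hB0.le h3)
  rw [div_le_div_iff₀ (by positivity) hδ] at h4
  rw [div_le_iff₀ hδ]
  nlinarith

theorem KernelBound.lowerConst_div_le {C : ℝ → ℝ → ℝ} (hC : KernelBound diracKernel C) {γ c : ℝ}
    (hγ : 0 < γ) (hγ1 : γ ≤ 1) (hc : c ∈ Ioo (0 : ℝ) 1) : lowerConst / γ ≤ C γ c := by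
  refine lowerConst_div_le_of_le hγ hγ1 hc.1 ?_ (hC.norm_unitKernel_le hγ hc hγ hγ 0 0)
  rw [← re_stripKernel_symb_one hγ (by positivity), show 3 * γ = γ + γ + γ by ring,
    ← re_unitKernel_zero]
  exact Complex.re_le_norm _

theorem KernelBound.lowerConst_mul_le {C : ℝ → ℝ → ℝ} (hC : KernelBound diracKernel C) {γ c : ℝ}
    (hγ1 : 1 ≤ γ) (hc : c ∈ Ioo (0 : ℝ) 1) : lowerConst * γ ≤ C γ c := by
  have hγ : 0 < γ := one_pos.trans_le hγ1
  have hi := inv_pos.2 hγ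
  rw [← div_inv_eq_mul]
  refine lowerConst_div_le_of_le hi (inv_le_one_of_one_le₀ hγ1) hc.1 ?_
    (hC.norm_unitKernel_le hγ hc hi hi 1 1)
  rw [← re_stripKernel_symb_neg_one hγ (by positivity), show 3 * γ⁻¹ = γ⁻¹ + γ⁻¹ + γ⁻¹ by ring,
    ← neg_neg (stripKernel _ _).re, ← re_unitKernel_one, ← norm_neg, ← Complex.neg_re]
  exact Complex.re_le_norm _

/-- Only the window 0 ≤ s ≤ r^{-1/2} is kept: there cosh s ≤ 1 + s² gives r cosh s ≤ r + 1, and e^s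
≥ 1. -/
theorem exp_div_sqrt_le_besselInt {r : ℝ} (hr : 1 ≤ r) :
    Real.exp (-(r + 1)) / Real.sqrt r ≤ besselInt 1 r := by
  have hr0 : 0 < r := one_pos.trans_le hr
  have hs : 0 < Real.sqrt r := Real.sqrt_pos.2 hr0
  have h := const_mul_le_integral (a := 0) (b := 1 / Real.sqrt r) (m := Real.exp (-(r + 1)))
    (integrable_besselInt abs_one_le_one hr0) (fun s => by positivity) (by positivity) fun s hs' => ?_
  · rw [sub_zero, one_div, inv_mul_eq_div] at h
    exact h
  · have h0 : 0 ≤ s := hs'.1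
    have h1 : r * s ^ 2 ≤ 1 := by
      have := hs'.2
      rw [le_div_iff₀ hs] at this
      have h2 : (s * Real.sqrt r) ^ 2 ≤ 1 := pow_le_one₀ (by positivity) this
      rwa [mul_pow, Real.sq_sqrt hr0.le, mul_comm] at h2
    have h2 : s ^ 2 ≤ 1 := le_trans (by nlinarith [sq_nonneg s]) h1
    have h3 : Real.cosh s ≤ 1 + s ^ 2 := by
      refine (Real.cosh_le_exp_half_sq s).trans
        ((Real.exp_bound_div_one_sub_of_interval (by positivity) (by linarith)).trans ?_)
      rw [div_le_iff₀ (by linarith)]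
      nlinarith [sq_nonneg s]
    rw [← Real.exp_add]
    refine Real.exp_le_exp.2 ?_
    nlinarith

theorem unitKernel_zero_one {γ : ℝ} {r t : ℝ} (hr : 0 < r) : unitKernel γ (0, t + r) (0, t) 0 1 =
    ((1 / (4 * Real.pi) * besselInt 1 r : ℝ) : ℂ) +
      Complex.I * stripKernel (symb γ 0) (0, t + r + t) := by
  have hn : euclNorm (((0 : ℝ), t + r) - (0, t)) = r := by
    rw [euclNorm]
    simp only [Prod.fst_sub, Prod.snd_sub, sub_self, add_sub_cancel_left]
    rw [zero_pow two_ne_zero, zero_add, Real.sqrt_sq hr.le]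
  have hr' : (r : ℂ) ≠ 0 := Complex.ofReal_ne_zero.2 hr.ne'
  rw [unitKernel, Matrix.add_apply, planeKernel, hn]
  simp [mirrorKernel, hr']

/-- Both points move away from the boundary at fixed distance r. The free part does not change and
the boundary part tends to 0; the height D/ε makes it at most ε. -/
theorem KernelBound.besselInt_le {C : ℝ → ℝ → ℝ} (hC : KernelBound diracKernel C) {γ c : ℝ}
    (hγ : 0 < γ) (hc : c ∈ Ioo (0 : ℝ) 1) {r : ℝ} (hr : 0 < r) :
    1 / (4 * Real.pi) * besselInt 1 r ≤ C γ c * (Real.exp (-(c * r)) / r) := by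
  obtain ⟨D, hD, h⟩ := exists_norm_stripKernel_symb_le hγ (c := 1 / 2) (by norm_num) (by norm_num)
  refine le_of_forall_pos_le_add fun ε hε => ?_
  have ht : 0 < D / ε := by positivity
  have h1 := hC.norm_unitKernel_le hγ hc hr ht 0 1
  rw [unitKernel_zero_one hr] at h1
  have hy : 0 < D / ε + r + D / ε := by positivity
  have h2 := h 0 abs_zero_le_one (0, D / ε + r + D / ε) hy
  have hn : euclNorm ((0 : ℝ), D / ε + r + D / ε) = D / ε + r + D / ε := by
    rw [euclNorm]
    simp only
    rw [zero_pow two_ne_zero, zero_add, Real.sqrt_sq hy.le]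
  rw [hn] at h2
  have h3 : D * (Real.exp (-(1 / 2 * (D / ε + r + D / ε))) / (D / ε + r + D / ε)) ≤ ε := by
    rw [← mul_div_assoc, div_le_iff₀ hy]
    have e1 : Real.exp (-(1 / 2 * (D / ε + r + D / ε))) ≤ 1 :=
      Real.exp_le_one_iff.2 (by linarith)
    have e2 : ε * (D / ε) = D := by field_simp
    nlinarith [mul_pos hε hr]
  have h4 := (Complex.re_le_norm _).trans (norm_sub_le
    (((1 / (4 * Real.pi) * besselInt 1 r : ℝ) : ℂ) +
      Complex.I * stripKernel (symb γ 0) (0, D / ε + r + D / ε))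
    (Complex.I * stripKernel (symb γ 0) (0, D / ε + r + D / ε)))
  rw [add_sub_cancel_right, Complex.ofReal_re, norm_mul Complex.I, Complex.norm_I, one_mul] at h4
  linarith

/-- At r = 1/(1 - c) one has cr = r - 1, so e^{-r} and e^{-cr} differ only by a fixed factor.
Comparing r^{-1/2} with C/r then leaves √r. -/
theorem KernelBound.sqrt_le {C : ℝ → ℝ → ℝ} (hC : KernelBound diracKernel C) {γ c : ℝ}
    (hγ : 0 < γ) (hc : c ∈ Ioo (0 : ℝ) 1) :
    Real.exp (-2) / (4 * Real.pi) * Real.sqrt (1 - c)⁻¹ ≤ C γ c := by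
  set r := (1 - c)⁻¹ with hr
  have h1c : 0 < 1 - c := sub_pos.2 hc.2
  have hr1 : 1 ≤ r := (one_le_inv₀ h1c).2 (by linarith [hc.1])
  have hr0 : 0 < r := one_pos.trans_le hr1
  have hs : 0 < Real.sqrt r := Real.sqrt_pos.2 hr0
  have hss : Real.sqrt r * Real.sqrt r = r := Real.mul_self_sqrt hr0.le
  have h := (mul_le_mul_of_nonneg_left (exp_div_sqrt_le_besselInt hr1)
    (by positivity : 0 ≤ 1 / (4 * Real.pi))).trans (hC.besselInt_le hγ hc hr0)
  have hcr : c * r = r - 1 := by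
    rw [hr]
    field_simp
    ring
  have e : Real.exp (-(r + 1)) = Real.exp (-2) * Real.exp (-(c * r)) := by
    rw [← Real.exp_add, hcr]
    congr 1
    ring
  have hE := Real.exp_pos (-(c * r))
  rw [e] at h
  have h' : 1 / (4 * Real.pi) * (Real.exp (-2) * Real.exp (-(c * r)) / Real.sqrt r) =
      (Real.exp (-2) / (4 * Real.pi) * Real.sqrt r) * (Real.exp (-(c * r)) / r) := by
    have hinv : 1 / Real.sqrt r = Real.sqrt r / r := by
      rw [div_eq_div_iff hs.ne' hr0.ne', hss, one_mul]
    rw [div_eq_mul_one_div _ (Real.sqrt r), hinv]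
    ring
  rw [h'] at h
  exact le_of_mul_le_mul_right h (by positivity)

end HalfPlaneDirac

end

theorem proposition2p3 :
    ∃ K : ℝ → ℝ → ℝ × ℝ → ℝ × ℝ → Matrix (Fin 2) (Fin 2) ℂ,
      -- `K γ lam` is the kernel of the resolvent at `i lam`
      (∀ γ : ℝ, 0 < γ → ∀ lam : ℝ, lam ≠ 0 →
        IsResolventKernel γ (Complex.I * (lam : ℂ)) (K γ lam)) ∧
      -- it is given explicitly by a partial Fourier transform for `lam > 0`,
      (∀ γ : ℝ, 0 < γ → ∀ lam : ℝ, 0 < lam → ∀ x ∈ halfPlane, ∀ x' ∈ halfPlane, x.2 ≠ x'.2 →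
        K γ lam x x' = (lam : ℂ) • freeKernel γ (lam • x) (lam • x')) ∧
      -- and for `lam < 0` by passing to the adjoint
      (∀ γ : ℝ, 0 < γ → ∀ lam : ℝ, lam < 0 → ∀ x ∈ halfPlane, ∀ x' ∈ halfPlane, x ≠ x' →
        K γ lam x x' = (K γ (-lam) x' x)ᴴ) ∧
      -- the estimate holds with some constants that depend on `γ` and `c` only
      (∃ C : ℝ → ℝ → ℝ, KernelBound K C) ∧
      -- and all such constants diverge in the three limits
      (∀ C : ℝ → ℝ → ℝ, KernelBound K C →
        (∀ c ∈ Ioo (0 : ℝ) 1, Tendsto (fun γ => C γ c) (𝓝[>] 0) atTop) ∧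
        (∀ c ∈ Ioo (0 : ℝ) 1, Tendsto (fun γ => C γ c) atTop atTop) ∧
        (∀ γ : ℝ, 0 < γ → Tendsto (fun c => C γ c) (𝓝[<] 1) atTop)) := by
  refine ⟨diracKernel, fun γ hγ lam hlam => isResolventKernel_diracKernel hγ hlam,
    fun γ hγ lam hlam x hx x' hx' hne => ?_,
    fun γ _ lam hlam x _ x' _ _ => diracKernel_of_neg hlam x x',
    exists_kernelBound_diracKernel, fun C hC => ⟨fun c hc => ?_, fun c hc => ?_, fun γ hγ => ?_⟩⟩
  · rw [diracKernel_of_pos hlam, freeKernel_eq_unitKernel hγ (smul_mem_halfPlane hlam hx)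
      (smul_mem_halfPlane hlam hx') fun h => hne (mul_left_cancel₀ hlam.ne' h)]
  · refine tendsto_atTop_mono' _ ?_ (tendsto_inv_nhdsGT_zero.const_mul_atTop lowerConst_pos)
    filter_upwards [Ioc_mem_nhdsGT one_pos] with γ hγ
    exact hC.lowerConst_div_le hγ.1 hγ.2 hc
  · refine tendsto_atTop_mono' _ ?_ (tendsto_id.const_mul_atTop lowerConst_pos)
    filter_upwards [eventually_ge_atTop 1] with γ hγ
    exact hC.lowerConst_mul_le hγ hc
  · have hlim : Tendsto (fun c : ℝ => (1 - c)⁻¹) (𝓝[<] 1) atTop := by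
      refine tendsto_inv_nhdsGT_zero.comp (tendsto_nhdsWithin_iff.2 ⟨?_, ?_⟩)
      · have h : Tendsto (fun c : ℝ => 1 - c) (𝓝 1) (𝓝 (1 - 1)) :=
          (continuous_const.sub continuous_id).tendsto 1
        rw [sub_self] at h
        exact h.mono_left nhdsWithin_le_nhds
      · filter_upwards [self_mem_nhdsWithin] with c hc
        have hc : c < 1 := hc
        exact sub_pos.2 hc
    refine tendsto_atTop_mono' _ ?_ ((Real.tendsto_sqrt_atTop.comp hlim).const_mul_atTop
      (by positivity : 0 < Real.exp (-2) / (4 * Real.pi)))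
    filter_upwards [Ioo_mem_nhdsLT one_pos] with c hc
    exact hC.sqrt_le hγ hc
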